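/- Let $k$ be an algebraically closed field of characteristic $p>0$. A foliation $\mathcal F$ on a smooth surface $X$ over $k$ is a saturated subsheaf $T_{\mathcal F}\subset T_X$ of rank one (automatically closed under Lie brackets); locally it is given by a generator $v$ of $T_{\mathcal F}$ and a generator $\omega$ of the conormal sheaf $N_{\mathcal F}^*\subset\Omega^1_X$, both with isolated zeros and with $i_v\omega=0$. It is $p$-closed if $T_{\mathcal F}$ is closed under $v\mapsto v^p$. If it is not $p$-closed, its $p$-divisor $\Delta_{\mathcal F}$ is the zero divisor of the section of $(\Omega^1_{\mathcal F})^{\otimes p}\otimes N_{\mathcal F}$ given locally by $i_{v^p}\omega$, where $\Omega^1_{\mathcal F}=T_{\mathcal F}^*$; a canonical divisor $K_{\mathcal F}$ is any divisor in the class of $\Omega^1_{\mathcal F}$. A foliation on $\mathbb P^2_k$ has degree $d$ if it is defined by a homogeneous $1$-form $A_0\,dX_0+A_1\,dX_1+A_2\,dX_2$ with $A_j$ homogeneous of degree $d+1$, $\sum_j X_jA_j=0$, and finitely many common zeros of the $A_j$ in $\mathbb P^2_k$. A divisor $\Delta$ has a $p$-factor if $pD\le\Delta$ for some effective divisor $D\neq0$.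 **Proposition.** Let $\mathcal F$ be a foliation of degree $d$ on $\mathbb P^2_k$ that is not $p$-closed, and let $Q\in\mathbb P^2_k$ be a closed point that is neither a singular point of $\mathcal F$ nor a point of the support of $\Delta_{\mathcal F}$. Let $\mathcal G=\mathrm{Bl}_Q^*\mathcal F$ be the induced foliation on the blowup $\mathrm{Bl}_Q(\mathbb P^2_k)$. Then $\mathcal G$ is not $p$-closed, and its $p$-divisor $\Delta_{\mathcal G}$ contains the exceptional divisor $E$ with multiplicity exactly $p$; in particular $\Delta_{\mathcal G}$ has a $p$-factor. Moreover, identifying $\mathrm{Bl}_Q(\mathbb P^2_k)$ with the Hirzebruch surface $\Sigma_1=\mathbb P(\mathcal O_{\mathbb P^1}\oplus\mathcal O_{\mathbb P^1}(1))$, every canonical divisor of $\mathcal G$ satisfies the numerical equivalence $$K_{\mathcal G}\equiv -F+dM_1,$$ where $F$ is any fibre of $\Sigma_1\to\mathbb P^1$ and $M_1$ is any section of it with $M_1\cdot F=1$ and $M_1^2=1$. -/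

import Mathlib

open scoped KaehlerDifferential

noncomputable section

namespace FoliatedSurface

/-! ## The `p`-th power of a derivation -/

section PPower

variable {k K : Type*} [Field k] [Field K] [Algebra k K]

/-- Leibniz' formula for the iterates of a derivation. -/
theorem iterate_leibniz (D : Derivation k K K) (n : ℕ) (a b : K) :
    D^[n] (a * b) = ∑ i ∈ Finset.range (n + 1), (n.choose i : K) * (D^[i] a * D^[n - i] b) := by
  induction n generalizing a b with
  | zero => simp
  | succ n ih =>
    rw [Function.iterate_succ_apply, D.leibniz, smul_eq_mul, smul_eq_mul, iterate_map_add, ih,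
      mul_comm b, ih]
    have e := Finset.sum_range_succ' (fun i => (n.choose i : K) * (D^[i] a * D^[n - i] (D b))) n
    have e' := Finset.sum_range_succ (fun i => (n.choose i : K) * (D^[i] (D a) * D^[n - i] b)) n
    rw [Finset.sum_range_succ' _ (n + 1), e, e']
    have h : ∀ i ∈ Finset.range n, ((n + 1).choose (i + 1) : K)
        * (D^[i + 1] a * D^[n + 1 - (i + 1)] b)
        = (n.choose i : K) * (D^[i] (D a) * D^[n - i] b)
          + (n.choose (i + 1) : K) * (D^[i + 1] a * D^[n - (i + 1)] (D b)) := by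
      intro i hi
      have hi' : i < n := Finset.mem_range.mp hi
      have e1 : n + 1 - (i + 1) = n - i := by omega
      have e2 : n - i = (n - (i + 1)) + 1 := by omega
      rw [Nat.choose_succ_succ, e1, ← Function.iterate_succ_apply D (n - (i + 1)) b, e2,
        ← Function.iterate_succ_apply D i a]
      push_cast
      ring
    rw [Finset.sum_range_succ _ n, Finset.sum_congr rfl h, Finset.sum_add_distrib]
    simp only [Nat.choose_self, Nat.choose_zero_right, Nat.sub_self, Nat.sub_zero,
      Function.iterate_zero, id, Function.iterate_succ_apply]
    ring

variable (p : ℕ) [Fact p.Prime] [CharP k p]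

/-- In characteristic `p` the `p`-th iterate of a derivation `D` is again a derivation, `D ^ p`. -/
def pPow (D : Derivation k K K) : Derivation k K K :=
  Derivation.mk' ((D : K →ₗ[k] K) ^ p) (by
    intro a b
    have hK : CharP K p := charP_of_injective_algebraMap (algebraMap k K).injective p
    have hp : p.Prime := Fact.out
    have key : D^[p] (a * b) = a * D^[p] b + b * D^[p] a := by
      rw [iterate_leibniz, Finset.sum_range_succ, Finset.sum_eq_single 0]
      · simp [mul_comm b]
      · intro i hi h0
        have hd : p ∣ p.choose i :=
          hp.dvd_choose_self h0 (Finset.mem_range.mp hi)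
        rw [(CharP.cast_eq_zero_iff K p _).mpr hd, zero_mul]
      · intro h
        exact absurd (Finset.mem_range.mpr hp.pos) h
    simpa [Module.End.pow_apply] using key)

theorem pPow_apply (D : Derivation k K K) (a : K) : pPow p D a = D^[p] a := by
  simp [pPow, Module.End.pow_apply]

end PPower

/-! ## Models of a function field

A surface with function field `K` is given by the set of the local rings `𝒪_{X,x} ⊆ K` of all its
(scheme-theoretic) points `x`, the generic point included.  A point of `X` is identified with its
local ring; `y` is a specialization of `x` iff `𝒪_{X,y} ⊆ 𝒪_{X,x}`, and a birational map that
induces the identity of `K` is a morphism `Y → X` near a point `y` iff `𝒪_{Y,y}` dominates some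
`𝒪_{X,x}` (the order `≤` of `LocalSubring` is domination), and then `y ↦ x`. -/

section Models

variable {k K : Type*} [Field k] [Field K] [Algebra k K]

/-- The model glued from affine charts `Spec A`, `A ⊆ K`: all local rings `A_P`, `P` prime. -/
def modelOfCharts (charts : Set (Subalgebra k K)) : Set (LocalSubring K) :=
  {R | ∃ A ∈ charts, ∃ (P : Ideal A.toSubring) (_ : P.IsPrime),
    R = LocalSubring.ofPrime A.toSubring P}

variable (k) in
/-- `K` is the rational function field `k(x, y)` in the two variables `x, y`. -/
def IsCoordinates (x y : K) : Prop :=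
  AlgebraicIndependent k ![x, y] ∧ IntermediateField.adjoin k {x, y} = ⊤

variable (k) in
/-- The projective plane with homogeneous coordinates `(1 : x : y)`; the chart `D₊(X_i)` has the
coordinate ring `k[X_j / X_i]`. -/
def projectivePlane (x y : K) : Set (LocalSubring K) :=
  modelOfCharts (Set.range fun i : Fin 3 =>
    Algebra.adjoin k (Set.range fun j : Fin 3 => ![1, x, y] j / ![1, x, y] i))

variable (k) in
/-- The Hirzebruch surface `Σ_n = ℙ(𝒪 ⊕ 𝒪(n))` over `ℙ¹`, where `t` is an affine coordinate of
the base `ℙ¹` and `s` is an affine coordinate of the fibres over `t ≠ ∞`.  The fibre coordinate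
over `t ≠ 0` is `t ^ n * s`, so `{s = 0}` is the section of self-intersection `-n`. -/
def hirzebruch (n : ℕ) (t s : K) : Set (LocalSubring K) :=
  modelOfCharts {Algebra.adjoin k {t, s}, Algebra.adjoin k {t, s⁻¹},
    Algebra.adjoin k {t⁻¹, t ^ n * s}, Algebra.adjoin k {t⁻¹, (t ^ n * s)⁻¹}}

/-- The rational function `f` is regular and vanishes at the point with local ring `R`. -/
def VanishesAt (R : LocalSubring K) (f : K) : Prop :=
  ∃ h : f ∈ R.toSubring, (⟨f, h⟩ : R.toSubring) ∈ IsLocalRing.maximalIdeal R.toSubring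

/-- Closed points: points of `X` without a specialization in `X` other than themselves. -/
def IsClosedPoint (X : Set (LocalSubring K)) (Q : LocalSubring K) : Prop :=
  Q ∈ X ∧ ∀ R ∈ X, R.toSubring ≤ Q.toSubring → R = Q

/-- The blowup of `X` at the closed point `Q`, with `𝔪` the maximal ideal of `𝒪_Q`: the points of
`X` other than `Q`, and the points over `Q` of the charts `Spec 𝒪_Q[𝔪 / f]`, `0 ≠ f ∈ 𝔪`, of the
blowup of `Spec 𝒪_Q` along `𝔪`. -/
def blowup (X : Set (LocalSubring K)) (Q : LocalSubring K) : Set (LocalSubring K) :=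
  {R | R ∈ X ∧ R ≠ Q} ∪
  {R | Q ≤ R ∧ ∃ f : K, f ≠ 0 ∧ VanishesAt Q f ∧
    ∃ (N : Ideal (Subring.closure
        ((Q.toSubring : Set K) ∪ {h : K | ∃ g : K, VanishesAt Q g ∧ h = g / f})))
      (_ : N.IsPrime), R = LocalSubring.ofPrime _ N}

/-! ## Divisors -/

/-- Prime divisors of a normal surface: the points of codimension one, i.e. those whose local ring
is a discrete valuation ring. -/
def PrimeDivisor (X : Set (LocalSubring K)) : Type _ :=
  {R : LocalSubring K // R ∈ X ∧ IsDiscreteValuationRing R.toSubring}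

/-- Weil divisors, as families of multiplicities. -/
abbrev Divisor (X : Set (LocalSubring K)) : Type _ := PrimeDivisor X → ℤ

open scoped Classical in
/-- A prime divisor as a divisor. -/
def single {X : Set (LocalSubring K)} (C : PrimeDivisor X) : Divisor X :=
  fun C' => if C' = C then 1 else 0

/-- The order `n` of `f ≠ 0` at a discrete valuation ring `R` of `K`: `f = u * ϖ ^ n` with `u` a
unit and `ϖ` a uniformizer. -/
def ordAt (R : LocalSubring K) (f : K) : ℤ :=
  Classical.epsilon fun n : ℤ => ∃ ϖ : R.toSubring, Irreducible ϖ ∧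
    ∃ u : (R.toSubring)ˣ, f = ((u : R.toSubring) : K) * (ϖ : K) ^ n

/-- Linear equivalence of divisors. -/
def LinEquiv {X : Set (LocalSubring K)} (D D' : Divisor X) : Prop :=
  ∃ f : K, f ≠ 0 ∧ ∀ C : PrimeDivisor X, D C - D' C = ordAt C.1 f

/-- An effective divisor (with finite support). -/
def IsEffective {X : Set (LocalSubring K)} (D : Divisor X) : Prop :=
  (Function.support D).Finite ∧ ∀ C, 0 ≤ D C

/-- The stalk at `x` of the ideal sheaf `𝒪_X(-D)` of an effective divisor `D`. -/
def idealAt {X : Set (LocalSubring K)} (D : Divisor X) (x : LocalSubring K) :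
    Ideal x.toSubring :=
  Ideal.span {h | h = 0 ∨ ∀ C : PrimeDivisor X, x.toSubring ≤ C.1.toSubring →
    D C ≤ ordAt C.1 (h : K)}

/-- The local intersection multiplicity at `x` of two effective divisors without common component:
the length of `𝒪_x / (f, g)`, where `f` and `g` are local equations. -/
def localIntersection {X : Set (LocalSubring K)} (D D' : Divisor X) (x : LocalSubring K) : ℕ :=
  (Module.length x.toSubring (x.toSubring ⧸ (idealAt D x ⊔ idealAt D' x))).toNat

/-- The intersection number `D · C` of a divisor with a prime divisor on a smooth projective
surface: replace `D` by a linearly equivalent difference `D₁ - D₂` of effective divisors that do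
not contain `C`, and count the intersections of `D₁` and `D₂` with `C` with multiplicity. -/
def intersection {X : Set (LocalSubring K)} (D : Divisor X) (C : PrimeDivisor X) : ℤ :=
  Classical.epsilon fun n : ℤ => ∃ D₁ D₂ : Divisor X, IsEffective D₁ ∧ IsEffective D₂ ∧
    D₁ C = 0 ∧ D₂ C = 0 ∧ LinEquiv D (D₁ - D₂) ∧
    n = ((∑ᶠ x : X, localIntersection D₁ (single C) x.1 : ℕ) : ℤ)
      - ((∑ᶠ x : X, localIntersection D₂ (single C) x.1 : ℕ) : ℤ)

/-- Numerical equivalence of divisors. -/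
def NumEquiv {X : Set (LocalSubring K)} (D D' : Divisor X) : Prop :=
  ∀ C : PrimeDivisor X, intersection D C = intersection D' C

/-- `D` has a `p`-factor: `p D' ≤ D` for some effective divisor `D' ≠ 0`. -/
def HasPFactor (p : ℕ) {X : Set (LocalSubring K)} (D : Divisor X) : Prop :=
  ∃ D' : Divisor X, IsEffective D' ∧ D' ≠ 0 ∧ ∀ C, (p : ℤ) * D' C ≤ D C

/-- The exceptional divisors of the blowup at `Q`: the prime divisors that lie over `Q`. -/
def IsExceptional {X : Set (LocalSubring K)} (Q : LocalSubring K)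
    (E : PrimeDivisor (blowup X Q)) : Prop :=
  Q ≤ E.1

variable (k) in
/-- A fibre of a surface that is fibred over `ℙ¹` by the rational function `t`: a prime divisor on
which `t` takes a constant value `c ∈ ℙ¹(k)`. -/
def IsFibre {X : Set (LocalSubring K)} (t : K) (C : PrimeDivisor X) : Prop :=
  (∃ c : k, VanishesAt C.1 (t - algebraMap k K c)) ∨ VanishesAt C.1 t⁻¹

variable (k) in
/-- A section `M_n` of `Σ_n` over `ℙ¹` of self-intersection `n`: the closure of a curve
`s⁻¹ = P(t)` with `deg P ≤ n`, which is disjoint from the section `s = 0`. -/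
def IsPositiveSection {X : Set (LocalSubring K)} (n : ℕ) (t s : K) (C : PrimeDivisor X) : Prop :=
  ∃ P : Polynomial k, P.natDegree ≤ n ∧ VanishesAt C.1 (s⁻¹ - Polynomial.aeval t P)

end Models

/-! ## Foliations -/

section Foliations

variable {k K : Type*} [Field k] [Field K] [Algebra k K]

variable (k K) in
/-- A foliation on a smooth surface `X` with function field `K`.  A saturated rank one subsheaf
`T_F` of the tangent sheaf `T_X` is determined by its stalk at the generic point, a line in
`T_K = Der_k(K)`, and every line occurs: its stalks are `T_{F,x} = T_{X,x} ∩ line`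
(`tangentStalk`).  In rank one `T_F` is always closed under Lie brackets.  The pullback of `F`
under a birational morphism is given by the same line. -/
structure Foliation where
  line : Submodule K (Derivation k K K)
  finrank_line : Module.finrank K line = 1

/-- The contraction `i_v ω` of a rational `1`-form with a rational vector field. -/
def contract (v : Derivation k K K) (ω : Ω[K⁄k]) : K := v.liftKaehlerDifferential ω

/-- The stalk `T_{F,x} ⊆ T_{X,x} = Der_k(𝒪_x)` of the tangent sheaf of the foliation. -/
def tangentStalk (F : Foliation k K) (x : LocalSubring K) :
    Submodule x.toSubring (Derivation k K K) where
  carrier := {v | v ∈ F.line ∧ ∀ f ∈ x.toSubring, v f ∈ x.toSubring}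
  add_mem' := fun {v w} hv hw => ⟨F.line.add_mem hv.1 hw.1, fun f hf => by
    simpa using x.toSubring.add_mem (hv.2 f hf) (hw.2 f hf)⟩
  zero_mem' := ⟨F.line.zero_mem, fun f _ => by simp⟩
  smul_mem' := fun c v hv => ⟨F.line.smul_mem (c : K) hv.1, fun f hf =>
    x.toSubring.mul_mem c.2 (hv.2 f hf)⟩

/-- The stalk at `x` of the conormal sheaf `N_F^* ⊆ Ω_X^1`: the regular `1`-forms at `x` that
vanish on the foliation. -/
def conormalStalk (F : Foliation k K) (x : LocalSubring K) : Submodule x.toSubring (Ω[K⁄k]) :=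
  Submodule.span x.toSubring (KaehlerDifferential.D k K '' (x.toSubring : Set K)) ⊓
  { carrier := {ω | ∀ v ∈ F.line, contract v ω = 0}
    add_mem' := fun {a b} ha hb v hv => by
      simp only [contract, map_add] at *
      rw [show v.liftKaehlerDifferential a = 0 from ha v hv,
        show v.liftKaehlerDifferential b = 0 from hb v hv, add_zero]
    zero_mem' := fun v _ => by simp [contract]
    smul_mem' := fun c a ha v hv => by
      have h : v.liftKaehlerDifferential ((c : K) • a) = 0 := by
        rw [map_smul, show v.liftKaehlerDifferential a = 0 from ha v hv, smul_zero]
      exact h }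

/-- `m` generates the cyclic submodule `N`. -/
def IsGenerator {R M : Type*} [CommRing R] [AddCommGroup M] [Module R M] (N : Submodule R M)
    (m : M) : Prop :=
  N = Submodule.span R {m}

/-- The singular points of the foliation: the points at which all its local vector fields
vanish. -/
def IsSingular (F : Foliation k K) (x : LocalSubring K) : Prop :=
  ∀ v ∈ tangentStalk F x, ∀ f ∈ x.toSubring, VanishesAt x (v f)

/-- The foliation on the projective plane has degree `d`: it is defined by a homogeneous `1`-form
`A₀ dX₀ + A₁ dX₁ + A₂ dX₂`, with `A_j` homogeneous of degree `d + 1` and `∑ X_j A_j = 0`, that has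
finitely many zeros in the plane. -/
def HasDegree (x y : K) (F : Foliation k K) (d : ℕ) : Prop :=
  ∃ A : Fin 3 → MvPolynomial (Fin 3) k,
    (∀ j, (A j).IsHomogeneous (d + 1)) ∧
    ∑ j, MvPolynomial.X j * A j = 0 ∧
    {P : Projectivization k (Fin 3 → k) | ∀ j, MvPolynomial.eval P.rep (A j) = 0}.Finite ∧
    ∀ v : Derivation k K K, v ∈ F.line ↔
      contract v (∑ j, MvPolynomial.aeval ![1, x, y] (A j) •
        KaehlerDifferential.D k K (![1, x, y] j)) = 0

/-- The canonical divisor `K_F` defined by a rational section `v ≠ 0` of `T_F`: minus the divisor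
of zeros and poles of `v`.  As `v` runs through the line of `F`, these are all the divisors of the
class of the line bundle `Ω_F^1 = T_F^*`. -/
def canonicalDivisor (X : Set (LocalSubring K)) (F : Foliation k K) (v : Derivation k K K) :
    Divisor X :=
  fun C => -(Classical.epsilon fun n : ℤ => ∃ (w : Derivation k K K) (f : K),
    IsGenerator (tangentStalk F C.1) w ∧ v = f • w ∧ n = ordAt C.1 f)

section

variable (p : ℕ) [Fact p.Prime] [CharP k p]

/-- The foliation is `p`-closed: its tangent sheaf is closed under `p`-th powers. -/
def IsPClosed (X : Set (LocalSubring K)) (F : Foliation k K) : Prop :=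
  ∀ x ∈ X, ∀ v ∈ tangentStalk F x, pPow p v ∈ tangentStalk F x

/-- The `p`-divisor: the divisor of zeros of the section of `(Ω_F^1)^{⊗ p} ⊗ N_F` that is given
locally by `i_{v^p} ω`, for local generators `v` of `T_F` and `ω` of `N_F^*`. -/
def pDivisor (X : Set (LocalSubring K)) (F : Foliation k K) : Divisor X :=
  fun C => Classical.epsilon fun n : ℤ => ∃ (v : Derivation k K K) (ω : Ω[K⁄k]),
    IsGenerator (tangentStalk F C.1) v ∧ IsGenerator (conormalStalk F C.1) ω ∧
    n = ordAt C.1 (contract (pPow p v) ω)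

end

/-- The point `Q` lies on the support of the divisor `D`. -/
def MemSupport {X : Set (LocalSubring K)} (Q : LocalSubring K) (D : Divisor X) : Prop :=
  ∃ C : PrimeDivisor X, D C ≠ 0 ∧ Q.toSubring ≤ C.1.toSubring

end Foliations

end FoliatedSurface

end

/-! A permutation and a translation of the homogeneous coordinates make `Q` the origin of an affine
chart with coordinates `x, y` (`exists_coordinates_origin`). The blowup then has the charts `(y/x,
x)` and `(x/y, y)` over the origin and `(y/x, 1/x)` and `(x/y, 1/y)` at infinity. These are the
charts of Σ₁ with base coordinate `t = y/x` and fibre coordinate `s = x`, and the exceptional curve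
`E` is the section `s = 0` (`blowup_eq_hirzebruch`, `exists_exceptional`).

Since `Q` is not singular, the foliation has a vector field `v` at `Q` with `v x` or `v y` a unit.
The formula `x v(y/x) = v y - t v x` shows that `x v` is regular along `E`; it does not vanish
there, because `t` is not constant on `E` (`IsPrimitiveAt.smul_exceptional`). So `x v` generates the
tangent sheaf along `E`. By Hochschild's formula `(f v)^p = f^p v^p + c v` (`pPow_smul`), the local
equation `i_{v^p} ω` of the p-divisor is multiplied by `f^(p+1)` when `v` becomes `f v`
(`pContract_smul`), and the passage from `(x, y)` to `(y/x, x)` contributes the Jacobian `-1/x`.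
Along `E` the equation is therefore `-x^p` times the equation at `Q` (`pContract_exceptional`), and
the latter is a unit because `Q` lies off the p-divisor: the multiplicity is exactly `p`.
Hochschild's formula also allows p-closedness to be tested on any one nonzero vector field of the
line in `Der_k(K)`, so that its failure survives the blowup.

For the canonical class, a defining form `∑ a_j dX_j` gives the generator `a₂ ∂_x - a₁ ∂_y` on the
affine chart. Rewriting it in the charts at infinity yields `(d - 1) L` for the line `L` at infinity
(`IsDefiningForm.isPrimitiveAt_infinity`), and the generator `x v` along `E` adds `E`. As `L ~ M₁`
and `E ~ M₁ - F`, the class is `-F + d M₁`; `linEquiv_canonicalDivisor` proves this with one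
explicit rational function.

Orders are computable because the prime divisors of a chart `k[u, w]` correspond to prime
polynomials, which serve as uniformizers (`IsLocPair.isUniformizerAt`, `exists_isLocPair_of_prime`).
-/

open scoped KaehlerDifferential

noncomputable section

namespace FoliatedSurface

/-! ## Units and non-units at a point -/

section LocalRings

variable {k K : Type*} [Field k] [Field K] [Algebra k K]

/-- The rational function `f` is a unit at the point with local ring `R`. -/
def IsUnitAt (R : LocalSubring K) (f : K) : Prop :=
  f ≠ 0 ∧ f ∈ R.toSubring ∧ f⁻¹ ∈ R.toSubring

variable {R : LocalSubring K}

theorem isUnitAt_iff {f : K} (hf : f ∈ R.toSubring) :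
    IsUnitAt R f ↔ IsUnit (⟨f, hf⟩ : R.toSubring) := by
  constructor
  · rintro ⟨h0, _, h2⟩
    exact IsUnit.of_mul_eq_one ⟨f⁻¹, h2⟩ (Subtype.ext (mul_inv_cancel₀ h0))
  · intro h
    obtain ⟨⟨g, hg⟩, hfg⟩ := h.exists_right_inv
    have e : f * g = 1 := congrArg Subtype.val hfg
    have h0 : f ≠ 0 := left_ne_zero_of_mul_eq_one e
    exact ⟨h0, hf, by rwa [← eq_inv_of_mul_eq_one_right e]⟩

theorem vanishesAt_iff {f : K} : VanishesAt R f ↔ f ∈ R.toSubring ∧ ¬ IsUnitAt R f := by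
  constructor
  · rintro ⟨h, h'⟩
    exact ⟨h, fun hu => h' ((isUnitAt_iff h).1 hu)⟩
  · rintro ⟨h, h'⟩
    exact ⟨h, fun hu => h' ((isUnitAt_iff h).2 hu)⟩

namespace IsUnitAt

theorem mem {f : K} (h : IsUnitAt R f) : f ∈ R.toSubring := h.2.1

theorem inv_mem {f : K} (h : IsUnitAt R f) : f⁻¹ ∈ R.toSubring := h.2.2

theorem one : IsUnitAt R 1 := ⟨one_ne_zero, R.toSubring.one_mem, by simp [R.toSubring.one_mem]⟩

theorem inv {f : K} (h : IsUnitAt R f) : IsUnitAt R f⁻¹ :=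
  ⟨inv_ne_zero h.1, h.2.2, by simpa using h.2.1⟩

theorem mul {f g : K} (hf : IsUnitAt R f) (hg : IsUnitAt R g) : IsUnitAt R (f * g) :=
  ⟨mul_ne_zero hf.1 hg.1, R.toSubring.mul_mem hf.2.1 hg.2.1, by
    rw [mul_inv]; exact R.toSubring.mul_mem hf.2.2 hg.2.2⟩

theorem div {f g : K} (hf : IsUnitAt R f) (hg : IsUnitAt R g) : IsUnitAt R (f / g) := by
  rw [div_eq_mul_inv]; exact hf.mul hg.inv

theorem neg {f : K} (hf : IsUnitAt R f) : IsUnitAt R (-f) :=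
  ⟨neg_ne_zero.2 hf.1, R.toSubring.neg_mem hf.2.1, by
    rw [inv_neg]; exact R.toSubring.neg_mem hf.2.2⟩

theorem pow {f : K} (hf : IsUnitAt R f) (n : ℕ) : IsUnitAt R (f ^ n) := by
  induction n with
  | zero => simpa using one
  | succ n ih => rw [pow_succ]; exact ih.mul hf

theorem zpow {f : K} (hf : IsUnitAt R f) (n : ℤ) : IsUnitAt R (f ^ n) := by
  cases n with
  | ofNat n => simpa using hf.pow n
  | negSucc n => rw [zpow_negSucc]; exact (hf.pow _).inv

theorem of_mul_left {f g : K} (h : IsUnitAt R (f * g)) (hf : f ∈ R.toSubring)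
    (hg : g ∈ R.toSubring) : IsUnitAt R f :=
  ⟨left_ne_zero_of_mul h.1, hf, by
    have : f⁻¹ = g * (f * g)⁻¹ := by
      have := left_ne_zero_of_mul h.1
      have := right_ne_zero_of_mul h.1
      field_simp
    rw [this]; exact R.toSubring.mul_mem hg h.2.2⟩

theorem mono {R' : LocalSubring K} {f : K} (h : IsUnitAt R f)
    (hR : R.toSubring ≤ R'.toSubring) : IsUnitAt R' f := ⟨h.1, hR h.2.1, hR h.2.2⟩

theorem const {c : k} (hk : ∀ c : k, algebraMap k K c ∈ R.toSubring) (hc : c ≠ 0) :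
    IsUnitAt R (algebraMap k K c) :=
  ⟨by simpa using hc, hk c, by rw [← map_inv₀]; exact hk _⟩

end IsUnitAt

namespace VanishesAt

theorem mem {f : K} (h : VanishesAt R f) : f ∈ R.toSubring := h.1

theorem not_isUnitAt {f : K} (h : VanishesAt R f) : ¬ IsUnitAt R f := (vanishesAt_iff.1 h).2

theorem zero : VanishesAt R (0 : K) := vanishesAt_iff.2 ⟨R.toSubring.zero_mem, fun h => h.1 rfl⟩

theorem add {f g : K} (hf : VanishesAt R f) (hg : VanishesAt R g) : VanishesAt R (f + g) := by
  obtain ⟨h, h'⟩ := hf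
  obtain ⟨j, j'⟩ := hg
  exact ⟨R.toSubring.add_mem h j, Ideal.add_mem _ h' j'⟩

theorem neg {f : K} (hf : VanishesAt R f) : VanishesAt R (-f) := by
  obtain ⟨h, h'⟩ := hf
  exact ⟨R.toSubring.neg_mem h, (Ideal.neg_mem_iff _).2 h'⟩

theorem sub {f g : K} (hf : VanishesAt R f) (hg : VanishesAt R g) : VanishesAt R (f - g) := by
  rw [sub_eq_add_neg]; exact hf.add hg.neg

theorem mul_left {f g : K} (hf : f ∈ R.toSubring) (hg : VanishesAt R g) :
    VanishesAt R (f * g) := by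
  obtain ⟨j, j'⟩ := hg
  exact ⟨R.toSubring.mul_mem hf j, Ideal.mul_mem_left _ (⟨f, hf⟩ : R.toSubring) j'⟩

theorem mul_right {f g : K} (hf : VanishesAt R f) (hg : g ∈ R.toSubring) :
    VanishesAt R (f * g) := by
  rw [mul_comm]; exact mul_left hg hf

theorem sum {ι : Type*} {s : Finset ι} {f : ι → K} (hf : ∀ i ∈ s, VanishesAt R (f i)) :
    VanishesAt R (∑ i ∈ s, f i) := by
  classical
  induction s using Finset.induction_on with
  | empty => simpa using zero
  | insert i s hi ih =>
    rw [Finset.sum_insert hi]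
    exact (hf i (Finset.mem_insert_self _ _)).add
      (ih fun j hj => hf j (Finset.mem_insert_of_mem hj))

theorem of_mul {f g : K} (h : VanishesAt R (f * g)) (hf : f ∈ R.toSubring)
    (hg : g ∈ R.toSubring) : VanishesAt R f ∨ VanishesAt R g := by
  by_contra! hc
  have h1 : IsUnitAt R f := by
    by_contra hn; exact hc.1 (vanishesAt_iff.2 ⟨hf, hn⟩)
  have h2 : IsUnitAt R g := by
    by_contra hn; exact hc.2 (vanishesAt_iff.2 ⟨hg, hn⟩)
  exact h.not_isUnitAt (h1.mul h2)

end VanishesAt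

theorem isUnitAt_or_vanishesAt {f : K} (hf : f ∈ R.toSubring) : IsUnitAt R f ∨ VanishesAt R f := by
  by_cases h : IsUnitAt R f
  · exact Or.inl h
  · exact Or.inr (vanishesAt_iff.2 ⟨hf, h⟩)

theorem IsUnitAt.add_vanishesAt {f g : K} (hf : IsUnitAt R f) (hg : VanishesAt R g) :
    IsUnitAt R (f + g) := by
  rcases isUnitAt_or_vanishesAt (R.toSubring.add_mem hf.mem hg.mem) with h | h
  · exact h
  · exact absurd hf (by simpa using (h.sub hg).not_isUnitAt)

theorem VanishesAt.of_inv_notMem {f : K} (hf : f ∈ R.toSubring) (h : f⁻¹ ∉ R.toSubring) :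
    VanishesAt R f := vanishesAt_iff.2 ⟨hf, fun hu => h hu.2.2⟩

theorem VanishesAt.inv_notMem {f : K} (hf : VanishesAt R f) (h0 : f ≠ 0) :
    f⁻¹ ∉ R.toSubring := fun h => hf.not_isUnitAt ⟨h0, hf.mem, h⟩

/-- Turns domination into a condition on functions: the inclusion is local exactly when non-units
stay non-units. -/
theorem localSubring_le_iff {R R' : LocalSubring K} :
    R ≤ R' ↔ R.toSubring ≤ R'.toSubring ∧ ∀ f, VanishesAt R f → VanishesAt R' f := by
  constructor
  · rintro ⟨h, hl⟩
    refine ⟨h, fun f hf => ?_⟩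
    refine vanishesAt_iff.2 ⟨h hf.mem, fun hu => hf.not_isUnitAt ?_⟩
    rw [isUnitAt_iff hf.mem]
    exact hl.1 _ ((isUnitAt_iff (h hf.mem)).1 hu)
  · rintro ⟨h, hv⟩
    refine ⟨h, ⟨fun a ha => ?_⟩⟩
    by_contra hn
    have := hv a.1 (vanishesAt_iff.2 ⟨a.2, fun hu => hn ((isUnitAt_iff a.2).1 hu)⟩)
    exact this.not_isUnitAt ((isUnitAt_iff (h a.2)).2 ha)

/-! ## Localizations of subrings -/

/-- The local ring `R` is a localization of its subring `A`. -/
def IsLocOf (A : Subring K) (R : LocalSubring K) : Prop :=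
  A ≤ R.toSubring ∧ ∀ r ∈ R.toSubring, ∃ a ∈ A, ∃ b ∈ A, IsUnitAt R b ∧ r = a / b

theorem isUnitAt_ofPrime {A : Subring K} {P : Ideal A} [P.IsPrime] (a : A) :
    IsUnitAt (LocalSubring.ofPrime A P) a ↔ a ∉ P := by
  rw [isUnitAt_iff (LocalSubring.le_ofPrime A P a.2)]
  exact IsLocalization.AtPrime.isUnit_to_map_iff (LocalSubring.ofPrime A P).toSubring P a

theorem isLocOf_ofPrime (A : Subring K) (P : Ideal A) [P.IsPrime] :
    IsLocOf A (LocalSubring.ofPrime A P) := by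
  refine ⟨LocalSubring.le_ofPrime A P, fun r hr => ?_⟩
  obtain ⟨⟨a, b⟩, h⟩ := IsLocalization.surj P.primeCompl
    (⟨r, hr⟩ : (LocalSubring.ofPrime A P).toSubring)
  have hb : IsUnitAt (LocalSubring.ofPrime A P) (b : A) := (isUnitAt_ofPrime _).2 b.2
  refine ⟨a, a.2, b, b.1.2, hb, ?_⟩
  rw [eq_div_iff hb.1]
  exact congrArg Subtype.val h

namespace IsLocOf

variable {A B : Subring K}

theorem le_of_isUnitAt {R' : LocalSubring K} (h : IsLocOf A R) (hA : A ≤ R'.toSubring)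
    (hu : ∀ a ∈ A, IsUnitAt R a → IsUnitAt R' a) : R.toSubring ≤ R'.toSubring := by
  intro r hr
  obtain ⟨a, ha, b, hb, hbu, rfl⟩ := h.2 r hr
  rw [div_eq_mul_inv]
  exact R'.toSubring.mul_mem (hA ha) (hu b hb hbu).inv_mem

theorem eq {R' : LocalSubring K} (h : IsLocOf A R) (h' : IsLocOf A R')
    (hu : ∀ a ∈ A, IsUnitAt R a ↔ IsUnitAt R' a) : R = R' :=
  LocalSubring.toSubring_injective (le_antisymm
    (h.le_of_isUnitAt h'.1 fun a ha => (hu a ha).1)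
    (h'.le_of_isUnitAt h.1 fun a ha => (hu a ha).2))

/-- The prime is the centre of `R` on `A`. With this, `IsLocOf` replaces the explicit primes in the
definitions of models and blowups. -/
theorem exists_prime (h : IsLocOf A R) :
    ∃ (P : Ideal A) (_ : P.IsPrime), R = LocalSubring.ofPrime A P ∧
      ∀ a : A, a ∈ P ↔ VanishesAt R a := by
  let P : Ideal A := (IsLocalRing.maximalIdeal R.toSubring).comap (Subring.inclusion h.1)
  have hP : P.IsPrime := Ideal.comap_isPrime _ _
  have hv : ∀ a : A, a ∈ P ↔ VanishesAt R a := fun a =>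
    ⟨fun ha => ⟨h.1 a.2, ha⟩, fun ⟨_, ha⟩ => ha⟩
  refine ⟨P, hP, h.eq (isLocOf_ofPrime A P) fun a ha => ?_, hv⟩
  have e := isUnitAt_ofPrime (P := P) ⟨a, ha⟩
  rw [hv] at e
  rw [e, vanishesAt_iff]
  simp [h.1 ha]

/-- The tool for every change of chart: numerators and denominators over `A` can be cleared to `B`,
since the denominators that occur are units at `R`. -/
theorem of_fractions (h : IsLocOf A R) (hB : B ≤ R.toSubring)
    (hAB : ∀ a ∈ A, ∃ b ∈ B, ∃ c ∈ B, IsUnitAt R c ∧ a = b / c) : IsLocOf B R := by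
  refine ⟨hB, fun r hr => ?_⟩
  obtain ⟨a, ha, b, hb, hbu, rfl⟩ := h.2 r hr
  obtain ⟨a1, ha1, a2, ha2, hau, rfl⟩ := hAB a ha
  obtain ⟨b1, hb1, b2, hb2, hbu', rfl⟩ := hAB b hb
  have hb1u : IsUnitAt R b1 := by
    have := hbu.mul hbu'
    rwa [div_mul_cancel₀ _ hbu'.1] at this
  refine ⟨a1 * b2, B.mul_mem ha1 hb2, a2 * b1, B.mul_mem ha2 hb1, hau.mul hb1u, ?_⟩
  have := hb1u.1
  have := hbu'.1
  have := hau.1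
  field_simp

end IsLocOf

theorem mem_modelOfCharts {charts : Set (Subalgebra k K)} :
    R ∈ modelOfCharts charts ↔ ∃ A ∈ charts, IsLocOf A.toSubring R := by
  constructor
  · rintro ⟨A, hA, P, hP, rfl⟩
    exact ⟨A, hA, isLocOf_ofPrime _ P⟩
  · rintro ⟨A, hA, h⟩
    obtain ⟨P, hP, e, -⟩ := h.exists_prime
    exact ⟨A, hA, P, hP, e⟩

/-- Fractions with unit denominators are closed under sums and products, so only generators need
checking. -/
theorem fractions_adjoin {S : Set K} (B : Subalgebra k K)
    (hS : ∀ a ∈ S, ∃ b ∈ B, ∃ c ∈ B, IsUnitAt R c ∧ a = b / c) :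
    ∀ a ∈ Algebra.adjoin k S, ∃ b ∈ B, ∃ c ∈ B, IsUnitAt R c ∧ a = b / c := by
  intro a ha
  induction ha using Algebra.adjoin_induction with
  | mem x hx => exact hS x hx
  | algebraMap c => exact ⟨algebraMap k K c, B.algebraMap_mem c, 1, B.one_mem, .one, by simp⟩
  | add x y _ _ hx hy =>
    obtain ⟨b, hb, c, hc, hcu, rfl⟩ := hx
    obtain ⟨b', hb', c', hc', hcu', rfl⟩ := hy
    exact ⟨b * c' + c * b', B.add_mem (B.mul_mem hb hc') (B.mul_mem hc hb'), c * c',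
      B.mul_mem hc hc', hcu.mul hcu', div_add_div _ _ hcu.1 hcu'.1⟩
  | mul x y _ _ hx hy =>
    obtain ⟨b, hb, c, hc, hcu, rfl⟩ := hx
    obtain ⟨b', hb', c', hc', hcu', rfl⟩ := hy
    exact ⟨b * b', B.mul_mem hb hb', c * c', B.mul_mem hc hc', hcu.mul hcu',
      div_mul_div_comm _ _ _ _⟩

variable (k) in
/-- The local ring `R` is a localization of `k[u, w]`. -/
def IsLocPair (u w : K) (R : LocalSubring K) : Prop :=
  IsLocOf (Algebra.adjoin k {u, w}).toSubring R

theorem adjoin_le_of_isLocOf {S T : Set K} (h : IsLocOf (Algebra.adjoin k S).toSubring R)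
    (hT : T ⊆ R.toSubring) : (Algebra.adjoin k T).toSubring ≤ R.toSubring := by
  intro a ha
  change a ∈ Algebra.adjoin k T at ha
  induction ha using Algebra.adjoin_induction with
  | mem x hx => exact hT hx
  | algebraMap c => exact h.1 ((Algebra.adjoin k S).algebraMap_mem c)
  | add x y _ _ hx hy => exact R.toSubring.add_mem hx hy
  | mul x y _ _ hx hy => exact R.toSubring.mul_mem hx hy

theorem IsLocOf.change_adjoin {S T : Set K} (h : IsLocOf (Algebra.adjoin k S).toSubring R)
    (hT : T ⊆ R.toSubring)
    (hS : ∀ a ∈ S, ∃ b ∈ Algebra.adjoin k T, ∃ c ∈ Algebra.adjoin k T,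
      IsUnitAt R c ∧ a = b / c) : IsLocOf (Algebra.adjoin k T).toSubring R :=
  h.of_fractions (adjoin_le_of_isLocOf h hT) (fractions_adjoin _ hS)

namespace IsLocPair

variable {u w u' w' : K}

theorem left_mem (h : IsLocPair k u w R) : u ∈ R.toSubring :=
  h.1 (Algebra.subset_adjoin (by simp))

theorem right_mem (h : IsLocPair k u w R) : w ∈ R.toSubring :=
  h.1 (Algebra.subset_adjoin (by simp))

theorem algebraMap_mem (h : IsLocPair k u w R) (c : k) : algebraMap k K c ∈ R.toSubring :=
  h.1 ((Algebra.adjoin k {u, w}).algebraMap_mem c)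

theorem symm (h : IsLocPair k u w R) : IsLocPair k w u R := by
  rwa [IsLocPair, Set.pair_comm]

theorem aeval_mem (h : IsLocPair k u w R) {t : K} (ht : t ∈ R.toSubring) (P : Polynomial k) :
    Polynomial.aeval t P ∈ R.toSubring := by
  rw [Polynomial.aeval_eq_sum_range]
  refine R.toSubring.sum_mem fun i _ => ?_
  rw [Algebra.smul_def]
  exact R.toSubring.mul_mem (h.algebraMap_mem _) (R.toSubring.pow_mem ht i)

theorem change (h : IsLocPair k u w R) (hu' : u' ∈ R.toSubring) (hw' : w' ∈ R.toSubring)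
    (hu : ∃ b ∈ Algebra.adjoin k {u', w'}, ∃ c ∈ Algebra.adjoin k {u', w'},
      IsUnitAt R c ∧ u = b / c)
    (hw : ∃ b ∈ Algebra.adjoin k {u', w'}, ∃ c ∈ Algebra.adjoin k {u', w'},
      IsUnitAt R c ∧ w = b / c) : IsLocPair k u' w' R := by
  refine IsLocOf.change_adjoin h ?_ ?_
  · rintro a (rfl | rfl)
    exacts [hu', hw']
  · rintro a (rfl | rfl)
    exacts [hu, hw]

end IsLocPair

theorem left_mem_adjoin_pair (u w : K) : u ∈ Algebra.adjoin k {u, w} :=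
  Algebra.subset_adjoin (by simp)

theorem right_mem_adjoin_pair (u w : K) : w ∈ Algebra.adjoin k {u, w} :=
  Algebra.subset_adjoin (by simp)

/-- Inverting the second coordinate where it is a unit. -/
theorem IsLocPair.inv_right {u w : K} (h : IsLocPair k u w R) (hw : IsUnitAt R w) :
    IsLocPair k u w⁻¹ R :=
  h.change h.left_mem hw.inv_mem
    ⟨u, left_mem_adjoin_pair _ _, 1, Subalgebra.one_mem _, .one, by simp⟩
    ⟨1, Subalgebra.one_mem _, w⁻¹, right_mem_adjoin_pair _ _, hw.inv, by simp⟩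

end LocalRings

/-! ## Orders of rational functions at discrete valuation rings -/

section Orders

variable {k K : Type*} [Field k] [Field K] [Algebra k K]
variable {R : LocalSubring K} {ϖ f g : K}

/-- The element `ϖ` of `K` is a uniformizer of the discrete valuation ring `R` of `K`. -/
def IsUniformizerAt (R : LocalSubring K) (ϖ : K) : Prop :=
  ϖ ≠ 0 ∧ VanishesAt R ϖ ∧ ∀ f : K, f ≠ 0 → ∃ n : ℤ, IsUnitAt R (f / ϖ ^ n)

/-- `R` is a discrete valuation ring with fraction field `K`. -/
def IsDivisorial (R : LocalSubring K) : Prop := ∃ ϖ, IsUniformizerAt R ϖ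

namespace IsUniformizerAt

theorem isUnitAt_zpow_iff (h : IsUniformizerAt R ϖ) {n : ℤ} : IsUnitAt R (ϖ ^ n) ↔ n = 0 := by
  have key : ∀ m : ℕ, ¬ IsUnitAt R (ϖ ^ (m + 1)) := fun m hu => by
    rw [pow_succ'] at hu
    exact h.2.1.not_isUnitAt (hu.of_mul_left h.2.1.mem (R.toSubring.pow_mem h.2.1.mem m))
  constructor
  · intro hu
    rcases n with (_ | m) | m
    · rfl
    · exact absurd (by rwa [Int.ofNat_eq_natCast, zpow_natCast] at hu) (key m)
    · exact absurd (by simpa using hu.inv) (key m)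
  · rintro rfl
    simpa using IsUnitAt.one

theorem unique (h : IsUniformizerAt R ϖ) {m n : ℤ} (hm : IsUnitAt R (f / ϖ ^ m))
    (hn : IsUnitAt R (f / ϖ ^ n)) : m = n := by
  have h0 := h.1
  have hf : f ≠ 0 := by rintro rfl; simpa using hm.1
  have := hm.div hn
  have e : f / ϖ ^ m / (f / ϖ ^ n) = ϖ ^ (n - m) := by
    rw [zpow_sub₀ h0]
    field_simp
  rw [e, h.isUnitAt_zpow_iff] at this
  omega

theorem mem_iff (h : IsUniformizerAt R ϖ) {n : ℤ} (hn : IsUnitAt R (f / ϖ ^ n)) :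
    f ∈ R.toSubring ↔ 0 ≤ n := by
  have h0 := h.1
  constructor
  · intro hf
    by_contra! hneg
    obtain ⟨m, rfl⟩ : ∃ m : ℕ, n = -(m + 1 : ℕ) := ⟨(-n).toNat - 1, by omega⟩
    rw [zpow_neg, div_inv_eq_mul, zpow_natCast, pow_succ, ← mul_assoc, mul_comm] at hn
    exact h.2.1.not_isUnitAt (hn.of_mul_left h.2.1.mem
      (R.toSubring.mul_mem hf (R.toSubring.pow_mem h.2.1.mem m)))
  · intro hn0
    lift n to ℕ using hn0
    have e : f = f / ϖ ^ (n : ℤ) * ϖ ^ n := by rw [zpow_natCast]; field_simp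
    rw [e]
    exact R.toSubring.mul_mem hn.mem (R.toSubring.pow_mem h.2.1.mem n)

theorem irreducible (h : IsUniformizerAt R ϖ) : Irreducible (⟨ϖ, h.2.1.mem⟩ : R.toSubring) := by
  refine ⟨fun hu => h.2.1.not_isUnitAt ((isUnitAt_iff _).2 hu), ?_⟩
  rintro ⟨a, ha⟩ ⟨b, hb⟩ hab
  have e : ϖ = a * b := congrArg Subtype.val hab
  have h0 := h.1
  have ha0 : a ≠ 0 := by rintro rfl; simp [h0] at e
  have hb0 : b ≠ 0 := by rintro rfl; simp [h0] at e
  obtain ⟨m, hm⟩ := h.2.2 a ha0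
  obtain ⟨n, hn⟩ := h.2.2 b hb0
  have hm0 := (h.mem_iff hm).1 ha
  have hn0 := (h.mem_iff hn).1 hb
  have hmn : m + n = 1 := by
    refine h.unique (f := ϖ) ?_ (by simpa [h0] using IsUnitAt.one)
    have := hm.mul hn
    rw [div_mul_div_comm, ← zpow_add₀ h0, ← e] at this
    exact this
  rw [← isUnitAt_iff, ← isUnitAt_iff]
  obtain rfl | rfl : m = 0 ∨ n = 0 := by omega
  · left; simpa using hm
  · right; simpa using hn

theorem isDiscreteValuationRing (h : IsUniformizerAt R ϖ) :
    IsDiscreteValuationRing R.toSubring := by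
  refine IsDiscreteValuationRing.ofHasUnitMulPowIrreducibleFactorization
    ⟨⟨ϖ, h.2.1.mem⟩, h.irreducible, ?_⟩
  rintro ⟨f, hf⟩ hf0
  have h0 := h.1
  have hf0' : f ≠ 0 := fun e => hf0 (Subtype.ext e)
  obtain ⟨n, hn⟩ := h.2.2 f hf0'
  have hn0 := (h.mem_iff hn).1 hf
  lift n to ℕ using hn0
  obtain ⟨u, hu⟩ := (isUnitAt_iff hn.mem).1 hn
  refine ⟨n, u, Subtype.ext ?_⟩
  have : ((u : R.toSubring) : K) = f / ϖ ^ (n : ℤ) := congrArg Subtype.val hu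
  simp only [Subring.coe_mul, Subring.coe_pow, this, zpow_natCast]
  field_simp

/-- A discrete valuation ring inside `K` may have a smaller fraction field; `hfrac` excludes this,
so that every element of `K` gets an order. -/
theorem of_irreducible [IsDiscreteValuationRing R.toSubring]
    (hfrac : ∀ f : K, ∃ a ∈ R.toSubring, ∃ b ∈ R.toSubring, f = a / b) {ϖ : R.toSubring}
    (h : Irreducible ϖ) : IsUniformizerAt R ϖ := by
  have h0 : (ϖ : K) ≠ 0 := fun e => h.ne_zero (Subtype.ext e)
  have key : ∀ a ∈ R.toSubring, a ≠ 0 → ∃ n : ℤ, IsUnitAt R (a / (ϖ : K) ^ n) := by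
    intro a ha ha0
    obtain ⟨n, u, hu⟩ := IsDiscreteValuationRing.eq_unit_mul_pow_irreducible
      (x := (⟨a, ha⟩ : R.toSubring)) (fun e => ha0 (congrArg Subtype.val e)) h
    have e : a = u * (ϖ : K) ^ n := congrArg Subtype.val hu
    refine ⟨n, ?_⟩
    rw [zpow_natCast, e, mul_div_cancel_right₀ _ (pow_ne_zero _ h0)]
    exact (isUnitAt_iff u.1.2).2 u.isUnit
  refine ⟨h0, vanishesAt_iff.2 ⟨ϖ.2, fun hu => h.not_isUnit ((isUnitAt_iff _).1 hu)⟩, ?_⟩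
  intro f hf
  obtain ⟨a, ha, b, hb, rfl⟩ := hfrac f
  obtain ⟨m, hm⟩ := key a ha (by rintro rfl; simp at hf)
  obtain ⟨n, hn⟩ := key b hb (by rintro rfl; simp at hf)
  refine ⟨m - n, ?_⟩
  have := hm.div hn
  have e : a / b / (ϖ : K) ^ (m - n) = a / (ϖ : K) ^ m / (b / (ϖ : K) ^ n) := by
    rw [zpow_sub₀ h0]
    field_simp
  rwa [e]

/-- `ordAt` chooses an exponent relative to some unknown uniformizer. Two uniformizers are
associated, so the chosen exponent agrees with the one computed from `ϖ`. -/
theorem ordAt_eq (h : IsUniformizerAt R ϖ) {n : ℤ} (hn : IsUnitAt R (f / ϖ ^ n)) :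
    ordAt R f = n := by
  have := h.isDiscreteValuationRing
  have h0 := h.1
  have hex : ∃ n : ℤ, ∃ ϖ : R.toSubring, Irreducible ϖ ∧
      ∃ u : (R.toSubring)ˣ, f = ((u : R.toSubring) : K) * (ϖ : K) ^ n := by
    obtain ⟨u, hu⟩ := (isUnitAt_iff hn.mem).1 hn
    refine ⟨n, _, h.irreducible, u, ?_⟩
    rw [hu]
    field_simp
  obtain ⟨ϖ', hirr, u, hu⟩ := Classical.epsilon_spec hex
  obtain ⟨v, hv⟩ := IsDiscreteValuationRing.associated_of_irreducible _ h.irreducible hirr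
  have e : ϖ' = ϖ * ((v : R.toSubring) : K) := (congrArg Subtype.val hv).symm
  have hvu : IsUnitAt R ((v : R.toSubring) : K) := (isUnitAt_iff v.1.2).2 v.isUnit
  have huu : IsUnitAt R ((u : R.toSubring) : K) := (isUnitAt_iff u.1.2).2 u.isUnit
  refine h.unique (f := f) ?_ hn
  change f = _ * _ ^ ordAt R f at hu
  generalize ordAt R f = N at hu ⊢
  rw [hu, e, mul_zpow]
  rw [mul_left_comm, mul_div_cancel_left₀ _ (zpow_ne_zero _ h0)]
  exact huu.mul (hvu.zpow _)

theorem ordAt_self (h : IsUniformizerAt R ϖ) : ordAt R ϖ = 1 :=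
  h.ordAt_eq (by simpa [h.1] using IsUnitAt.one)

theorem isUnitAt_div_ordAt (h : IsUniformizerAt R ϖ) (hf : f ≠ 0) :
    IsUnitAt R (f / ϖ ^ ordAt R f) := by
  obtain ⟨n, hn⟩ := h.2.2 f hf
  rwa [h.ordAt_eq hn]

end IsUniformizerAt

namespace IsDivisorial

theorem isDiscreteValuationRing (h : IsDivisorial R) : IsDiscreteValuationRing R.toSubring :=
  h.choose_spec.isDiscreteValuationRing

theorem ordAt_mul (h : IsDivisorial R) (hf : f ≠ 0) (hg : g ≠ 0) :
    ordAt R (f * g) = ordAt R f + ordAt R g := by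
  obtain ⟨ϖ, h⟩ := h
  refine h.ordAt_eq ?_
  rw [zpow_add₀ h.1, ← div_mul_div_comm]
  exact (h.isUnitAt_div_ordAt hf).mul (h.isUnitAt_div_ordAt hg)

theorem mem_iff (h : IsDivisorial R) (hf : f ≠ 0) : f ∈ R.toSubring ↔ 0 ≤ ordAt R f := by
  obtain ⟨ϖ, h⟩ := h
  exact h.mem_iff (h.isUnitAt_div_ordAt hf)

theorem isUnitAt_iff (h : IsDivisorial R) (hf : f ≠ 0) : IsUnitAt R f ↔ ordAt R f = 0 := by
  obtain ⟨ϖ, h⟩ := h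
  constructor
  · intro hu; exact h.ordAt_eq (by simpa using hu)
  · intro e
    simpa [e] using h.isUnitAt_div_ordAt hf

theorem ordAt_isUnitAt (h : IsDivisorial R) (hf : IsUnitAt R f) : ordAt R f = 0 :=
  (h.isUnitAt_iff hf.1).1 hf

theorem ordAt_inv (h : IsDivisorial R) (hf : f ≠ 0) : ordAt R f⁻¹ = - ordAt R f := by
  have e := h.ordAt_mul hf (inv_ne_zero hf)
  rw [mul_inv_cancel₀ hf, h.ordAt_isUnitAt .one] at e
  omega

theorem ordAt_div (h : IsDivisorial R) (hf : f ≠ 0) (hg : g ≠ 0) :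
    ordAt R (f / g) = ordAt R f - ordAt R g := by
  rw [div_eq_mul_inv, h.ordAt_mul hf (inv_ne_zero hg), h.ordAt_inv hg, sub_eq_add_neg]

theorem ordAt_pow (h : IsDivisorial R) (hf : f ≠ 0) (n : ℕ) :
    ordAt R (f ^ n) = n * ordAt R f := by
  induction n with
  | zero => simpa using h.ordAt_isUnitAt .one
  | succ n ih => rw [pow_succ, h.ordAt_mul (pow_ne_zero _ hf) hf, ih]; push_cast; ring

theorem mem_or_inv_mem (h : IsDivisorial R) (f : K) :
    f ∈ R.toSubring ∨ f⁻¹ ∈ R.toSubring := by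
  by_cases hf : f = 0
  · left; rw [hf]; exact R.toSubring.zero_mem
  · rw [h.mem_iff hf, h.mem_iff (inv_ne_zero hf), h.ordAt_inv hf]
    omega

end IsDivisorial

end Orders

/-! ## Coordinates of the function field -/

section Coordinates

variable {k K : Type*} [Field k] [Field K] [Algebra k K] {u w u' w' : K} {R : LocalSubring K}

/-- Two elements that generate a field of transcendence degree two form a transcendence basis, so
algebraic independence of the new pair comes for free. -/
theorem IsCoordinates.change (h : IsCoordinates k u w)
    (hu : u ∈ IntermediateField.adjoin k {u', w'})
    (hw : w ∈ IntermediateField.adjoin k {u', w'}) : IsCoordinates k u' w' := by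
  have htop : IntermediateField.adjoin k {u', w'} = ⊤ := by
    rw [eq_top_iff, ← h.2, IntermediateField.adjoin_le_iff]
    rintro a (rfl | rfl)
    exacts [hu, hw]
  refine ⟨?_, htop⟩
  have hr : Set.range ![u', w'] = {u', w'} := by simp [Set.pair_comm]
  have halg : Algebra.IsAlgebraic (Algebra.adjoin k (Set.range ![u', w'])) K := by
    rw [hr]
    refine ⟨fun z => ?_⟩
    have hz : z ∈ IntermediateField.adjoin k {u', w'} := htop ▸ IntermediateField.mem_top
    obtain ⟨r, hr, s, hs, rfl⟩ := IntermediateField.mem_adjoin_iff_div.1 hz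
    have h1 : IsAlgebraic (Algebra.adjoin k {u', w'}) r := isAlgebraic_algebraMap (⟨r, hr⟩ :
      Algebra.adjoin k {u', w'})
    have h2 : IsAlgebraic (Algebra.adjoin k {u', w'}) s := isAlgebraic_algebraMap (⟨s, hs⟩ :
      Algebra.adjoin k {u', w'})
    rw [div_eq_mul_inv]
    exact h1.mul h2.inv
  exact (Algebra.IsAlgebraic.isTranscendenceBasis_of_lift_le_trdeg_of_finite k ![u', w']
    h.1.lift_cardinalMk_le_trdeg).1

theorem aeval_aeval_X_zero {B : Type*} [CommRing B] [Algebra k B] (a b : B) (f : Polynomial k) :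
    MvPolynomial.aeval ![a, b] (Polynomial.aeval (MvPolynomial.X (R := k) (0 : Fin 2)) f) =
      Polynomial.aeval a f := by
  rw [← Polynomial.aeval_algHom_apply]
  simp

namespace IsCoordinates

theorem symm (h : IsCoordinates k u w) : IsCoordinates k w u :=
  h.change (IntermediateField.subset_adjoin _ _ (by simp))
    (IntermediateField.subset_adjoin _ _ (by simp))

theorem aeval_injective (h : IsCoordinates k u w) :
    Function.Injective (MvPolynomial.aeval (R := k) ![u, w]) := h.1

theorem aeval_eq_zero_iff (h : IsCoordinates k u w) {f : MvPolynomial (Fin 2) k} :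
    MvPolynomial.aeval ![u, w] f = 0 ↔ f = 0 :=
  map_eq_zero_iff _ h.aeval_injective

theorem left_ne_const (h : IsCoordinates k u w) (c : k) : u ≠ algebraMap k K c := by
  intro e
  have : (MvPolynomial.X 0 - MvPolynomial.C c : MvPolynomial (Fin 2) k) = 0 := by
    rw [← h.aeval_eq_zero_iff]
    simp [e]
  have h2 := congrArg (MvPolynomial.eval fun _ => c + 1) this
  simp at h2

theorem left_ne_zero (h : IsCoordinates k u w) : u ≠ 0 := by
  simpa using h.left_ne_const 0

theorem right_ne_zero (h : IsCoordinates k u w) : w ≠ 0 := h.symm.left_ne_zero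

end IsCoordinates

theorem mem_adjoin_pair {a : K} :
    a ∈ Algebra.adjoin k {u, w} ↔ ∃ f, MvPolynomial.aeval (R := k) ![u, w] f = a := by
  have hr : ({u, w} : Set K) = Set.range ![u, w] := by simp [Set.pair_comm]
  rw [hr, Algebra.adjoin_range_eq_range_aeval]
  rfl

/-- With the second variable as the main one, this is the monic linear polynomial `X - C q` over the
domain `k[X₀]`. -/
theorem prime_right_sub (q : Polynomial k) :
    Prime (MvPolynomial.X 1 - Polynomial.aeval (MvPolynomial.X 0) q :
      MvPolynomial (Fin 2) k) := by
  let e : MvPolynomial (Fin 2) k ≃ₐ[k] Polynomial (MvPolynomial (Fin 1) k) :=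
    (MvPolynomial.renameEquiv k (Equiv.swap 0 1)).trans (MvPolynomial.finSuccEquiv k 1)
  rw [← MulEquiv.prime_iff e]
  have h1 : e (MvPolynomial.X 1) = Polynomial.X := by
    simp [e, MvPolynomial.finSuccEquiv_X_zero]
  have h0 : e (MvPolynomial.X 0) = Polynomial.C (MvPolynomial.X 0) := by
    simp only [e, AlgEquiv.trans_apply, MvPolynomial.renameEquiv_apply, MvPolynomial.rename_X,
      Equiv.swap_apply_left]
    exact MvPolynomial.finSuccEquiv_X_succ (j := 0)
  have h2 : e (Polynomial.aeval (MvPolynomial.X 0) q) =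
      Polynomial.C (Polynomial.aeval (MvPolynomial.X 0) q) := by
    have a1 := Polynomial.aeval_algHom_apply e.toAlgHom
      (MvPolynomial.X 0) q
    have a2 := Polynomial.aeval_algHom_apply
      (Algebra.ofId (MvPolynomial (Fin 1) k) (Polynomial (MvPolynomial (Fin 1) k))
        |>.restrictScalars k)
      (MvPolynomial.X 0) q
    have e3 : e.toAlgHom (MvPolynomial.X 0) =
      (Algebra.ofId (MvPolynomial (Fin 1) k) (Polynomial (MvPolynomial (Fin 1) k))
        |>.restrictScalars k)
      (MvPolynomial.X 0) := h0
    rw [← e3] at a2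
    exact a1.symm.trans a2
  change Prime (e _)
  rw [map_sub, h1, h2]
  exact Polynomial.prime_X_sub_C _

end Coordinates

/-! ## Prime divisors in a chart with coordinate ring `k[u, w]` -/

section PrimeDivisors

variable {k K : Type*} [Field k] [Field K] [Algebra k K] {u w : K} {R : LocalSubring K}

theorem IsCoordinates.exists_div (h : IsCoordinates k u w) (z : K) :
    ∃ f g : MvPolynomial (Fin 2) k, g ≠ 0 ∧
      z = MvPolynomial.aeval ![u, w] f / MvPolynomial.aeval ![u, w] g := by
  have hz : z ∈ IntermediateField.adjoin k {u, w} := h.2 ▸ IntermediateField.mem_top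
  obtain ⟨r, hr, s, hs, rfl⟩ := IntermediateField.mem_adjoin_iff_div.1 hz
  obtain ⟨f, rfl⟩ := mem_adjoin_pair.1 hr
  obtain ⟨g, rfl⟩ := mem_adjoin_pair.1 hs
  by_cases hg : g = 0
  · exact ⟨0, 1, one_ne_zero, by simp [hg]⟩
  · exact ⟨f, g, hg, rfl⟩

namespace IsLocPair

theorem poly_mem (h : IsLocPair k u w R) (f : MvPolynomial (Fin 2) k) :
    MvPolynomial.aeval ![u, w] f ∈ R.toSubring :=
  h.1 (mem_adjoin_pair.2 ⟨f, rfl⟩)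

theorem exists_div (h : IsLocPair k u w R) {r : K} (hr : r ∈ R.toSubring) :
    ∃ f g : MvPolynomial (Fin 2) k, IsUnitAt R (MvPolynomial.aeval ![u, w] g) ∧
      r = MvPolynomial.aeval ![u, w] f / MvPolynomial.aeval ![u, w] g := by
  obtain ⟨a, ha, b, hb, hbu, rfl⟩ := h.2 r hr
  obtain ⟨f, rfl⟩ := mem_adjoin_pair.1 ha
  obtain ⟨g, rfl⟩ := mem_adjoin_pair.1 hb
  exact ⟨f, g, hbu, rfl⟩

theorem exists_frac (h : IsLocPair k u w R) (hc : IsCoordinates k u w) (z : K) :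
    ∃ a ∈ R.toSubring, ∃ b ∈ R.toSubring, z = a / b := by
  obtain ⟨f, g, -, e⟩ := hc.exists_div z
  exact ⟨_, h.poly_mem f, _, h.poly_mem g, e⟩

theorem isDivisorial (h : IsLocPair k u w R) (hc : IsCoordinates k u w)
    (hR : IsDiscreteValuationRing R.toSubring) : IsDivisorial R := by
  obtain ⟨ϖ, hϖ⟩ := IsDiscreteValuationRing.exists_irreducible R.toSubring
  exact ⟨ϖ, .of_irreducible (h.exists_frac hc) hϖ⟩

theorem eq_of_poly {R' : LocalSubring K} (h : IsLocPair k u w R) (h' : IsLocPair k u w R')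
    (hv : ∀ f : MvPolynomial (Fin 2) k, VanishesAt R (MvPolynomial.aeval ![u, w] f) ↔
      VanishesAt R' (MvPolynomial.aeval ![u, w] f)) : R = R' := by
  refine IsLocOf.eq h h' fun a ha => ?_
  obtain ⟨f, rfl⟩ := mem_adjoin_pair.1 ha
  have := hv f
  rw [vanishesAt_iff, vanishesAt_iff] at this
  simpa [h.poly_mem, h'.poly_mem, not_iff_not] using this

variable {π : MvPolynomial (Fin 2) k}

/-- A prime polynomial that vanishes at a prime divisor is a uniformizer there. -/
theorem isUniformizerAt (h : IsLocPair k u w R) (hc : IsCoordinates k u w)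
    (hR : IsDiscreteValuationRing R.toSubring) (hπ : Prime π)
    (hv : VanishesAt R (MvPolynomial.aeval ![u, w] π)) :
    IsUniformizerAt R (MvPolynomial.aeval ![u, w] π) := by
  -- A prime polynomial that is not a unit at `R` stays prime in the localization, and a prime
  -- element of a discrete valuation ring is a uniformizer.
  have hp : Prime (⟨_, h.poly_mem π⟩ : R.toSubring) := by
    refine ⟨fun e => hπ.ne_zero (hc.aeval_eq_zero_iff.1 (congrArg Subtype.val e)),
      fun hu => hv.not_isUnitAt ((isUnitAt_iff _).2 hu), ?_⟩
    have key : ∀ a f g : MvPolynomial (Fin 2) k, IsUnitAt R (MvPolynomial.aeval ![u, w] g) →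
        π ∣ f → ∀ r : R.toSubring,
        (r : K) = MvPolynomial.aeval ![u, w] f / MvPolynomial.aeval ![u, w] g →
        (⟨_, h.poly_mem π⟩ : R.toSubring) ∣ r := by
      rintro - _ g hg ⟨c, rfl⟩ r hr
      refine ⟨⟨_, R.toSubring.mul_mem (h.poly_mem c) hg.inv_mem⟩, Subtype.ext ?_⟩
      rw [hr, map_mul, mul_div_assoc, div_eq_mul_inv]
      rfl
    rintro ⟨r, hr⟩ ⟨s, hs⟩ ⟨⟨t, ht⟩, he⟩
    have he' : r * s = MvPolynomial.aeval ![u, w] π * t := congrArg Subtype.val he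
    obtain ⟨f, g, hg, rfl⟩ := h.exists_div hr
    obtain ⟨f', g', hg', rfl⟩ := h.exists_div hs
    obtain ⟨f'', g'', hg'', rfl⟩ := h.exists_div ht
    have e : f * f' * g'' = π * (f'' * (g * g')) := by
      apply hc.aeval_injective
      simp only [map_mul]
      have := hg.1
      have := hg'.1
      have := hg''.1
      field_simp at he'
      linear_combination he'
    have hd : π ∣ f * f' * g'' := ⟨_, e⟩
    rcases hπ.dvd_or_dvd hd with hd | ⟨c, rfl⟩
    · rcases hπ.dvd_or_dvd hd with hd | hd
      · exact Or.inl (key f f g hg hd _ rfl)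
      · exact Or.inr (key f' f' g' hg' hd _ rfl)
    · rw [map_mul] at hg''
      exact absurd (hg''.of_mul_left hv.mem (h.poly_mem c)) hv.not_isUnitAt
  exact IsUniformizerAt.of_irreducible (h.exists_frac hc) hp.irreducible

/-- The centre of the prime divisor on `k[u, w]` is the ideal `(π)`: if `f` has positive order then
`f / π` is regular, and its denominator is prime to `π`. Hence `π` determines the point, which is
`unique_of_prime`. -/
theorem vanishesAt_iff_dvd (h : IsLocPair k u w R) (hc : IsCoordinates k u w)
    (hπ : Prime π) (hv : IsUniformizerAt R (MvPolynomial.aeval ![u, w] π))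
    {f : MvPolynomial (Fin 2) k} :
    VanishesAt R (MvPolynomial.aeval ![u, w] f) ↔ π ∣ f := by
  constructor
  · intro hf
    by_cases hf0 : f = 0
    · simp [hf0]
    have hd : IsDivisorial R := ⟨_, hv⟩
    have hφ0 : MvPolynomial.aeval ![u, w] f ≠ 0 := fun e => hf0 (hc.aeval_eq_zero_iff.1 e)
    have h1 : ordAt R (MvPolynomial.aeval ![u, w] f) ≠ 0 := fun e =>
      hf.not_isUnitAt ((hd.isUnitAt_iff hφ0).2 e)
    have h2 := (hd.mem_iff hφ0).1 hf.mem
    have h3 : MvPolynomial.aeval ![u, w] f / MvPolynomial.aeval ![u, w] π ∈ R.toSubring := by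
      rw [hd.mem_iff (div_ne_zero hφ0 hv.1), hd.ordAt_div hφ0 hv.1, hv.ordAt_self]
      omega
    obtain ⟨a, b, hb, e⟩ := h.exists_div h3
    rw [div_eq_div_iff hv.1 hb.1, ← map_mul, ← map_mul] at e
    have e' := hc.aeval_injective e
    have hd' : π ∣ f * b := ⟨a, by rw [e', mul_comm]⟩
    rcases hπ.dvd_or_dvd hd' with hd | ⟨c, rfl⟩
    · exact hd
    · rw [map_mul] at hb
      exact absurd (hb.of_mul_left hv.2.1.mem (h.poly_mem c)) hv.2.1.not_isUnitAt
  · rintro ⟨c, rfl⟩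
    rw [map_mul]
    exact hv.2.1.mul_right (h.poly_mem c)

theorem unique_of_prime {R' : LocalSubring K} (h : IsLocPair k u w R) (h' : IsLocPair k u w R')
    (hc : IsCoordinates k u w) (hR : IsDiscreteValuationRing R.toSubring)
    (hR' : IsDiscreteValuationRing R'.toSubring) (hπ : Prime π)
    (hv : VanishesAt R (MvPolynomial.aeval ![u, w] π))
    (hv' : VanishesAt R' (MvPolynomial.aeval ![u, w] π)) : R = R' :=
  h.eq_of_poly h' fun f => by
    rw [h.vanishesAt_iff_dvd hc hπ (h.isUniformizerAt hc hR hπ hv),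
      h'.vanishesAt_iff_dvd hc hπ (h'.isUniformizerAt hc hR' hπ hv')]

end IsLocPair

theorem IsLocPair.exists_ideal (h : IsLocPair k u w R) :
    ∃ P : Ideal (MvPolynomial (Fin 2) k), P.IsPrime ∧
      ∀ f, f ∈ P ↔ VanishesAt R (MvPolynomial.aeval ![u, w] f) :=
  ⟨(IsLocalRing.maximalIdeal R.toSubring).comap
      ((MvPolynomial.aeval (R := k) ![u, w]).toRingHom.codRestrict R.toSubring h.poly_mem),
    Ideal.comap_isPrime _ _, fun f => ⟨fun hf => ⟨h.poly_mem f, hf⟩, fun ⟨_, hf⟩ => hf⟩⟩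

/-- The point of `Spec k[u, w]` that belongs to a prime ideal. -/
theorem exists_isLocPair_of_isPrime (hc : IsCoordinates k u w)
    {P : Ideal (MvPolynomial (Fin 2) k)} (hP : P.IsPrime) :
    ∃ R, IsLocPair k u w R ∧ ∀ f, VanishesAt R (MvPolynomial.aeval ![u, w] f) ↔ f ∈ P := by
  let A := (Algebra.adjoin k {u, w}).toSubring
  have hmem : ∀ f : MvPolynomial (Fin 2) k, MvPolynomial.aeval ![u, w] f ∈ A :=
    fun f => mem_adjoin_pair.2 ⟨f, rfl⟩
  let φ : MvPolynomial (Fin 2) k →+* A :=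
    (MvPolynomial.aeval (R := k) ![u, w]).toRingHom.codRestrict A hmem
  have hφ : Function.Bijective φ := by
    refine ⟨fun f g e => hc.aeval_injective (congrArg Subtype.val e), ?_⟩
    rintro ⟨a, ha⟩
    obtain ⟨f, hf⟩ := mem_adjoin_pair.1 ha
    exact ⟨f, Subtype.ext hf⟩
  let e := RingEquiv.ofBijective φ hφ
  have hP' : (P.comap e.symm).IsPrime := Ideal.comap_isPrime _ _
  have hloc : IsLocPair k u w (LocalSubring.ofPrime A (P.comap e.symm)) := isLocOf_ofPrime A _
  refine ⟨_, hloc, fun f => ?_⟩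
  have := isUnitAt_ofPrime (P := P.comap e.symm) (e f)
  rw [Ideal.mem_comap, RingEquiv.symm_apply_apply] at this
  rw [vanishesAt_iff]
  change _ ∧ ¬ IsUnitAt _ ((e f : A) : K) ↔ _
  rw [this, not_not]
  exact and_iff_right (hloc.poly_mem f)

/-- The prime divisor with a given prime equation. -/
theorem exists_isLocPair_of_prime (hc : IsCoordinates k u w) {π : MvPolynomial (Fin 2) k}
    (hπ : Prime π) :
    ∃ R, IsLocPair k u w R ∧ IsUniformizerAt R (MvPolynomial.aeval ![u, w] π) := by
  obtain ⟨R, hloc, hv⟩ := exists_isLocPair_of_isPrime hc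
    ((Ideal.span_singleton_prime hπ.ne_zero).2 hπ)
  have hu : ∀ f, IsUnitAt R (MvPolynomial.aeval ![u, w] f) ↔ ¬ π ∣ f := fun f => by
    have := hv f
    rw [Ideal.mem_span_singleton, vanishesAt_iff] at this
    rw [← this]
    simp [hloc.poly_mem f]
  have hπ0 : MvPolynomial.aeval ![u, w] π ≠ 0 := fun e => hπ.ne_zero (hc.aeval_eq_zero_iff.1 e)
  -- The order of a polynomial is its multiplicity at `π`: the cofactor is not divisible by `π`,
  -- hence is a unit at `R`.
  have key : ∀ f : MvPolynomial (Fin 2) k, f ≠ 0 → ∃ n : ℕ,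
      IsUnitAt R (MvPolynomial.aeval ![u, w] f / MvPolynomial.aeval ![u, w] π ^ (n : ℤ)) := by
    intro f hf
    obtain ⟨c, e, hc'⟩ := (FiniteMultiplicity.of_prime_left hπ hf).exists_eq_pow_mul_and_not_dvd
    refine ⟨multiplicity π f, ?_⟩
    generalize multiplicity π f = n at e
    rw [e, map_mul, map_pow, zpow_natCast, mul_div_cancel_left₀ _ (pow_ne_zero _ hπ0)]
    exact (hu c).2 hc'
  refine ⟨R, hloc, hπ0, vanishesAt_iff.2 ⟨hloc.poly_mem π, fun h => (hu π).1 h dvd_rfl⟩, ?_⟩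
  intro z hz
  obtain ⟨f, g, hg, rfl⟩ := hc.exists_div z
  obtain ⟨m, hm⟩ := key f (by rintro rfl; simp at hz)
  obtain ⟨n, hn⟩ := key g hg
  refine ⟨m - n, ?_⟩
  have hg0 : MvPolynomial.aeval ![u, w] g ≠ 0 := fun e => hg (hc.aeval_eq_zero_iff.1 e)
  have e := hm.div hn
  rw [zpow_sub₀ hπ0]
  convert e using 1
  field_simp

/-- A rational function that is a unit at all prime divisors through `Q` is a unit at `Q`. -/
theorem isUnitAt_of_forall_divisorial (hc : IsCoordinates k u w) {Q : LocalSubring K}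
    (hQ : IsLocPair k u w Q) {z : K} (hz : z ≠ 0)
    (hR : ∀ R, IsLocPair k u w R → IsDivisorial R → Q.toSubring ≤ R.toSubring → IsUnitAt R z) :
    IsUnitAt Q z := by
  obtain ⟨a, b, hb, rfl⟩ := hc.exists_div z
  have ha : a ≠ 0 := by rintro rfl; simp at hz
  -- In lowest terms no prime divisor can carry a zero of both numerator and denominator.
  obtain ⟨a', b', c, hcop, rfl, rfl⟩ :=
    UniqueFactorizationMonoid.exists_reduced_factors a ha b
  have hc0 : c ≠ 0 := left_ne_zero_of_mul ha
  have ha' : a' ≠ 0 := right_ne_zero_of_mul ha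
  have hb' : b' ≠ 0 := right_ne_zero_of_mul hb
  have hφ : ∀ f : MvPolynomial (Fin 2) k, f ≠ 0 → MvPolynomial.aeval ![u, w] f ≠ 0 :=
    fun f hf e => hf (hc.aeval_eq_zero_iff.1 e)
  rw [map_mul, map_mul, mul_div_mul_left _ _ (hφ c hc0)] at hR ⊢
  have key : ∀ f g : MvPolynomial (Fin 2) k, f ≠ 0 → g ≠ 0 → IsRelPrime f g →
      (∀ R, IsLocPair k u w R → IsDivisorial R → Q.toSubring ≤ R.toSubring →
        IsUnitAt R (MvPolynomial.aeval ![u, w] f / MvPolynomial.aeval ![u, w] g)) →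
      IsUnitAt Q (MvPolynomial.aeval ![u, w] f) := by
    intro f g hf hg hfg hR
    rcases isUnitAt_or_vanishesAt (hQ.poly_mem f) with h | h
    · exact h
    exfalso
    -- If the numerator vanished at `Q`, so would one of its prime factors `π`. The curve `π = 0`
    -- passes through `Q`, and the quotient is a unit along it, so `π` would divide the denominator
    -- too.
    have hfac : ∃ π, Prime π ∧ π ∣ f ∧ VanishesAt Q (MvPolynomial.aeval ![u, w] π) := by
      clear hR hfg
      induction f using UniqueFactorizationMonoid.induction_on_prime with
      | h₁ => exact absurd rfl hf
      | h₂ x hx =>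
        exfalso
        have := hx.map (MvPolynomial.aeval (R := k) ![u, w])
        obtain ⟨y, hy⟩ := hx.exists_right_inv
        refine h.not_isUnitAt (IsUnitAt.of_mul_left (g := MvPolynomial.aeval ![u, w] y) ?_
          h.mem (hQ.poly_mem y))
        rw [← map_mul, hy, map_one]
        exact .one
      | h₃ a p ha hp ih =>
        rw [map_mul] at h
        rcases h.of_mul (hQ.poly_mem _) (hQ.poly_mem _) with h | h
        · exact ⟨p, hp, dvd_mul_right _ _, h⟩
        · obtain ⟨π, h1, h2, h3⟩ := ih ha h
          exact ⟨π, h1, h2.mul_left _, h3⟩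
    obtain ⟨π, hπ, hπf, hπQ⟩ := hfac
    obtain ⟨R, hR1, hR2⟩ := exists_isLocPair_of_prime hc hπ
    have hQR : Q.toSubring ≤ R.toSubring := by
      refine IsLocOf.le_of_isUnitAt hQ hR1.1 fun s hs hsu => ?_
      obtain ⟨s, rfl⟩ := mem_adjoin_pair.1 hs
      rcases isUnitAt_or_vanishesAt (hR1.poly_mem s) with h | h
      · exact h
      obtain ⟨c, rfl⟩ := (hR1.vanishesAt_iff_dvd hc hπ hR2).1 h
      rw [map_mul] at hsu
      exact absurd (hsu.of_mul_left hπQ.mem (hQ.poly_mem c)) hπQ.not_isUnitAt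
    have hu := hR R hR1 ⟨_, hR2⟩ hQR
    have hfv : VanishesAt R (MvPolynomial.aeval ![u, w] f) :=
      (hR1.vanishesAt_iff_dvd hc hπ hR2).2 hπf
    have hgv : VanishesAt R (MvPolynomial.aeval ![u, w] g) := by
      have e : MvPolynomial.aeval ![u, w] g = MvPolynomial.aeval ![u, w] f *
          (MvPolynomial.aeval ![u, w] f / MvPolynomial.aeval ![u, w] g)⁻¹ := by
        have := hφ f hf
        have := hφ g hg
        field_simp
      rw [e]
      exact hfv.mul_right hu.inv_mem
    exact hπ.not_isUnit (hfg hπf ((hR1.vanishesAt_iff_dvd hc hπ hR2).1 hgv))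
  refine (key a' b' ha' hb' hcop hR).div (key b' a' hb' ha' hcop.symm fun R h1 h2 h3 => ?_)
  have := (hR R h1 h2 h3).inv
  rwa [inv_div] at this

/-! ### Graphs -/

namespace IsLocPair

variable {q : Polynomial k}

theorem isUniformizerAt_graph (h : IsLocPair k u w R) (hc : IsCoordinates k u w)
    (hR : IsDiscreteValuationRing R.toSubring) (hv : VanishesAt R (w - Polynomial.aeval u q)) :
    IsUniformizerAt R (w - Polynomial.aeval u q) := by
  have e : MvPolynomial.aeval ![u, w]
      (MvPolynomial.X 1 - Polynomial.aeval (MvPolynomial.X 0) q :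
      MvPolynomial (Fin 2) k) = w - Polynomial.aeval u q := by
    rw [map_sub, aeval_aeval_X_zero]; simp
  rw [← e] at hv ⊢
  exact h.isUniformizerAt hc hR (prime_right_sub q) hv

theorem unique_of_graph {R' : LocalSubring K} (h : IsLocPair k u w R) (h' : IsLocPair k u w R')
    (hc : IsCoordinates k u w) (hR : IsDiscreteValuationRing R.toSubring)
    (hR' : IsDiscreteValuationRing R'.toSubring) (hv : VanishesAt R (w - Polynomial.aeval u q))
    (hv' : VanishesAt R' (w - Polynomial.aeval u q)) : R = R' := by
  have e : MvPolynomial.aeval ![u, w]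
      (MvPolynomial.X 1 - Polynomial.aeval (MvPolynomial.X 0) q :
      MvPolynomial (Fin 2) k) = w - Polynomial.aeval u q := by
    rw [map_sub, aeval_aeval_X_zero]; simp
  rw [← e] at hv hv'
  exact h.unique_of_prime h' hc hR hR' (prime_right_sub q) hv hv'

theorem isUnitAt_aeval_of_graph (h : IsLocPair k u w R) (hc : IsCoordinates k u w)
    (hR : IsDiscreteValuationRing R.toSubring) (hv : VanishesAt R (w - Polynomial.aeval u q))
    {P : Polynomial k} (hP : P ≠ 0) : IsUnitAt R (Polynomial.aeval u P) := by
  rcases isUnitAt_or_vanishesAt (h.aeval_mem h.left_mem P) with hu | hu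
  · exact hu
  exfalso
  have e : MvPolynomial.aeval ![u, w]
      (MvPolynomial.X 1 - Polynomial.aeval (MvPolynomial.X 0) q :
      MvPolynomial (Fin 2) k) = w - Polynomial.aeval u q := by
    rw [map_sub, aeval_aeval_X_zero]; simp
  rw [← e] at hv
  have hv' := h.isUniformizerAt hc hR (prime_right_sub q) hv
  rw [← aeval_aeval_X_zero u w,
    h.vanishesAt_iff_dvd hc (prime_right_sub q) hv'] at hu
  -- Substituting `w = q(u)` kills the divisor `w - q(u)` and leaves `P` unchanged, which would
  -- force `P = 0`.
  have := map_dvd (MvPolynomial.aeval (R := k) ![Polynomial.X, q]) hu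
  rw [map_sub, aeval_aeval_X_zero, aeval_aeval_X_zero] at this
  simp [hP] at this

theorem isUnitAt_left_of_graph (h : IsLocPair k u w R) (hc : IsCoordinates k u w)
    (hR : IsDiscreteValuationRing R.toSubring) (hv : VanishesAt R (w - Polynomial.aeval u q))
    (c : k) : IsUnitAt R (u - algebraMap k K c) := by
  simpa using h.isUnitAt_aeval_of_graph hc hR hv (Polynomial.X_sub_C_ne_zero c)

end IsLocPair

end PrimeDivisors

/-! ## Differential operators generated by a derivation -/

section Hochschild

variable {k K : Type*} [Field k] [Field K] [Algebra k K]

/-- The operators `∑ i < n, c i * v ^ i`. -/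
def opSpan (v : Derivation k K K) (n : ℕ) : Submodule K (K → K) :=
  Submodule.span K {g | ∃ i < n, g = v^[i]}

variable {v : Derivation k K K} {m n : ℕ}

theorem opSpan_mono (h : m ≤ n) : opSpan v m ≤ opSpan v n :=
  Submodule.span_mono fun _ ⟨i, hi, e⟩ => ⟨i, hi.trans_le h, e⟩

theorem iterate_mem_opSpan (h : m < n) : (v^[m] : K → K) ∈ opSpan v n :=
  Submodule.subset_span ⟨m, h, rfl⟩

theorem opSpan_induction {C : (K → K) → Prop} (h0 : C 0)
    (hadd : ∀ g g', C g → C g' → C (g + g')) (hsmul : ∀ (c : K) g, C g → C (c • g))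
    (hi : ∀ i < n, C v^[i]) {g : K → K} (hg : g ∈ opSpan v n) : C g := by
  refine Submodule.span_induction (p := fun g _ => C g) ?_ h0 (fun g g' _ _ => hadd g g')
    (fun c g _ => hsmul c g) hg
  rintro - ⟨i, hin, rfl⟩
  exact hi i hin

theorem exists_of_mem_opSpan_succ {g : K → K} (hg : g ∈ opSpan v (n + 1)) :
    ∃ (c : K) (T : K → K), T ∈ opSpan v n ∧ g = c • v^[n] + T := by
  refine opSpan_induction (C := fun g => ∃ (c : K) (T : K → K), T ∈ opSpan v n ∧
    g = c • (v^[n] : K → K) + T) ?_ ?_ ?_ ?_ hg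
  · exact ⟨0, 0, zero_mem _, by simp⟩
  · rintro - - ⟨c, T, hT, rfl⟩ ⟨c', T', hT', rfl⟩
    exact ⟨c + c', T + T', add_mem hT hT', by module⟩
  · rintro a - ⟨c, T, hT, rfl⟩
    exact ⟨a * c, a • T, Submodule.smul_mem _ _ hT, by module⟩
  · intro i hi
    rcases Nat.lt_succ_iff_lt_or_eq.1 hi with h | rfl
    · exact ⟨0, v^[i], iterate_mem_opSpan h, by simp⟩
    · exact ⟨1, 0, zero_mem _, by simp⟩

/-- The commutator of an operator with the multiplication by `a`. -/
def opComm (a : K) (T : K → K) : K → K := fun z => T (a * z) - a * T z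

theorem opComm_add (a : K) (T T' : K → K) : opComm a (T + T') = opComm a T + opComm a T' := by
  funext z; simp only [opComm, Pi.add_apply]; ring

theorem opComm_smul (a c : K) (T : K → K) : opComm a (c • T) = c • opComm a T := by
  funext z; simp only [opComm, Pi.smul_apply, smul_eq_mul]; ring

/-- In Leibniz' formula the term without derivatives on `a` cancels and the one with a single
derivative on `a` is the leading term. -/
theorem opComm_iterate (a : K) (n : ℕ) :
    ∃ T ∈ opSpan v n, opComm a v^[n + 1] = ((n + 1 : ℕ) * v a) • v^[n] + T := by
  -- These are the Leibniz terms with at least two derivatives on `a`.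
  refine ⟨∑ i ∈ Finset.range n, ((n + 1).choose (i + 2) * v^[i + 2] a) • v^[n - (i + 1)],
    Submodule.sum_mem _ fun i hi => Submodule.smul_mem _ _ (iterate_mem_opSpan ?_), ?_⟩
  · have := Finset.mem_range.1 hi
    omega
  · funext z
    simp only [opComm, Pi.add_apply, Pi.smul_apply, Finset.sum_apply, smul_eq_mul]
    rw [iterate_leibniz, Finset.sum_range_succ', Finset.sum_range_succ']
    simp only [Nat.choose_zero_right, Function.iterate_zero, id, Nat.choose_one_right,
      Function.iterate_one, zero_add, Nat.sub_zero, Nat.cast_one, Nat.add_sub_cancel]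
    have e : ∀ i, n + 1 - (i + 1 + 1) = n - (i + 1) := fun i => by omega
    simp only [e]
    rw [Finset.sum_congr rfl fun i _ => (mul_assoc _ _ _).symm]
    ring

theorem opComm_mem_opSpan (a : K) {T : K → K} (hT : T ∈ opSpan v (n + 1)) :
    opComm a T ∈ opSpan v n := by
  refine opSpan_induction (C := fun T => opComm a T ∈ opSpan v n) ?_ ?_ ?_ ?_ hT
  · have : opComm a (0 : K → K) = 0 := by funext z; simp [opComm]
    rw [this]; exact zero_mem _
  · intro g g' hg hg'
    rw [opComm_add]; exact add_mem hg hg'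
  · intro c g hg
    rw [opComm_smul]; exact Submodule.smul_mem _ _ hg
  · intro i hi
    cases i with
    | zero =>
      have : opComm a (v^[0]) = 0 := by funext z; simp [opComm]
      rw [this]; exact zero_mem _
    | succ i =>
      obtain ⟨T, hT, e⟩ := opComm_iterate (v := v) a i
      rw [e]
      exact add_mem (Submodule.smul_mem _ _ (iterate_mem_opSpan (by omega)))
        (opSpan_mono (by omega) hT)

/-- The commutator with some `a` such that `v a ≠ 0` lowers orders by one and multiplies the leading
coefficient by `(n + 1) v a`, which is nonzero because `n + 1 < p`. A relation for `v^(n+1)` thus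
descends step by step to the absurd relation `id = 0`. -/
theorem iterate_notMem_opSpan (p : ℕ) [CharP K p] (hv : v ≠ 0) (hn : n < p) :
    (v^[n] : K → K) ∉ opSpan v n := by
  induction n with
  | zero =>
    intro h
    have : (v^[0] : K → K) = 0 := by simpa [opSpan] using h
    simpa using congrFun this 1
  | succ n ih =>
    intro h
    obtain ⟨a, ha⟩ : ∃ a, v a ≠ 0 := by
      by_contra! h
      exact hv (Derivation.ext h)
    refine ih (by omega) ?_
    have h1 := opComm_mem_opSpan a h
    obtain ⟨T, hT, e⟩ := opComm_iterate (v := v) a n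
    rw [e] at h1
    have h2 := (Submodule.add_mem_iff_left _ hT).1 h1
    have h3 : (((n + 1 : ℕ) : K) * v a) ≠ 0 := by
      refine mul_ne_zero (fun h0 => ?_) ha
      rw [CharP.cast_eq_zero_iff K p] at h0
      exact absurd (Nat.le_of_dvd (by omega) h0) (by omega)
    exact (Submodule.smul_mem_iff _ h3).1 h2

/-- The commutator of a derivation with a multiplication has order zero, whereas that of an operator
of order between `2` and `p - 1` has positive order. So `D` has order at most one, and `D 1 = 0`
removes the constant term. -/
theorem derivation_mem_opSpan (p : ℕ) [CharP K p] (hv : v ≠ 0) (D : Derivation k K K)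
    (hn : n < p)
    (hD : (D : K → K) ∈ opSpan v (n + 1)) : ∃ c : K, D = c • v := by
  induction n with
  | zero =>
    obtain ⟨c, T, hT, e⟩ := exists_of_mem_opSpan_succ hD
    have hT0 : T = 0 := by simpa [opSpan] using hT
    refine ⟨0, Derivation.ext fun z => ?_⟩
    have h1 := congrFun e 1
    have hz := congrFun e z
    simp [hT0] at h1 hz
    simp [hz, ← h1]
  | succ n ih =>
    obtain ⟨c, T, hT, e⟩ := exists_of_mem_opSpan_succ hD
    rcases Nat.eq_zero_or_pos n with rfl | hn0
    · obtain ⟨c', T', hT', rfl⟩ := exists_of_mem_opSpan_succ hT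
      have hT0 : T' = 0 := by simpa [opSpan] using hT'
      refine ⟨c, Derivation.ext fun z => ?_⟩
      have h1 := congrFun e 1
      have hz := congrFun e z
      simp [hT0] at h1 hz
      simp [hz, ← h1]
    · have hc : c = 0 := by
        by_contra hc
        obtain ⟨a, ha⟩ : ∃ a, v a ≠ 0 := by
          by_contra! h
          exact hv (Derivation.ext h)
        obtain ⟨T', hT', e'⟩ := opComm_iterate (v := v) a n
        have h1 : opComm a D = (D a) • v^[0] := by
          funext z
          simp [opComm, mul_comm z]
        have h2 : opComm a D ∈ opSpan v n := by
          rw [h1]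
          exact Submodule.smul_mem _ _ (iterate_mem_opSpan hn0)
        rw [e, opComm_add, opComm_smul, e', smul_add, smul_smul,
          Submodule.add_mem_iff_left _ (opComm_mem_opSpan a hT),
          Submodule.add_mem_iff_left _ (Submodule.smul_mem _ _ hT')] at h2
        have h3 : (((n + 1 : ℕ) : K) * v a) ≠ 0 := by
          refine mul_ne_zero (fun h0 => ?_) ha
          rw [CharP.cast_eq_zero_iff K p] at h0
          exact absurd (Nat.le_of_dvd (by omega) h0) (by omega)
        exact iterate_notMem_opSpan p hv (by omega)
          ((Submodule.smul_mem_iff _ (mul_ne_zero hc h3)).1 h2)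
      refine ih (by omega) ?_
      rw [e, hc]
      simpa using hT

/-- Applying `f v` to `c v^i` gives `f c v^(i+1) + f v(c) v^i`: lower-order terms rise by at most
one order, and the leading coefficient gains a factor `f`. -/
theorem iterate_smul_sub_mem (v : Derivation k K K) (f : K) (n : ℕ) :
    ∃ T ∈ opSpan v n, ((f • v : Derivation k K K)^[n] : K → K) = f ^ n • v^[n] + T := by
  induction n with
  | zero => exact ⟨0, zero_mem _, by funext z; simp⟩
  | succ n ih =>
    obtain ⟨T, hT, e⟩ := ih
    have key : T ∈ opSpan v n ∧ (fun z => f * v (T z)) ∈ opSpan v (n + 1) := by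
      refine opSpan_induction
        (C := fun T => T ∈ opSpan v n ∧ (fun z => f * v (T z)) ∈ opSpan v (n + 1)) ?_ ?_ ?_ ?_ hT
      · have : (fun z : K => f * v ((0 : K → K) z)) = 0 := by funext z; simp
        rw [this]; exact ⟨zero_mem _, zero_mem _⟩
      · intro g g' hg hg'
        refine ⟨add_mem hg.1 hg'.1, ?_⟩
        convert add_mem hg.2 hg'.2 using 1
        funext z; simp [mul_add]
      · intro c g hg
        refine ⟨Submodule.smul_mem _ _ hg.1, ?_⟩
        convert add_mem (Submodule.smul_mem _ c hg.2)
          (Submodule.smul_mem _ (f * v c) (opSpan_mono n.le_succ hg.1)) using 1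
        funext z
        simp only [Pi.smul_apply, Pi.add_apply, smul_eq_mul, Derivation.leibniz]
        ring
      · intro i hi
        refine ⟨iterate_mem_opSpan hi, ?_⟩
        convert Submodule.smul_mem _ f (iterate_mem_opSpan (v := v) (show i + 1 < n + 1 by omega))
          using 1
        funext z
        rw [Pi.smul_apply, Function.iterate_succ_apply', smul_eq_mul]
    refine ⟨(fun z => f * v (T z)) + (f * v (f ^ n)) • v^[n],
      add_mem key.2 (Submodule.smul_mem _ _ (iterate_mem_opSpan (by omega))), ?_⟩
    funext z
    rw [Function.iterate_succ_apply', e]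
    simp only [Derivation.smul_apply, Pi.add_apply, Pi.smul_apply, smul_eq_mul, map_add,
      Derivation.leibniz, Function.iterate_succ_apply']
    ring

/-- Hochschild's formula. -/
theorem pPow_smul (p : ℕ) [Fact p.Prime] [CharP k p] (v : Derivation k K K) (f : K) :
    ∃ c : K, pPow p (f • v) = f ^ p • pPow p v + c • v := by
  have hK : CharP K p := charP_of_injective_algebraMap (algebraMap k K).injective p
  by_cases hv : v = 0
  · subst hv
    have hp : (pPow p (0 : Derivation k K K)) = 0 := by
      refine Derivation.ext fun z => ?_
      obtain ⟨q, hq⟩ := Nat.exists_eq_succ_of_ne_zero (Fact.out : p.Prime).ne_zero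
      rw [pPow_apply, hq, Function.iterate_succ_apply']
      simp
    exact ⟨0, by simp [hp]⟩
  have hp1 : p - 1 + 1 = p := Nat.sub_add_cancel (Fact.out : p.Prime).pos
  obtain ⟨T, hT, e⟩ := iterate_smul_sub_mem v f p
  -- The difference is a derivation and at the same time an operator of order below `p` in `v`,
  -- hence a multiple of `v`.
  obtain ⟨c, hc⟩ := derivation_mem_opSpan p hv (pPow p (f • v) - f ^ p • pPow p v)
    (n := p - 1) (by omega) (by
      rw [hp1]
      convert hT using 1
      funext z
      have := congrFun e z
      simp only [Derivation.sub_apply, Derivation.smul_apply, pPow_apply, this]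
      simp)
  exact ⟨c, by rw [← hc]; abel⟩

end Hochschild

/-! ## Stalks of the foliation at a point with local coordinates -/

section Stalks

variable {k K : Type*} [Field k] [Field K] [Algebra k K] {u w : K} {R : LocalSubring K}
  {F : Foliation k K} {v : Derivation k K K}

theorem IsCoordinates.derivation_ext (hc : IsCoordinates k u w) {D D' : Derivation k K K}
    (hu : D u = D' u) (hw : D w = D' w) : D = D' := by
  refine Derivation.ext fun z => ?_
  have hz : z ∈ IntermediateField.adjoin k {u, w} := hc.2 ▸ IntermediateField.mem_top
  induction hz using IntermediateField.adjoin_induction with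
  | mem x hx =>
    rcases hx with rfl | rfl
    exacts [hu, hw]
  | algebraMap x => simp
  | add x y _ _ hx hy => simp [hx, hy]
  | inv x _ hx => simp [Derivation.leibniz_inv, hx]
  | mul x y _ _ hx hy => simp [hx, hy]

theorem contract_D (v : Derivation k K K) (f : K) :
    contract v (KaehlerDifferential.D k K f) = v f :=
  v.liftKaehlerDifferential_comp_D f

theorem contract_add (v : Derivation k K K) (ω ω' : Ω[K⁄k]) :
    contract v (ω + ω') = contract v ω + contract v ω' := map_add _ _ _

theorem contract_sub (v : Derivation k K K) (ω ω' : Ω[K⁄k]) :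
    contract v (ω - ω') = contract v ω - contract v ω' := map_sub _ _ _

theorem contract_smul (v : Derivation k K K) (f : K) (ω : Ω[K⁄k]) :
    contract v (f • ω) = f * contract v ω := map_smul _ _ _

theorem contract_add_smul (v v' : Derivation k K K) (f g : K) (ω : Ω[K⁄k]) :
    contract (f • v + g • v') ω = f * contract v ω + g * contract v' ω := by
  have : ω ∈ Submodule.span K (Set.range (KaehlerDifferential.D k K)) := by
    rw [KaehlerDifferential.span_range_derivation]; trivial
  induction this using Submodule.span_induction with
  | mem x hx =>
    obtain ⟨z, rfl⟩ := hx
    simp [contract_D]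
  | zero => simp [contract]
  | add x y _ _ hx hy => simp only [contract_add, hx, hy]; ring
  | smul a x _ hx => simp only [contract_smul, hx]; ring

theorem kaehler_smul_def (c : R.toSubring) (ω : Ω[K⁄k]) : c • ω = (c : K) • ω :=
  (algebraMap_smul K c ω).symm

namespace IsLocPair

/-- Near a point with coordinates `u, w` the forms `du, dw` generate the regular differentials; the
quotient rule extends this from polynomials to the local ring. -/
theorem exists_D_eq (h : IsLocPair k u w R) {f : K} (hf : f ∈ R.toSubring) :
    ∃ a ∈ R.toSubring, ∃ b ∈ R.toSubring, KaehlerDifferential.D k K f =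
      a • KaehlerDifferential.D k K u + b • KaehlerDifferential.D k K w := by
  have key : ∀ f ∈ Algebra.adjoin k {u, w}, ∃ a ∈ R.toSubring, ∃ b ∈ R.toSubring,
      KaehlerDifferential.D k K f =
      a • KaehlerDifferential.D k K u + b • KaehlerDifferential.D k K w := by
    intro f hf
    have hmem : ∀ f ∈ Algebra.adjoin k {u, w}, f ∈ R.toSubring := fun f hf => h.1 hf
    induction hf using Algebra.adjoin_induction with
    | mem x hx =>
      rcases hx with rfl | rfl
      · exact ⟨1, R.toSubring.one_mem, 0, R.toSubring.zero_mem, by simp⟩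
      · exact ⟨0, R.toSubring.zero_mem, 1, R.toSubring.one_mem, by simp⟩
    | algebraMap c => exact ⟨0, R.toSubring.zero_mem, 0, R.toSubring.zero_mem, by simp⟩
    | add x y _ _ hx hy =>
      obtain ⟨a, ha, b, hb, e⟩ := hx
      obtain ⟨a', ha', b', hb', e'⟩ := hy
      refine ⟨a + a', R.toSubring.add_mem ha ha', b + b', R.toSubring.add_mem hb hb', ?_⟩
      rw [map_add, e, e']; module
    | mul x y hx0 hy0 hx hy =>
      obtain ⟨a, ha, b, hb, e⟩ := hx
      obtain ⟨a', ha', b', hb', e'⟩ := hy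
      have hx := hmem x hx0
      have hy := hmem y hy0
      refine ⟨x * a' + y * a, add_mem (mul_mem hx ha') (mul_mem hy ha), x * b' + y * b,
        add_mem (mul_mem hx hb') (mul_mem hy hb), ?_⟩
      rw [Derivation.leibniz, e, e']; module
  obtain ⟨x, hx, y, hy, hyu, rfl⟩ := h.2 f hf
  obtain ⟨a, ha, b, hb, e⟩ := key x hx
  obtain ⟨a', ha', b', hb', e'⟩ := key y hy
  have hx' := h.1 hx
  have hy' := hyu.mem
  have hi := (hyu.pow 2).inv_mem
  refine ⟨(y ^ 2)⁻¹ * (y * a - x * a'),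
    mul_mem hi (sub_mem (mul_mem hy' ha) (mul_mem hx' ha')), (y ^ 2)⁻¹ * (y * b - x * b'),
    mul_mem hi (sub_mem (mul_mem hy' hb) (mul_mem hx' hb')), ?_⟩
  rw [Derivation.leibniz_div, e, e']
  module

theorem exists_apply_eq (h : IsLocPair k u w R) {f : K} (hf : f ∈ R.toSubring) :
    ∃ a ∈ R.toSubring, ∃ b ∈ R.toSubring, ∀ v : Derivation k K K, v f = a * v u + b * v w := by
  obtain ⟨a, ha, b, hb, e⟩ := h.exists_D_eq hf
  refine ⟨a, ha, b, hb, fun v => ?_⟩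
  rw [← contract_D, e, contract_add, contract_smul, contract_smul, contract_D, contract_D]

theorem derivation_mem (h : IsLocPair k u w R) (hu : v u ∈ R.toSubring) (hw : v w ∈ R.toSubring)
    {f : K} (hf : f ∈ R.toSubring) : v f ∈ R.toSubring := by
  obtain ⟨a, ha, b, hb, e⟩ := h.exists_apply_eq hf
  rw [e v]
  exact R.toSubring.add_mem (R.toSubring.mul_mem ha hu) (R.toSubring.mul_mem hb hw)

end IsLocPair

/-- The vector field `v` is regular without zeros at a point with local coordinates `u, w`. -/
def IsPrimitiveAt (R : LocalSubring K) (u w : K) (v : Derivation k K K) : Prop :=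
  v u ∈ R.toSubring ∧ v w ∈ R.toSubring ∧ (IsUnitAt R (v u) ∨ IsUnitAt R (v w))

theorem IsPrimitiveAt.ne_zero (h : IsPrimitiveAt R u w v) : v ≠ 0 := by
  rintro rfl
  rcases h.2.2 with h | h <;> simpa using h.1

theorem IsPrimitiveAt.mem_of_smul (h : IsPrimitiveAt R u w v) {c : K}
    (hu : c * v u ∈ R.toSubring) (hw : c * v w ∈ R.toSubring) : c ∈ R.toSubring := by
  rcases h.2.2 with h | h
  · have := R.toSubring.mul_mem hu h.inv_mem
    rwa [mul_assoc, mul_inv_cancel₀ h.1, mul_one] at this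
  · have := R.toSubring.mul_mem hw h.inv_mem
    rwa [mul_assoc, mul_inv_cancel₀ h.1, mul_one] at this

theorem Foliation.exists_smul_eq (hv : v ∈ F.line) (hv0 : v ≠ 0) {v' : Derivation k K K}
    (hv' : v' ∈ F.line) : ∃ c : K, v' = c • v := by
  obtain ⟨c, hc⟩ := exists_smul_eq_of_finrank_eq_one F.finrank_line
    (x := (⟨v, hv⟩ : F.line)) (fun e => hv0 (congrArg Subtype.val e)) ⟨v', hv'⟩
  exact ⟨c, (congrArg Subtype.val hc).symm⟩

/-- If `c v` is regular, then `c` is regular: divide by whichever of `v u`, `v w` is a unit. -/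
theorem IsLocPair.isGenerator_tangentStalk (h : IsLocPair k u w R) (hv : v ∈ F.line)
    (hp : IsPrimitiveAt R u w v) : IsGenerator (tangentStalk F R) v := by
  refine le_antisymm ?_ ?_
  · rintro v' ⟨hv', hR⟩
    obtain ⟨c, rfl⟩ := Foliation.exists_smul_eq hv hp.ne_zero hv'
    have hcR := hp.mem_of_smul (hR u h.left_mem) (hR w h.right_mem)
    exact Submodule.mem_span_singleton.2 ⟨⟨c, hcR⟩, rfl⟩
  · rw [Submodule.span_singleton_le_iff_mem]
    exact ⟨hv, fun f hf => h.derivation_mem hp.1 hp.2.1 hf⟩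

/-- A form `a du + b dw` that kills `v` has `(a, b)` proportional to `(v w, -v u)`, and the factor
is regular because one of these entries is a unit. -/
theorem IsLocPair.isGenerator_conormalStalk (h : IsLocPair k u w R) (hv : v ∈ F.line)
    (hp : IsPrimitiveAt R u w v) : IsGenerator (conormalStalk F R)
      (v w • KaehlerDifferential.D k K u - v u • KaehlerDifferential.D k K w) := by
  refine le_antisymm ?_ ?_
  · rintro ω ⟨hω, hF⟩
    have hab : ∃ a ∈ R.toSubring, ∃ b ∈ R.toSubring,
        ω = a • KaehlerDifferential.D k K u + b • KaehlerDifferential.D k K w := by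
      clear hF
      induction hω using Submodule.span_induction with
      | mem x hx =>
        obtain ⟨f, hf, rfl⟩ := hx
        exact h.exists_D_eq hf
      | zero => exact ⟨0, R.toSubring.zero_mem, 0, R.toSubring.zero_mem, by simp⟩
      | add x y _ _ hx hy =>
        obtain ⟨a, ha, b, hb, rfl⟩ := hx
        obtain ⟨a', ha', b', hb', rfl⟩ := hy
        exact ⟨a + a', add_mem ha ha', b + b', add_mem hb hb', by module⟩
      | smul c x _ hx =>
        obtain ⟨a, ha, b, hb, rfl⟩ := hx
        refine ⟨c * a, mul_mem c.2 ha, c * b, mul_mem c.2 hb, ?_⟩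
        rw [kaehler_smul_def]
        module
    obtain ⟨a, ha, b, hb, rfl⟩ := hab
    have h0 : contract v (a • KaehlerDifferential.D k K u + b • KaehlerDifferential.D k K w) = 0 :=
      hF v hv
    rw [contract_add, contract_smul, contract_smul, contract_D, contract_D] at h0
    rw [Submodule.mem_span_singleton]
    rcases hp.2.2 with hu | hu
    · refine ⟨⟨-b * (v u)⁻¹, R.toSubring.mul_mem (R.toSubring.neg_mem hb) hu.inv_mem⟩, ?_⟩
      have hu0 := hu.1
      have ea : a = -b * (v u)⁻¹ * v w := by
        field_simp
        linear_combination h0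
      have eb : b = -(-b * (v u)⁻¹ * v u) := by field_simp
      rw [kaehler_smul_def, smul_sub, smul_smul, smul_smul, sub_eq_add_neg, ← neg_smul, ← ea, ← eb]
    · refine ⟨⟨a * (v w)⁻¹, R.toSubring.mul_mem ha hu.inv_mem⟩, ?_⟩
      have hu0 := hu.1
      have ea : b = -(a * (v w)⁻¹ * v u) := by
        field_simp
        linear_combination h0
      have eb : a = a * (v w)⁻¹ * v w := by field_simp
      rw [kaehler_smul_def, smul_sub, smul_smul, smul_smul, sub_eq_add_neg, ← neg_smul, ← ea, ← eb]
  · rw [Submodule.span_singleton_le_iff_mem]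
    refine ⟨?_, fun v' hv' => ?_⟩
    · refine Submodule.sub_mem _
        (Submodule.smul_mem _ (⟨v w, hp.2.1⟩ : R.toSubring)
          (Submodule.subset_span ⟨u, h.left_mem, rfl⟩))
        (Submodule.smul_mem _ (⟨v u, hp.1⟩ : R.toSubring)
          (Submodule.subset_span ⟨w, h.right_mem, rfl⟩))
    · obtain ⟨c, rfl⟩ := Foliation.exists_smul_eq hv hp.ne_zero hv'
      rw [contract_sub, contract_smul, contract_smul, contract_D, contract_D]
      simp only [Derivation.smul_apply, smul_eq_mul]
      ring

/-- Divide `v` by its component of smaller order; of two elements of a valued field one divides the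
other. -/
theorem IsDivisorial.exists_isPrimitiveAt (hR : IsDivisorial R) (hc : IsCoordinates k u w)
    (hv : v ≠ 0) : ∃ c : K, c ≠ 0 ∧ IsPrimitiveAt R u w (c • v) := by
  by_cases hu : v u = 0
  · have hw : v w ≠ 0 := fun hw => hv (hc.derivation_ext (by simpa using hu) (by simpa using hw))
    refine ⟨(v w)⁻¹, inv_ne_zero hw, ?_⟩
    simp [IsPrimitiveAt, hu, hw, R.toSubring.zero_mem, R.toSubring.one_mem, IsUnitAt.one]
  by_cases hw : v w = 0
  · refine ⟨(v u)⁻¹, inv_ne_zero hu, ?_⟩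
    simp [IsPrimitiveAt, hu, hw, R.toSubring.zero_mem, R.toSubring.one_mem, IsUnitAt.one]
  rcases hR.mem_or_inv_mem (v u / v w) with h | h
  · refine ⟨(v w)⁻¹, inv_ne_zero hw, ?_⟩
    rw [div_eq_inv_mul] at h
    simp [IsPrimitiveAt, hw, h, R.toSubring.one_mem, IsUnitAt.one]
  · refine ⟨(v u)⁻¹, inv_ne_zero hu, ?_⟩
    rw [inv_div, div_eq_inv_mul] at h
    simp [IsPrimitiveAt, hu, h, R.toSubring.one_mem, IsUnitAt.one]

/-- Makes the divisors that are defined by a choice of local generators independent of that choice.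
-/
theorem IsGenerator.exists_isUnitAt {M : Type*} [AddCommGroup M] [Module K M]
    {N : Submodule R.toSubring M} {m m' : M} (h : IsGenerator N m)
    (h' : IsGenerator N m') (h0 : m ≠ 0) : ∃ c : K, IsUnitAt R c ∧ m' = c • m := by
  have h1 : m' ∈ Submodule.span R.toSubring {m} := by
    rw [← h, h']; exact Submodule.mem_span_singleton_self _
  have h2 : m ∈ Submodule.span R.toSubring {m'} := by
    rw [← h', h]; exact Submodule.mem_span_singleton_self _
  obtain ⟨c, rfl⟩ := Submodule.mem_span_singleton.1 h1
  obtain ⟨c', hc'⟩ := Submodule.mem_span_singleton.1 h2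
  refine ⟨c, ?_, rfl⟩
  have e : ((c' : K) * c) • m = m := by rw [mul_smul]; exact hc'
  have e1 : (c' : K) * c = 1 := by
    by_contra hn
    have : ((c' : K) * c - 1) • m = 0 := by rw [sub_smul, e, one_smul, sub_self]
    rcases smul_eq_zero.1 this with h | h
    · exact hn (sub_eq_zero.1 h)
    · exact h0 h
  refine ⟨right_ne_zero_of_mul_eq_one e1, c.2, ?_⟩
  rw [← eq_inv_of_mul_eq_one_left e1]
  exact c'.2

theorem canonicalDivisor_eq {X : Set (LocalSubring K)} {C : PrimeDivisor X}
    (hC : IsDivisorial C.1) (hg : IsGenerator (tangentStalk F C.1) v) (hv : v ≠ 0) {f : K}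
    (hf : f ≠ 0) : canonicalDivisor X F (f • v) C = -ordAt C.1 f := by
  have hex : ∃ n : ℤ, ∃ (w : Derivation k K K) (g : K),
      IsGenerator (tangentStalk F C.1) w ∧ f • v = g • w ∧ n = ordAt C.1 g :=
    ⟨_, v, f, hg, rfl, rfl⟩
  obtain ⟨v', g, hg', e, hn⟩ := Classical.epsilon_spec hex
  obtain ⟨c, hc, rfl⟩ := hg.exists_isUnitAt hg' hv
  have e' : f = g * c := by
    rw [smul_smul, ← sub_eq_zero, ← sub_smul, smul_eq_zero] at e
    rcases e with e | e
    · exact sub_eq_zero.1 e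
    · exact absurd e hv
  have hg0 : g ≠ 0 := by rintro rfl; simp [hf] at e'
  rw [canonicalDivisor, neg_inj]
  refine hn.trans ?_
  rw [e', hC.ordAt_mul hg0 hc.1, hC.ordAt_isUnitAt hc, add_zero]

/-- The contraction of `v ^ p` with the `1`-form `v(w) du - v(u) dw`. -/
def pContract (p : ℕ) (u w : K) (v : Derivation k K K) : K :=
  v w * v^[p] u - v u * v^[p] w

theorem contract_conormal (D : Derivation k K K) :
    contract D (v w • KaehlerDifferential.D k K u - v u • KaehlerDifferential.D k K w) =
      v w * D u - v u * D w := by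
  rw [contract_sub, contract_smul, contract_smul, contract_D, contract_D]


/-- `pContract` is the determinant of `v` and `v^p` in the coordinates `u, w`, so its vanishing
would put `v^p` on the line spanned by `v`. -/
theorem IsCoordinates.pContract_ne_zero {p : ℕ} [Fact p.Prime] [CharP k p]
    (hc : IsCoordinates k u w) (hv : v ∈ F.line) (hv0 : v ≠ 0)
    (hp : pPow p v ∉ F.line) : pContract p u w v ≠ 0 := by
  intro e
  apply hp
  rw [pContract, ← pPow_apply, ← pPow_apply] at e
  by_cases hu : v u = 0
  · have hw : v w ≠ 0 := fun hw => hv0 (hc.derivation_ext (by simpa using hu) (by simpa using hw))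
    have : pPow p v = (pPow p v w / v w) • v := by
      refine hc.derivation_ext ?_ ?_
      · simp only [hu, zero_mul, sub_zero, mul_eq_zero, hw, false_or] at e
        simp [hu, e]
      · simp [hw]
    rw [this]
    exact F.line.smul_mem _ hv
  · have : pPow p v = (pPow p v u / v u) • v := by
      refine hc.derivation_ext ?_ ?_
      · simp [hu]
      · simp only [Derivation.smul_apply, smul_eq_mul]
        field_simp
        linear_combination -e
    rw [this]
    exact F.line.smul_mem _ hv

/-- By Hochschild's formula, closure of the line under p-th powers is decided by any one of its
nonzero vector fields. -/
theorem pPow_notMem_of_ne_zero {p : ℕ} [Fact p.Prime] [CharP k p] (hv : v ∈ F.line)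
    (hp : pPow p v ∉ F.line) {v' : Derivation k K K}
    (hv' : v' ∈ F.line) (h0 : v' ≠ 0) : pPow p v' ∉ F.line := by
  intro h
  obtain ⟨c, rfl⟩ := Foliation.exists_smul_eq hv' h0 hv
  obtain ⟨a, e⟩ := pPow_smul p v' c
  rw [e] at hp
  exact hp (F.line.add_mem (F.line.smul_mem _ h) (F.line.smul_mem _ hv'))

/-- The exponent is `p` from Hochschild's formula plus `1` from the conormal form; the term `a v`
contracts to zero. -/
theorem pContract_smul {p : ℕ} [Fact p.Prime] [CharP k p] (c : K) :
    pContract p u w (c • v) = c ^ (p + 1) * pContract p u w v := by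
  obtain ⟨a, e⟩ := pPow_smul p v c
  simp only [pContract, ← pPow_apply, e]
  simp only [Derivation.add_apply, Derivation.smul_apply, smul_eq_mul]
  ring

theorem IsLocPair.pContract_mem {p : ℕ} (h : IsLocPair k u w R) (hp : IsPrimitiveAt R u w v) :
    pContract p u w v ∈ R.toSubring := by
  have hi : ∀ n : ℕ, ∀ f ∈ R.toSubring, v^[n] f ∈ R.toSubring := by
    intro n
    induction n with
    | zero => intro f hf; exact hf
    | succ n ih =>
      intro f hf
      rw [Function.iterate_succ_apply]
      exact ih _ (h.derivation_mem hp.1 hp.2.1 hf)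
  exact R.toSubring.sub_mem (R.toSubring.mul_mem hp.2.1 (hi _ _ h.left_mem))
    (R.toSubring.mul_mem hp.1 (hi _ _ h.right_mem))

/-- Another choice of generators changes the contraction by units only: the multiple of `v` in
Hochschild's formula is killed by the conormal form. -/
theorem pDivisor_eq {p : ℕ} [Fact p.Prime] [CharP k p] {X : Set (LocalSubring K)}
    {C : PrimeDivisor X} (hC : IsDivisorial C.1)
    (h : IsLocPair k u w C.1) (hc : IsCoordinates k u w) (hv : v ∈ F.line)
    (hp : IsPrimitiveAt C.1 u w v) (hF : pPow p v ∉ F.line) :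
    pDivisor p X F C = ordAt C.1 (pContract p u w v) := by
  have hT := h.isGenerator_tangentStalk hv hp
  have hN := h.isGenerator_conormalStalk hv hp
  have hex : ∃ n : ℤ, ∃ (v : Derivation k K K) (ω : Ω[K⁄k]),
      IsGenerator (tangentStalk F C.1) v ∧ IsGenerator (conormalStalk F C.1) ω ∧
      n = ordAt C.1 (contract (pPow p v) ω) := ⟨_, v, _, hT, hN, rfl⟩
  obtain ⟨v', ω', hT', hN', hn⟩ := Classical.epsilon_spec hex
  refine Eq.trans hn ?_
  have hne := hc.pContract_ne_zero hv hp.ne_zero hF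
  have hcon : contract (pPow p v)
      (v w • KaehlerDifferential.D k K u - v u • KaehlerDifferential.D k K w) =
      pContract p u w v := by
    rw [contract_conormal, pContract, pPow_apply, pPow_apply]
  obtain ⟨c, hcu, rfl⟩ := hT.exists_isUnitAt hT' hp.ne_zero
  obtain ⟨b, hbu, rfl⟩ := hN.exists_isUnitAt hN' (by
    intro e
    rw [e] at hcon
    exact hne (by rw [← hcon]; simp [contract]))
  obtain ⟨a, e⟩ := pPow_smul p v c
  have hv0 : contract v
      (v w • KaehlerDifferential.D k K u - v u • KaehlerDifferential.D k K w) = 0 := by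
    rw [contract_conormal]; ring
  rw [contract_smul, e, contract_add_smul, hcon, hv0, mul_zero, add_zero,
    hC.ordAt_mul hbu.1 (mul_ne_zero (pow_ne_zero _ hcu.1) hne),
    hC.ordAt_mul (pow_ne_zero _ hcu.1) hne, hC.ordAt_isUnitAt hbu, hC.ordAt_isUnitAt (hcu.pow p)]
  ring

theorem pDivisor_nonneg {p : ℕ} [Fact p.Prime] [CharP k p] {X : Set (LocalSubring K)}
    {C : PrimeDivisor X} (hC : IsDivisorial C.1)
    (h : IsLocPair k u w C.1) (hc : IsCoordinates k u w) (hv : v ∈ F.line)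
    (hF : pPow p v ∉ F.line) : 0 ≤ pDivisor p X F C := by
  have hv0 : v ≠ 0 := by
    rintro rfl
    apply hF
    obtain ⟨a, e⟩ := pPow_smul p (0 : Derivation k K K) 0
    simp [zero_pow (Fact.out : p.Prime).ne_zero] at e
    rw [e]; exact zero_mem _
  obtain ⟨c, hc0, hp⟩ := hC.exists_isPrimitiveAt hc hv0
  have hcv := F.line.smul_mem c hv
  have hF' := pPow_notMem_of_ne_zero hv hF hcv hp.ne_zero
  rw [pDivisor_eq hC h hc hcv hp hF', ← hC.mem_iff (hc.pContract_ne_zero hcv hp.ne_zero hF')]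
  exact h.pContract_mem hp

end Stalks

/-! ## The projective plane in homogeneous coordinates -/

section Plane

variable {k K : Type*} [Field k] [Field K] [Algebra k K] {R : LocalSubring K}

variable (k) in
/-- The projective plane with homogeneous coordinates `X`. -/
def plane (X : Fin 3 → K) : Set (LocalSubring K) :=
  modelOfCharts (Set.range fun i : Fin 3 => Algebra.adjoin k (Set.range fun j => X j / X i))

theorem plane_eq_of_perm {X X' : Fin 3 → K} (σ : Equiv.Perm (Fin 3)) {c : K} (hc : c ≠ 0)
    (h : ∀ j, X' j = c * X (σ j)) : plane k X' = plane k X := by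
  have e : (fun i => Algebra.adjoin k (Set.range fun j => X' j / X' i)) =
      (fun i => Algebra.adjoin k (Set.range fun j => X j / X i)) ∘ σ := by
    funext i
    have : (fun j => X' j / X' i) = (fun j => X j / X (σ i)) ∘ σ := by
      funext j
      rw [h, h, Function.comp_apply, mul_div_mul_left _ _ hc]
    rw [this, σ.surjective.range_comp]
    rfl
  rw [plane, plane, e, σ.surjective.range_comp]

theorem mem_plane {X : Fin 3 → K} :
    R ∈ plane k X ↔ ∃ i, IsLocOf (Algebra.adjoin k (Set.range fun j => X j / X i)).toSubring R := by
  rw [plane, mem_modelOfCharts]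
  simp

/-- The vector `z` is regular without zeros at the point with local ring `R`. -/
def IsUnimodularAt (R : LocalSubring K) (z : Fin 3 → K) : Prop :=
  (∀ j, z j ∈ R.toSubring) ∧ ∃ j, IsUnitAt R (z j)

/-- If all new entries vanished at the point, the inverse constant matrix would make all old ones
vanish. -/
theorem IsUnimodularAt.linear {z z' : Fin 3 → K} (h : IsUnimodularAt R z)
    (hk : ∀ c : k, algebraMap k K c ∈ R.toSubring) {M N : Fin 3 → Fin 3 → k}
    (hM : ∀ j, z' j = ∑ l, algebraMap k K (M j l) * z l)
    (hN : ∀ j, z j = ∑ l, algebraMap k K (N j l) * z' l) : IsUnimodularAt R z' := by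
  obtain ⟨h1, j, h2⟩ := h
  have h3 : ∀ j, z' j ∈ R.toSubring := fun j => by
    rw [hM]; exact sum_mem fun l _ => mul_mem (hk _) (h1 l)
  refine ⟨h3, ?_⟩
  by_contra! hn
  refine VanishesAt.not_isUnitAt ?_ h2
  rw [hN]
  exact VanishesAt.sum fun l _ => VanishesAt.mul_left (hk _) (vanishesAt_iff.2 ⟨h3 l, hn l⟩)

theorem isUnimodularAt_div {X : Fin 3 → K} {i : Fin 3} (hi : X i ≠ 0)
    (h : IsLocOf (Algebra.adjoin k (Set.range fun j => X j / X i)).toSubring R) :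
    IsUnimodularAt R fun j => X j / X i :=
  ⟨fun j => h.1 (Algebra.subset_adjoin ⟨j, rfl⟩), i, by simpa [hi] using IsUnitAt.one⟩

theorem algebraMap_mem_of_isLocOf {S : Set K} (h : IsLocOf (Algebra.adjoin k S).toSubring R)
    (c : k) : algebraMap k K c ∈ R.toSubring :=
  h.1 ((Algebra.adjoin k S).algebraMap_mem c)

/-- In the coordinates normalized by `X i` the new vector is still unimodular; an entry that is a
unit selects the new chart. -/
theorem plane_subset_of_linear {X X' : Fin 3 → K} (hX : ∀ i, X i ≠ 0) (hX' : ∀ i, X' i ≠ 0)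
    {M N : Fin 3 → Fin 3 → k} (hM : ∀ j, X' j = ∑ l, algebraMap k K (M j l) * X l)
    (hN : ∀ j, X j = ∑ l, algebraMap k K (N j l) * X' l) : plane k X ⊆ plane k X' := by
  intro R hR
  obtain ⟨i, hi⟩ := mem_plane.1 hR
  have hk := algebraMap_mem_of_isLocOf hi
  have hU' : IsUnimodularAt R fun j => X' j / X i :=
    (isUnimodularAt_div (hX i) hi).linear hk (M := M) (N := N)
      (fun j => by rw [hM, Finset.sum_div]; simp only [mul_div_assoc])
      (fun j => by rw [hN, Finset.sum_div]; simp only [mul_div_assoc])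
  obtain ⟨h1, i', h2⟩ := hU'
  refine mem_plane.2 ⟨i', hi.change_adjoin ?_ ?_⟩
  · rintro - ⟨j, rfl⟩
    have e : X' j / X' i' = X' j / X i * (X' i' / X i)⁻¹ := by
      have := hX i
      have := hX' i'
      field_simp
    change X' j / X' i' ∈ R.toSubring
    rw [e]
    exact mul_mem (h1 j) h2.inv_mem
  · rintro - ⟨j, rfl⟩
    have hmem : ∀ j, X j / X' i' ∈ Algebra.adjoin k (Set.range fun j => X' j / X' i') := fun j => by
      rw [hN, Finset.sum_div]
      refine sum_mem fun l _ => ?_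
      rw [mul_div_assoc]
      exact mul_mem (Subalgebra.algebraMap_mem _ _) (Algebra.subset_adjoin ⟨l, rfl⟩)
    refine ⟨_, hmem j, _, hmem i, ?_, (div_div_div_cancel_right₀ (hX' i') _ _).symm⟩
    simpa using h2.inv

theorem plane_eq_of_linear {X X' : Fin 3 → K} (hX : ∀ i, X i ≠ 0) (hX' : ∀ i, X' i ≠ 0)
    {M N : Fin 3 → Fin 3 → k} (hM : ∀ j, X' j = ∑ l, algebraMap k K (M j l) * X l)
    (hN : ∀ j, X j = ∑ l, algebraMap k K (N j l) * X' l) : plane k X' = plane k X :=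
  (plane_subset_of_linear hX' hX hN hM).antisymm (plane_subset_of_linear hX hX' hM hN)

/-! ### The `1`-form that defines a foliation of the plane -/

/-- The `1`-form `∑ a_j dX_j` on the plane with homogeneous coordinates `X`, homogeneous of degree
`d + 2` and without zeros in codimension one, defines the foliation `F`. -/
structure IsDefiningForm (F : Foliation k K) (d : ℕ) (X a : Fin 3 → K) : Prop where
  euler : ∑ j, a j * X j = 0
  line : ∀ v, v ∈ F.line ↔ ∑ j, a j * v (X j) = 0
  unimodular : ∀ R ∈ plane k X, IsDiscreteValuationRing R.toSubring → ∀ l : K, l ≠ 0 →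
    IsUnimodularAt R (fun j => X j / l) → IsUnimodularAt R fun j => a j / l ^ (d + 1)

namespace IsDefiningForm

variable {F : Foliation k K} {d : ℕ} {X X' a a' : Fin 3 → K}

theorem perm (h : IsDefiningForm F d X a) (σ : Equiv.Perm (Fin 3)) {c : K} (hc : c ≠ 0)
    (hX : ∀ j, X' j = c * X (σ j)) (ha : ∀ j, a' j = c ^ (d + 1) * a (σ j)) :
    IsDefiningForm F d X' a' := by
  have hs : ∀ f : Fin 3 → K, ∑ j, f (σ j) = ∑ j, f j := fun f => Equiv.sum_comp σ f
  have euler : ∑ j, a (σ j) * X (σ j) = 0 := (hs fun j => a j * X j).trans h.euler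
  refine ⟨?_, fun v => ?_, fun R hR hD l hl hU => ?_⟩
  · have e : ∀ j, a' j * X' j = c ^ (d + 2) * (a (σ j) * X (σ j)) := fun j => by
      rw [ha, hX]; ring
    rw [Finset.sum_congr rfl fun j _ => e j, ← Finset.mul_sum, euler, mul_zero]
  · have e : ∀ j, a' j * v (X' j) = c ^ (d + 2) * (a (σ j) * v (X (σ j))) +
        c ^ (d + 1) * v c * (a (σ j) * X (σ j)) := fun j => by
      rw [ha, hX, Derivation.leibniz, smul_eq_mul, smul_eq_mul]; ring
    rw [Finset.sum_congr rfl fun j _ => e j, Finset.sum_add_distrib, ← Finset.mul_sum,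
      ← Finset.mul_sum, euler, mul_zero, add_zero, hs fun j => a j * v (X j), h.line]
    simp [hc]
  · rw [plane_eq_of_perm σ hc hX] at hR
    have eX : ∀ j, X' j / l = X (σ j) / (l / c) := fun j => by
      rw [hX, mul_comm, div_div_eq_mul_div]
    have hU' : IsUnimodularAt R fun j => X j / (l / c) := by
      refine ⟨fun j => ?_, ?_⟩
      · have : X' (σ.symm j) / l ∈ R.toSubring := hU.1 (σ.symm j)
        rwa [eX, Equiv.apply_symm_apply] at this
      · obtain ⟨j, hj⟩ := hU.2
        change IsUnitAt R (X' j / l) at hj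
        rw [eX] at hj
        exact ⟨σ j, hj⟩
    obtain ⟨h1, j, h2⟩ := h.unimodular R hR hD _ (div_ne_zero hl hc) hU'
    have e : ∀ j, a' j / l ^ (d + 1) = a (σ j) / (l / c) ^ (d + 1) := fun j => by
      rw [ha, div_pow, div_div_eq_mul_div, mul_comm]
    refine ⟨fun j => ?_, σ.symm j, ?_⟩
    · change a' j / _ ∈ _
      rw [e]; exact h1 _
    · change IsUnitAt R (a' _ / _)
      rw [e, Equiv.apply_symm_apply]; exact h2

/-- The coefficients of the form transform contragrediently to the coordinates, hence the transposed
matrices. -/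
theorem linear (h : IsDefiningForm F d X a) (hX : ∀ i, X i ≠ 0) (hX' : ∀ i, X' i ≠ 0)
    {M N : Fin 3 → Fin 3 → k} (hM : ∀ j, X' j = ∑ l, algebraMap k K (M j l) * X l)
    (hN : ∀ j, X j = ∑ l, algebraMap k K (N j l) * X' l)
    (haN : ∀ j, a' j = ∑ l, algebraMap k K (N l j) * a l)
    (haM : ∀ j, a j = ∑ l, algebraMap k K (M l j) * a' l) :
    IsDefiningForm F d X' a' := by
  refine ⟨?_, fun v => ?_, fun R hR hD l hl hU => ?_⟩
  · rw [← h.euler]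
    simp only [haN, hN, Finset.sum_mul, Finset.mul_sum]
    rw [Finset.sum_comm]
    exact Finset.sum_congr rfl fun _ _ => Finset.sum_congr rfl fun _ _ => by ring
  · rw [h.line]
    have hv : ∀ j, v (X j) = ∑ l, algebraMap k K (N j l) * v (X' l) := fun j => by
      rw [hN, map_sum]
      exact Finset.sum_congr rfl fun l _ => by simp
    have e : ∑ j, a j * v (X j) = ∑ j, a' j * v (X' j) := by
      simp only [haN, hv, Finset.sum_mul, Finset.mul_sum]
      rw [Finset.sum_comm]
      exact Finset.sum_congr rfl fun _ _ => Finset.sum_congr rfl fun _ _ => by ring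
    rw [e]
  · have hp := plane_eq_of_linear (k := k) hX hX' hM hN
    obtain ⟨i, hi⟩ := mem_plane.1 hR
    have hk := algebraMap_mem_of_isLocOf hi
    rw [hp] at hR
    refine (h.unimodular R hR hD l hl (hU.linear hk (M := N) (N := M)
      (fun j => ?_) (fun j => ?_))).linear hk (M := fun i j => N j i) (N := fun i j => M j i)
      (fun j => ?_) (fun j => ?_)
    · rw [hN, Finset.sum_div]; simp only [mul_div_assoc]
    · rw [hM, Finset.sum_div]; simp only [mul_div_assoc]
    · rw [haN, Finset.sum_div]; simp only [mul_div_assoc]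
    · rw [haM, Finset.sum_div]; simp only [mul_div_assoc]

end IsDefiningForm

/-! ### Affine charts of the plane -/

theorem adjoin_chart_eq {X : Fin 3 → K} {i : Fin 3} (hi : X i ≠ 0) :
    Algebra.adjoin k (Set.range fun j => X j / X i) =
      Algebra.adjoin k {X (i.succAbove 0) / X i, X (i.succAbove 1) / X i} := by
  apply le_antisymm
  · refine Algebra.adjoin_le ?_
    rintro - ⟨j, rfl⟩
    rcases Fin.eq_self_or_eq_succAbove i j with rfl | ⟨l, rfl⟩
    · simp [hi]
    · fin_cases l
      exacts [left_mem_adjoin_pair _ _, right_mem_adjoin_pair _ _]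
  · refine Algebra.adjoin_mono ?_
    rintro - (rfl | rfl)
    exacts [⟨_, rfl⟩, ⟨_, rfl⟩]

theorem aeval_smul_of_isHomogeneous {A : MvPolynomial (Fin 3) k} {n : ℕ} (hA : A.IsHomogeneous n)
    {B : Type*} [CommRing B] [Algebra k B] (c : B) (z : Fin 3 → B) :
    MvPolynomial.aeval (fun j => c * z j) A = c ^ n * MvPolynomial.aeval z A := by
  rw [MvPolynomial.aeval_def, MvPolynomial.aeval_def, MvPolynomial.eval₂_eq',
    MvPolynomial.eval₂_eq', Finset.mul_sum]
  refine Finset.sum_congr rfl fun m hm => ?_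
  have hn : ∑ i, m i = n := by
    have := hA (MvPolynomial.mem_support_iff.1 hm)
    rw [← this, Finsupp.weight_apply, Finsupp.sum_fintype _ _ (by simp)]
    simp
  simp only [mul_pow, Finset.prod_mul_distrib]
  rw [Finset.prod_pow_eq_pow_sum, hn]
  ring

/-- A prime ideal of `k[u, w]` with finitely many zeros is the ideal of a point. -/
theorem exists_eq_of_finite_zeroLocus [IsAlgClosed k] {P : Ideal (MvPolynomial (Fin 2) k)}
    (hP : P.IsPrime) (hfin : (MvPolynomial.zeroLocus k P).Finite) :
    ∃ z : Fin 2 → k, P = MvPolynomial.vanishingIdeal k {z} := by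
  have h1 : MvPolynomial.vanishingIdeal k (MvPolynomial.zeroLocus k P) = P :=
    MvPolynomial.IsPrime.vanishingIdeal_zeroLocus P
  -- A prime that is a finite intersection of point ideals contains one of them; the reverse
  -- inclusion holds because the point is a zero of `P`.
  have h2 : MvPolynomial.vanishingIdeal k (MvPolynomial.zeroLocus k P) =
      hfin.toFinset.inf fun z : Fin 2 → k => MvPolynomial.vanishingIdeal k {z} := by
    ext f
    rw [MvPolynomial.mem_vanishingIdeal_iff]
    simp [Submodule.mem_finsetInf]
  rw [h1] at h2
  obtain ⟨z, hz, hle⟩ := (Ideal.IsPrime.inf_le' hP).1 h2.ge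
  refine ⟨z, le_antisymm ?_ hle⟩
  intro f hf
  rw [MvPolynomial.mem_vanishingIdeal_singleton_iff]
  exact (hfin.mem_toFinset.1 hz) f hf

/-- Along a prime divisor on which `w` is the constant `c`, the other coordinate is not constant, so
`u - b` would be a unit. -/
theorem not_isDiscreteValuationRing_of_point {u w : K} (h : IsLocPair k u w R)
    (hc : IsCoordinates k u w) {b c : k} (hu : VanishesAt R (u - algebraMap k K b))
    (hw : VanishesAt R (w - algebraMap k K c)) : ¬ IsDiscreteValuationRing R.toSubring := by
  intro hR
  refine hu.not_isUnitAt (h.isUnitAt_left_of_graph hc hR (q := Polynomial.C c) ?_ b)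
  simpa using hw

end Plane

/-! ### Defining forms of foliations of degree `d`, and moving a closed point to the origin. -/

section Normalization

variable {k K : Type*} [Field k] [Field K] [Algebra k K] {R : LocalSubring K}

variable (k) in
/-- Homogeneous coordinates for which the charts of the plane have coordinates of `K`. -/
structure IsFrame (X : Fin 3 → K) : Prop where
  ne_zero : ∀ i, X i ≠ 0
  isCoordinates : ∀ i : Fin 3, IsCoordinates k (X (i.succAbove 0) / X i) (X (i.succAbove 1) / X i)

theorem left_mem_fieldAdjoin (u w : K) : u ∈ IntermediateField.adjoin k {u, w} :=
  IntermediateField.subset_adjoin _ _ (by simp)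

theorem right_mem_fieldAdjoin (u w : K) : w ∈ IntermediateField.adjoin k {u, w} :=
  IntermediateField.subset_adjoin _ _ (by simp)

theorem IsCoordinates.isFrame {x y : K} (h : IsCoordinates k x y) : IsFrame k ![1, x, y] := by
  have hx := h.left_ne_zero
  have hy := h.right_ne_zero
  refine ⟨fun i => ?_, fun i => ?_⟩
  · fin_cases i
    exacts [one_ne_zero, hx, hy]
  · fin_cases i
    · change IsCoordinates k (x / 1) (y / 1)
      simpa using h
    · change IsCoordinates k (1 / x) (y / x)
      have h1 := left_mem_fieldAdjoin (k := k) (1 / x) (y / x)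
      have h2 := right_mem_fieldAdjoin (k := k) (1 / x) (y / x)
      refine h.change (by simpa using inv_mem h1) ?_
      convert div_mem h2 h1 using 1
      field_simp
    · change IsCoordinates k (1 / y) (x / y)
      have h1 := left_mem_fieldAdjoin (k := k) (1 / y) (x / y)
      have h2 := right_mem_fieldAdjoin (k := k) (1 / y) (x / y)
      refine h.change ?_ (by simpa using inv_mem h1)
      convert div_mem h2 h1 using 1
      field_simp

theorem IsFrame.isLocPair {X : Fin 3 → K} (hX : IsFrame k X) {i : Fin 3} :
    IsLocOf (Algebra.adjoin k (Set.range fun j => X j / X i)).toSubring R ↔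
      IsLocPair k (X (i.succAbove 0) / X i) (X (i.succAbove 1) / X i) R := by
  rw [adjoin_chart_eq (hX.ne_zero i)]
  rfl

theorem insertNth_one_eq {X : Fin 3 → K} {i : Fin 3} (hi : X i ≠ 0) :
    i.insertNth 1 ![X (i.succAbove 0) / X i, X (i.succAbove 1) / X i] = fun j => X j / X i := by
  funext j
  rcases Fin.eq_self_or_eq_succAbove i j with rfl | ⟨l, rfl⟩
  · simp [hi]
  · rw [Fin.insertNth_apply_succAbove]
    fin_cases l <;> rfl

/-- The substitution `X_i = 1` in a homogeneous polynomial. -/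
theorem aeval_insertNth {B : Type*} [CommRing B] [Algebra k B] (i : Fin 3) (z : Fin 2 → B)
    (A : MvPolynomial (Fin 3) k) :
    MvPolynomial.aeval z (MvPolynomial.aeval (i.insertNth 1 MvPolynomial.X :
      Fin 3 → MvPolynomial (Fin 2) k) A) = MvPolynomial.aeval (i.insertNth 1 z : Fin 3 → B) A := by
  rw [← AlgHom.comp_apply, MvPolynomial.comp_aeval]
  congr 2
  funext j
  rcases Fin.eq_self_or_eq_succAbove i j with rfl | ⟨l, rfl⟩ <;> simp

/-- A curve of common zeros of the `A_j` would contain infinitely many points. Algebraically, the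
centre of such a prime divisor has a finite zero locus, so it is a point, and a point is not a prime
divisor. -/
theorem isDefiningForm_of_hasDegree [IsAlgClosed k] {x y : K} (hxy : IsCoordinates k x y) {d : ℕ}
    {F : Foliation k K} (h : HasDegree x y F d) :
    ∃ a, IsDefiningForm F d ![1, x, y] a := by
  obtain ⟨A, hA, hE, hfin, hF⟩ := h
  set X : Fin 3 → K := ![1, x, y] with hXdef
  have hX : IsFrame k X := hxy.isFrame
  refine ⟨fun j => MvPolynomial.aeval X (A j), ?_, fun v => ?_, ?_⟩
  · have := congrArg (MvPolynomial.aeval X) hE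
    rw [map_sum, map_zero] at this
    rw [← this]
    exact Finset.sum_congr rfl fun j _ => by rw [map_mul, MvPolynomial.aeval_X, mul_comm]
  · rw [hF, Fin.sum_univ_three, Fin.sum_univ_three, contract_add, contract_add]
    simp only [contract_smul, contract_D]
  · intro R hR hD l hl hU
    obtain ⟨i, hi⟩ := mem_plane.1 hR
    have hk := algebraMap_mem_of_isLocOf hi
    have hloc := hX.isLocPair.1 hi
    have hc := hX.isCoordinates i
    have hXi := hX.ne_zero i
    have hscale : ∀ (m : K) (j), m ≠ 0 → MvPolynomial.aeval X (A j) / m ^ (d + 1) =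
        MvPolynomial.aeval (fun j => X j / m) (A j) := by
      intro m j hm
      have := aeval_smul_of_isHomogeneous (hA j) m⁻¹ X
      simp only [div_eq_inv_mul]
      rw [this, inv_pow]
    have hmem : ∀ j, MvPolynomial.aeval X (A j) / l ^ (d + 1) ∈ R.toSubring := by
      intro j
      rw [hscale l j hl, MvPolynomial.aeval_def, MvPolynomial.eval₂_eq']
      exact sum_mem fun m _ => mul_mem (hk _) (prod_mem fun n _ => pow_mem (hU.1 n) _)
    refine ⟨hmem, ?_⟩
    by_contra! hn
    -- `l` and `X i` are two normalizations of the same homogeneous coordinates; regularity of their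
    -- quotient carries the vanishing over to the chart.
    have hli : l / X i ∈ R.toSubring := by
      obtain ⟨j, hj⟩ := hU.2
      have e : l / X i = X j / X i * (X j / l)⁻¹ := by
        have := hX.ne_zero j
        field_simp
      rw [e]
      exact mul_mem (hi.1 (Algebra.subset_adjoin ⟨j, rfl⟩)) hj.inv_mem
    have hv : ∀ j, VanishesAt R (MvPolynomial.aeval (fun j => X j / X i) (A j)) := by
      intro j
      rw [← hscale _ _ hXi]
      have e : MvPolynomial.aeval X (A j) / X i ^ (d + 1) =
          (l / X i) ^ (d + 1) * (MvPolynomial.aeval X (A j) / l ^ (d + 1)) := by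
        rw [div_pow]; field_simp
      rw [e]
      exact VanishesAt.mul_left (pow_mem hli _) (vanishesAt_iff.2 ⟨hmem j, hn j⟩)
    obtain ⟨P, hP, hPv⟩ := hloc.exists_ideal
    have hAP : ∀ j, MvPolynomial.aeval (i.insertNth 1 MvPolynomial.X :
        Fin 3 → MvPolynomial (Fin 2) k) (A j) ∈ P := by
      intro j
      rw [hPv, aeval_insertNth, insertNth_one_eq hXi]
      exact hv j
    have hins : ∀ z : Fin 2 → k, (i.insertNth 1 z : Fin 3 → k) ≠ 0 := fun z e => by
      simpa using congrFun e i
    -- The affine zeros embed into the projective zero set of the `A_j` by setting the `i`-th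
    -- coordinate to `1`.
    have hzero : (MvPolynomial.zeroLocus k P).Finite := by
      refine Set.Finite.of_finite_image (f := fun z => Projectivization.mk k _ (hins z))
        (hfin.subset ?_) ?_
      · rintro - ⟨z, hz, rfl⟩ j
        obtain ⟨c, hc⟩ := Projectivization.exists_smul_eq_mk_rep k _ (hins z)
        rw [← hc]
        have h0 := hz _ (hAP j)
        rw [aeval_insertNth] at h0
        have h1 := aeval_smul_of_isHomogeneous (hA j) (c : k) (i.insertNth 1 z : Fin 3 → k)
        rw [h0, mul_zero, MvPolynomial.aeval_eq_eval] at h1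
        exact h1
      · intro z _ z' _ e
        obtain ⟨c, hc⟩ := (Projectivization.mk_eq_mk_iff' k _ _ (hins z) (hins z')).1 e
        have h1 : c = 1 := by simpa using congrFun hc i
        rw [h1, one_smul] at hc
        exact (Fin.insertNth_right_injective (α := fun _ => k) (p := i) 1 hc).symm
    obtain ⟨z, rfl⟩ := exists_eq_of_finite_zeroLocus hP hzero
    refine not_isDiscreteValuationRing_of_point hloc hc (b := z 0) (c := z 1) ?_ ?_ hD
    · have := (hPv (MvPolynomial.X 0 - MvPolynomial.C (z 0))).1 (by
        rw [MvPolynomial.mem_vanishingIdeal_singleton_iff]; simp)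
      simpa using this
    · have := (hPv (MvPolynomial.X 1 - MvPolynomial.C (z 1))).1 (by
        rw [MvPolynomial.mem_vanishingIdeal_singleton_iff]; simp)
      simpa using this

/-- A maximal ideal above the centre of `Q` gives a specialization of `Q`, which closedness
identifies with `Q`; the Nullstellensatz then supplies its coordinates. -/
theorem IsClosedPoint.exists_point [IsAlgClosed k] {X : Fin 3 → K} (hX : IsFrame k X)
    {Q : LocalSubring K} (hQ : IsClosedPoint (plane k X) Q) :
    ∃ (i : Fin 3) (b c : k), IsLocPair k (X (i.succAbove 0) / X i) (X (i.succAbove 1) / X i) Q ∧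
      VanishesAt Q (X (i.succAbove 0) / X i - algebraMap k K b) ∧
      VanishesAt Q (X (i.succAbove 1) / X i - algebraMap k K c) := by
  obtain ⟨i, hi⟩ := mem_plane.1 hQ.1
  have hloc := hX.isLocPair.1 hi
  obtain ⟨P, hP, hPv⟩ := hloc.exists_ideal
  obtain ⟨M, hM, hPM⟩ := Ideal.exists_le_maximal P hP.ne_top
  obtain ⟨R, hR, hRv⟩ := exists_isLocPair_of_isPrime (hX.isCoordinates i) hM.isPrime
  have hRQ : R.toSubring ≤ Q.toSubring := by
    refine IsLocOf.le_of_isUnitAt hR hloc.1 fun s hs hsu => ?_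
    obtain ⟨f, rfl⟩ := mem_adjoin_pair.1 hs
    rcases isUnitAt_or_vanishesAt (hloc.poly_mem f) with h | h
    · exact h
    · exact absurd hsu ((hRv f).2 (hPM ((hPv f).2 h))).not_isUnitAt
  obtain rfl := hQ.2 R (mem_plane.2 ⟨i, hX.isLocPair.2 hR⟩) hRQ
  obtain ⟨z, rfl⟩ := MvPolynomial.isMaximal_iff_eq_vanishingIdeal_singleton.1 hM
  refine ⟨i, z 0, z 1, hloc, ?_, ?_⟩
  · have := (hRv (MvPolynomial.X 0 - MvPolynomial.C (z 0))).2 (by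
      rw [MvPolynomial.mem_vanishingIdeal_singleton_iff]; simp)
    simpa using this
  · have := (hRv (MvPolynomial.X 1 - MvPolynomial.C (z 1))).2 (by
      rw [MvPolynomial.mem_vanishingIdeal_singleton_iff]; simp)
    simpa using this

/-- The permutation `0 ↦ i` of the homogeneous coordinates. -/
theorem exists_perm_succAbove (i : Fin 3) : ∃ σ : Equiv.Perm (Fin 3),
    σ 0 = i ∧ σ 1 = i.succAbove 0 ∧ σ 2 = i.succAbove 1 := by
  revert i; decide

theorem IsCoordinates.sub_const {u w : K} (h : IsCoordinates k u w) (b c : k) :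
    IsCoordinates k (u - algebraMap k K b) (w - algebraMap k K c) := by
  refine h.change ?_ ?_
  · have := add_mem (left_mem_fieldAdjoin (k := k) (u - algebraMap k K b) (w - algebraMap k K c))
      (IntermediateField.algebraMap_mem _ b)
    simpa using this
  · have := add_mem (right_mem_fieldAdjoin (k := k) (u - algebraMap k K b) (w - algebraMap k K c))
      (IntermediateField.algebraMap_mem _ c)
    simpa using this

theorem IsLocPair.sub_const {u w : K} (h : IsLocPair k u w R) (b c : k) :
    IsLocPair k (u - algebraMap k K b) (w - algebraMap k K c) R := by
  refine h.change (sub_mem h.left_mem (h.algebraMap_mem b))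
    (sub_mem h.right_mem (h.algebraMap_mem c)) ⟨u, ?_, 1, one_mem _, .one, by simp⟩
    ⟨w, ?_, 1, one_mem _, .one, by simp⟩
  · have := add_mem (left_mem_adjoin_pair (k := k) (u - algebraMap k K b) (w - algebraMap k K c))
      (Subalgebra.algebraMap_mem _ b)
    simpa using this
  · have := add_mem (right_mem_adjoin_pair (k := k) (u - algebraMap k K b) (w - algebraMap k K c))
      (Subalgebra.algebraMap_mem _ c)
    simpa using this

/-- Affine coordinates of the plane in which a given closed point is the origin. -/
theorem exists_coordinates_origin [IsAlgClosed k] {x y : K} (hxy : IsCoordinates k x y) {d : ℕ}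
    {F : Foliation k K} (hd : HasDegree x y F d) {Q : LocalSubring K}
    (hQ : IsClosedPoint (projectivePlane k x y) Q) :
    ∃ x' y' : K, IsCoordinates k x' y' ∧ plane k ![1, x', y'] = projectivePlane k x y ∧
      (∃ a, IsDefiningForm F d ![1, x', y'] a) ∧ IsLocPair k x' y' Q ∧ VanishesAt Q x' ∧
      VanishesAt Q y' := by
  obtain ⟨a, ha⟩ := isDefiningForm_of_hasDegree hxy hd
  have hX := hxy.isFrame
  change IsClosedPoint (plane k ![1, x, y]) Q at hQ
  change ∃ x' y' : K, IsCoordinates k x' y' ∧ plane k ![1, x', y'] = plane k ![1, x, y] ∧ _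
  generalize (![1, x, y] : Fin 3 → K) = X at *
  obtain ⟨i, b, c, hloc, hb, hc⟩ := hQ.exists_point hX
  obtain ⟨σ, h0, h1, h2⟩ := exists_perm_succAbove i
  have hcoord := hX.isCoordinates i
  have hXi := hX.ne_zero i
  set u := X (i.succAbove 0) / X i with hu
  set w := X (i.succAbove 1) / X i with hw
  have hσ : ∀ j, (![1, u, w] : Fin 3 → K) j = (X i)⁻¹ * X (σ j) := by
    intro j
    fin_cases j
    · change 1 = (X i)⁻¹ * X (σ 0)
      rw [h0, inv_mul_cancel₀ hXi]
    · change u = (X i)⁻¹ * X (σ 1)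
      rw [h1, hu, div_eq_inv_mul]
    · change w = (X i)⁻¹ * X (σ 2)
      rw [h2, hw, div_eq_inv_mul]
  have hform := ha.perm σ (inv_ne_zero hXi) hσ fun j => rfl
  have hplane := plane_eq_of_perm (k := k) σ (inv_ne_zero hXi) hσ
  generalize (fun j => (X i)⁻¹ ^ (d + 1) * a (σ j)) = a' at hform
  have hcoord' := hcoord.sub_const b c
  -- The contragredient of the translation by `(b, c)`: only the coefficient of `dX₀` changes.
  refine ⟨_, _, hcoord', ?_, ⟨![a' 0 + algebraMap k K b * a' 1 + algebraMap k K c * a' 2, a' 1,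
    a' 2], ?_⟩, hloc.sub_const b c, hb, hc⟩
  · rw [← hplane]
    refine plane_eq_of_linear hcoord.isFrame.ne_zero hcoord'.isFrame.ne_zero
      (M := ![![1, 0, 0], ![-b, 1, 0], ![-c, 0, 1]]) (N := ![![1, 0, 0], ![b, 1, 0], ![c, 0, 1]])
      (fun j => ?_) (fun j => ?_) <;>
    fin_cases j <;> simp [Fin.sum_univ_three] <;> ring
  · refine hform.linear hcoord.isFrame.ne_zero hcoord'.isFrame.ne_zero
      (M := ![![1, 0, 0], ![-b, 1, 0], ![-c, 0, 1]]) (N := ![![1, 0, 0], ![b, 1, 0], ![c, 0, 1]])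
      (fun j => ?_) (fun j => ?_) (fun j => ?_) (fun j => ?_) <;>
    fin_cases j <;> simp [Fin.sum_univ_three] <;> ring

end Normalization

/-! ## The blowup of the plane at the origin -/

section Blowup

variable {k K : Type*} [Field k] [Field K] [Algebra k K] {R Q : LocalSubring K} {x y : K}

/-- The fractions of elements of `C` whose denominators are units at the point with local
ring `R`. -/
def fractionSubring (C : Subring K) (R : LocalSubring K) : Subring K where
  carrier := {a | ∃ b ∈ C, ∃ c ∈ C, IsUnitAt R c ∧ a = b / c}
  mul_mem' := by
    rintro - - ⟨b, hb, c, hc, hcu, rfl⟩ ⟨b', hb', c', hc', hcu', rfl⟩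
    exact ⟨b * b', mul_mem hb hb', c * c', mul_mem hc hc', hcu.mul hcu', div_mul_div_comm _ _ _ _⟩
  one_mem' := ⟨1, one_mem _, 1, one_mem _, .one, by simp⟩
  add_mem' := by
    rintro - - ⟨b, hb, c, hc, hcu, rfl⟩ ⟨b', hb', c', hc', hcu', rfl⟩
    exact ⟨b * c' + c * b', add_mem (mul_mem hb hc') (mul_mem hc hb'), c * c', mul_mem hc hc',
      hcu.mul hcu', div_add_div _ _ hcu.1 hcu'.1⟩
  zero_mem' := ⟨0, zero_mem _, 1, one_mem _, .one, by simp⟩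
  neg_mem' := by
    rintro - ⟨b, hb, c, hc, hcu, rfl⟩
    exact ⟨-b, neg_mem hb, c, hc, hcu, (neg_div _ _).symm⟩

theorem le_fractionSubring (C : Subring K) : C ≤ fractionSubring C R :=
  fun b hb => ⟨b, hb, 1, one_mem _, .one, by simp⟩

theorem inv_mem_fractionSubring {C : Subring K} {a : K} (ha : a ∈ fractionSubring C R)
    (hu : IsUnitAt R a) : a⁻¹ ∈ fractionSubring C R := by
  obtain ⟨b, hb, c, hc, hcu, rfl⟩ := ha
  refine ⟨c, hc, b, hb, ?_, inv_div _ _⟩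
  have := hu.mul hcu
  rwa [div_mul_cancel₀ _ hcu.1] at this

theorem exists_eq_const_add {a : K} (ha : a ∈ Algebra.adjoin k {x, y}) :
    ∃ c : k, ∃ b ∈ Algebra.adjoin k {x, y}, ∃ b' ∈ Algebra.adjoin k {x, y},
      a = algebraMap k K c + (b * x + b' * y) := by
  have hx := left_mem_adjoin_pair (k := k) x y
  have hy := right_mem_adjoin_pair (k := k) x y
  induction ha using Algebra.adjoin_induction with
  | mem a ha =>
    rcases ha with rfl | rfl
    · exact ⟨0, 1, one_mem _, 0, zero_mem _, by simp⟩
    · exact ⟨0, 0, zero_mem _, 1, one_mem _, by simp⟩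
  | algebraMap c => exact ⟨c, 0, zero_mem _, 0, zero_mem _, by simp⟩
  | add a a' _ _ h h' =>
    obtain ⟨c, b, hb, d, hd, rfl⟩ := h
    obtain ⟨c', b', hb', d', hd', rfl⟩ := h'
    refine ⟨c + c', b + b', add_mem hb hb', d + d', add_mem hd hd', ?_⟩
    rw [map_add]; ring
  | mul a a' ha _ h h' =>
    obtain ⟨c, b, hb, d, hd, e⟩ := h
    obtain ⟨c', b', hb', d', hd', e'⟩ := h'
    have hc' := Subalgebra.algebraMap_mem (Algebra.adjoin k {x, y}) c'
    refine ⟨c * c', algebraMap k K c' * b + a * b', add_mem (mul_mem hc' hb) (mul_mem ha hb'),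
      algebraMap k K c' * d + a * d', add_mem (mul_mem hc' hd) (mul_mem ha hd'), ?_⟩
    rw [map_mul]
    linear_combination algebraMap k K c' * e + a * e'

/-- At a point where `x` and `y` vanish, a polynomial is a unit iff its constant term is not
zero. -/
theorem isUnitAt_const_add_iff (hk : ∀ c : k, algebraMap k K c ∈ R.toSubring)
    (hx : VanishesAt R x) (hy : VanishesAt R y) {b b' : K} (hb : b ∈ R.toSubring)
    (hb' : b' ∈ R.toSubring) (c : k) :
    IsUnitAt R (algebraMap k K c + (b * x + b' * y)) ↔ c ≠ 0 := by
  have hv : VanishesAt R (b * x + b' * y) := (hx.mul_left hb).add (hy.mul_left hb')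
  constructor
  · rintro h rfl
    rw [map_zero, zero_add] at h
    exact hv.not_isUnitAt h
  · intro h
    exact (IsUnitAt.const hk h).add_vanishesAt hv

theorem adjoin_pair_le (hk : ∀ c : k, algebraMap k K c ∈ R.toSubring)
    (hx : x ∈ R.toSubring) (hy : y ∈ R.toSubring) {a : K} (ha : a ∈ Algebra.adjoin k {x, y}) :
    a ∈ R.toSubring := by
  induction ha using Algebra.adjoin_induction with
  | mem a ha =>
    rcases ha with rfl | rfl
    exacts [hx, hy]
  | algebraMap c => exact hk c
  | add a a' _ _ h h' => exact add_mem h h'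
  | mul a a' _ _ h h' => exact mul_mem h h'

/-- The maximal ideal at the origin is generated by `x` and `y`, as a numerator without constant
term lies in `(x, y)`. -/
theorem exists_eq_add_of_vanishesAt (hQ : IsLocPair k x y Q) (hx : VanishesAt Q x)
    (hy : VanishesAt Q y) {f : K} (hf : VanishesAt Q f) :
    ∃ a ∈ Q.toSubring, ∃ b ∈ Q.toSubring, f = a * x + b * y := by
  obtain ⟨g, hg, h, hh, hu, rfl⟩ := hQ.2 f hf.mem
  have hgv : VanishesAt Q g := by
    have := hf.mul_right hu.mem
    rwa [div_mul_cancel₀ _ hu.1] at this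
  obtain ⟨c, b, hb, b', hb', rfl⟩ := exists_eq_const_add hg
  have hc : c = 0 := by
    by_contra hc
    exact hgv.not_isUnitAt
      ((isUnitAt_const_add_iff hQ.algebraMap_mem hx hy (hQ.1 hb) (hQ.1 hb') c).2 hc)
  refine ⟨b * h⁻¹, mul_mem (hQ.1 hb) hu.inv_mem, b' * h⁻¹, mul_mem (hQ.1 hb') hu.inv_mem, ?_⟩
  rw [hc, map_zero]
  ring

/-- At `Q` as at `R`, a polynomial in `x, y` is a unit exactly when its constant term is nonzero. So
the points over the origin are recognized by the vanishing of `x` and `y`. -/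
theorem le_of_vanishesAt (hQ : IsLocPair k x y Q) (hx : VanishesAt Q x) (hy : VanishesAt Q y)
    (hk : ∀ c : k, algebraMap k K c ∈ R.toSubring) (hxR : VanishesAt R x) (hyR : VanishesAt R y) :
    Q ≤ R := by
  have hle : Q.toSubring ≤ R.toSubring := by
    refine IsLocOf.le_of_isUnitAt hQ (fun a ha => adjoin_pair_le hk hxR.mem hyR.mem ha) ?_
    intro a ha hu
    obtain ⟨c, b, hb, b', hb', rfl⟩ := exists_eq_const_add ha
    rw [isUnitAt_const_add_iff hQ.algebraMap_mem hx hy (hQ.1 hb) (hQ.1 hb')] at hu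
    exact (isUnitAt_const_add_iff hk hxR hyR (adjoin_pair_le hk hxR.mem hyR.mem hb)
      (adjoin_pair_le hk hxR.mem hyR.mem hb') c).2 hu
  refine localSubring_le_iff.2 ⟨hle, fun f hf => ?_⟩
  obtain ⟨a, ha, b, hb, rfl⟩ := exists_eq_add_of_vanishesAt hQ hx hy hf
  exact (hxR.mul_left (hle ha)).add (hyR.mul_left (hle hb))

theorem IsLocPair.eq_of_vanishesAt (hQ : IsLocPair k x y Q) (hx : VanishesAt Q x)
    (hy : VanishesAt Q y) (hR : IsLocPair k x y R) (hxR : VanishesAt R x) (hyR : VanishesAt R y) :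
    R = Q :=
  le_antisymm (le_of_vanishesAt hR hxR hyR hQ.algebraMap_mem hx hy)
    (le_of_vanishesAt hQ hx hy hR.algebraMap_mem hxR hyR)

/-- The coordinate ring of the chart `Spec 𝒪_Q[𝔪 / f]` of the blowup. -/
def blowupChart (Q : LocalSubring K) (f : K) : Subring K :=
  Subring.closure ((Q.toSubring : Set K) ∪ {h : K | ∃ g : K, VanishesAt Q g ∧ h = g / f})

theorem mem_blowup {X : Set (LocalSubring K)} :
    R ∈ blowup X Q ↔ (R ∈ X ∧ R ≠ Q) ∨
      (Q ≤ R ∧ ∃ f : K, f ≠ 0 ∧ VanishesAt Q f ∧ IsLocOf (blowupChart Q f) R) := by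
  refine or_congr Iff.rfl (and_congr Iff.rfl (exists_congr fun f => and_congr Iff.rfl
    (and_congr Iff.rfl ⟨?_, ?_⟩)))
  · rintro ⟨N, hN, rfl⟩
    exact isLocOf_ofPrime _ N
  · intro h
    obtain ⟨P, hP, e, -⟩ := h.exists_prime
    exact ⟨P, hP, e⟩

/-- Where `x / f` is a unit, `x` generates the pullback of the maximal ideal of `Q`, so every `g /
f` can be rewritten through `g / x`, a combination of `1` and `y / x`. -/
theorem isLocPair_of_blowupChart (hc : IsCoordinates k x y) (hQ : IsLocPair k x y Q)
    (hx : VanishesAt Q x) (hy : VanishesAt Q y) (hle : Q ≤ R) {f : K} (hf : VanishesAt Q f)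
    (hR : IsLocOf (blowupChart Q f) R) (hu : IsUnitAt R (x / f)) : IsLocPair k (y / x) x R := by
  have hx0 := hc.left_ne_zero
  have hQR := hle.1
  have hf0 : f ≠ 0 := by rintro rfl; simpa using hu.1
  have ht : y / x ∈ R.toSubring := by
    have h1 : y / f ∈ R.toSubring := hR.1 (Subring.subset_closure (Or.inr ⟨y, hy, rfl⟩))
    have e : y / x = y / f * (x / f)⁻¹ := by field_simp
    rw [e]
    exact mul_mem h1 hu.inv_mem
  have hk : ∀ c : k, algebraMap k K c ∈ R.toSubring := fun c => hQR (hQ.algebraMap_mem c)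
  let C := (Algebra.adjoin k {y / x, x}).toSubring
  have htC : y / x ∈ C := left_mem_adjoin_pair _ _
  have hxC : x ∈ C := right_mem_adjoin_pair _ _
  have hyC : y ∈ C := by
    have := mul_mem htC hxC
    rwa [div_mul_cancel₀ _ hx0] at this
  have hxyC : ∀ a ∈ Algebra.adjoin k {x, y}, a ∈ C := by
    have : Algebra.adjoin k {x, y} ≤ Algebra.adjoin k {y / x, x} := by
      rw [Algebra.adjoin_le_iff, Set.insert_subset_iff, Set.singleton_subset_iff]
      exact ⟨hxC, hyC⟩
    exact this
  have hQF : Q.toSubring ≤ fractionSubring C R := by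
    intro r hr
    obtain ⟨a, ha, b, hb, hbu, rfl⟩ := hQ.2 r hr
    exact ⟨a, hxyC a ha, b, hxyC b hb, hbu.mono hQR, rfl⟩
  have hdiv : ∀ g, VanishesAt Q g → g / x ∈ fractionSubring C R := by
    intro g hg
    obtain ⟨a, ha, b, hb, rfl⟩ := exists_eq_add_of_vanishesAt hQ hx hy hg
    have e : (a * x + b * y) / x = a + b * (y / x) := by field_simp
    rw [e]
    exact add_mem (hQF ha) (mul_mem (hQF hb) (le_fractionSubring C htC))
  refine hR.of_fractions (fun a ha => adjoin_pair_le hk ht (hQR hx.mem) ha) ?_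
  have : blowupChart Q f ≤ fractionSubring C R := by
    refine Subring.closure_le.2 (Set.union_subset hQF ?_)
    rintro - ⟨g, hg, rfl⟩
    have e : g / f = g / x * (f / x)⁻¹ := by field_simp
    have hu' : IsUnitAt R (f / x) := by simpa using hu.inv
    rw [e]
    exact mul_mem (hdiv g hg) (inv_mem_fractionSubring (hdiv f hf) hu')
  exact this

theorem isLocPair_of_isUnitAt (hR : IsLocPair k x y R) (hx : IsUnitAt R x) :
    IsLocPair k (y / x) x R := by
  have hxC : x ∈ Algebra.adjoin k {y / x, x} := right_mem_adjoin_pair _ _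
  have htC : y / x ∈ Algebra.adjoin k {y / x, x} := left_mem_adjoin_pair _ _
  refine hR.change ?_ hx.mem ⟨x, hxC, 1, one_mem _, .one, by simp⟩
    ⟨y / x * x, mul_mem htC hxC, 1, one_mem _, .one, ?_⟩
  · rw [div_eq_mul_inv]; exact mul_mem hR.right_mem hx.inv_mem
  · rw [div_one, div_mul_cancel₀ _ hx.1]

theorem isLocOf_blowupChart (hc : IsCoordinates k x y) (hQ : IsLocPair k x y Q)
    (hx : VanishesAt Q x) (hy : VanishesAt Q y) (hR : IsLocPair k (y / x) x R)
    (hxR : VanishesAt R x) : Q ≤ R ∧ IsLocOf (blowupChart Q x) R := by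
  have hx0 := hc.left_ne_zero
  have hyR : VanishesAt R y := by
    have := hxR.mul_left hR.left_mem
    rwa [div_mul_cancel₀ _ hx0] at this
  have hle := le_of_vanishesAt hQ hx hy hR.algebraMap_mem hxR hyR
  have hQB : Q.toSubring ≤ blowupChart Q x := fun a ha => Subring.subset_closure (Or.inl ha)
  refine ⟨hle, IsLocOf.of_fractions hR (Subring.closure_le.2 (Set.union_subset hle.1 ?_)) ?_⟩
  · rintro - ⟨g, hg, rfl⟩
    obtain ⟨a, ha, b, hb, rfl⟩ := exists_eq_add_of_vanishesAt hQ hx hy hg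
    have e : (a * x + b * y) / x = a + b * (y / x) := by field_simp
    rw [e]
    exact add_mem (hle.1 ha) (mul_mem (hle.1 hb) hR.left_mem)
  · intro a ha
    refine ⟨a, ?_, 1, one_mem _, .one, by simp⟩
    change a ∈ Algebra.adjoin k {y / x, x} at ha
    induction ha using Algebra.adjoin_induction with
    | mem a ha =>
      rcases ha with rfl | rfl
      exacts [Subring.subset_closure (Or.inr ⟨y, hy, rfl⟩), hQB hx.mem]
    | algebraMap c => exact hQB (hQ.algebraMap_mem c)
    | add a a' _ _ h h' => exact add_mem h h'
    | mul a a' _ _ h h' => exact mul_mem h h'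

theorem mem_plane_iff (hc : IsCoordinates k x y) : R ∈ plane k ![1, x, y] ↔
    IsLocPair k x y R ∨ IsLocPair k (y / x) x⁻¹ R ∨ IsLocPair k (x / y) y⁻¹ R := by
  have hX := hc.isFrame
  rw [mem_plane, Fin.exists_fin_succ, Fin.exists_fin_two, hX.isLocPair, hX.isLocPair,
    hX.isLocPair]
  change IsLocPair k (x / 1) (y / 1) R ∨ IsLocPair k (1 / x) (y / x) R ∨
    IsLocPair k (1 / y) (x / y) R ↔ _
  rw [div_one, div_one, one_div, one_div]
  have e : ∀ a b : K, IsLocPair k a b R ↔ IsLocPair k b a R := fun a b =>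
    ⟨IsLocPair.symm, IsLocPair.symm⟩
  rw [e x⁻¹, e y⁻¹]

theorem mem_hirzebruch_one {t s : K} : R ∈ hirzebruch k 1 t s ↔
    IsLocPair k t s R ∨ IsLocPair k t s⁻¹ R ∨ IsLocPair k t⁻¹ (t * s) R ∨
      IsLocPair k t⁻¹ (t * s)⁻¹ R := by
  rw [hirzebruch, mem_modelOfCharts, pow_one]
  simp [IsLocPair]

/-- Points at infinity match in the charts `(t, s⁻¹)` and `(t⁻¹, (t s)⁻¹)`. Finite points match
according to which of `x`, `y` is a unit away from `Q`, or generates the pulled back maximal ideal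
over `Q`. -/
theorem blowup_eq_hirzebruch (hc : IsCoordinates k x y) (hQ : IsLocPair k x y Q)
    (hx : VanishesAt Q x) (hy : VanishesAt Q y) :
    blowup (plane k ![1, x, y]) Q = hirzebruch k 1 (y / x) x := by
  have hx0 := hc.left_ne_zero
  have hy0 := hc.right_ne_zero
  ext R
  rw [mem_hirzebruch_one, mem_blowup, mem_plane_iff hc, inv_div, div_mul_cancel₀ _ hx0]
  constructor
  · rintro (⟨h | h | h, hne⟩ | ⟨hle, f, hf0, hf, hR⟩)
    · rcases isUnitAt_or_vanishesAt h.left_mem with hu | hv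
      · exact Or.inl (isLocPair_of_isUnitAt h hu)
      rcases isUnitAt_or_vanishesAt h.right_mem with hu | hv'
      · exact Or.inr (Or.inr (Or.inl (isLocPair_of_isUnitAt h.symm hu)))
      · exact absurd (hQ.eq_of_vanishesAt hx hy h hv hv') hne
    · exact Or.inr (Or.inl h)
    · exact Or.inr (Or.inr (Or.inr h))
    · obtain ⟨a, ha, b, hb, e⟩ := exists_eq_add_of_vanishesAt hQ hx hy hf
      have h1 : x / f ∈ R.toSubring := hR.1 (Subring.subset_closure (Or.inr ⟨x, hx, rfl⟩))
      have h2 : y / f ∈ R.toSubring := hR.1 (Subring.subset_closure (Or.inr ⟨y, hy, rfl⟩))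
      rcases isUnitAt_or_vanishesAt h1 with hu | hv
      · exact Or.inl (isLocPair_of_blowupChart hc hQ hx hy hle hf hR hu)
      rcases isUnitAt_or_vanishesAt h2 with hu | hv'
      · exact Or.inr (Or.inr (Or.inl
          (isLocPair_of_blowupChart hc.symm hQ.symm hy hx hle hf hR hu)))
      -- From `f = a x + b y`: `x / f` and `y / f` cannot vanish together, so the two charts with `f
      -- = x` and `f = y` cover.
      · have e' : (1 : K) = a * (x / f) + b * (y / f) := by
          field_simp
          exact e
        have : VanishesAt R (1 : K) := by
          rw [e']
          exact (hv.mul_left (hle.1 ha)).add (hv'.mul_left (hle.1 hb))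
        exact absurd .one this.not_isUnitAt
  · have hneQ : ∀ {a : K}, a ≠ 0 → VanishesAt Q a → a⁻¹ ∈ R.toSubring → R ≠ Q := by
      rintro a ha0 ha hR rfl
      exact ha.inv_notMem ha0 hR
    rintro (h | h | h | h)
    · rcases isUnitAt_or_vanishesAt h.right_mem with hu | hv
      · exact Or.inl ⟨Or.inr (Or.inl (h.inv_right hu)), hneQ hx0 hx hu.inv_mem⟩
      · obtain ⟨h1, h2⟩ := isLocOf_blowupChart hc hQ hx hy h hv
        exact Or.inr ⟨h1, x, hx0, hx, h2⟩
    · exact Or.inl ⟨Or.inr (Or.inl h), hneQ hx0 hx h.right_mem⟩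
    · rcases isUnitAt_or_vanishesAt h.right_mem with hu | hv
      · exact Or.inl ⟨Or.inr (Or.inr (h.inv_right hu)), hneQ hy0 hy hu.inv_mem⟩
      · obtain ⟨h1, h2⟩ := isLocOf_blowupChart hc.symm hQ.symm hy hx h hv
        exact Or.inr ⟨h1, y, hy0, hy, h2⟩
    · exact Or.inl ⟨Or.inr (Or.inr h), hneQ hy0 hy h.right_mem⟩

end Blowup

/-! ## Prime divisors on the Hirzebruch surface `Σ₁` -/

section Hirzebruch

variable {k K : Type*} [Field k] [Field K] [Algebra k K] {R R' : LocalSubring K} {t s : K}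

theorem IsCoordinates.inv_right (hc : IsCoordinates k t s) : IsCoordinates k t s⁻¹ :=
  hc.change (left_mem_fieldAdjoin _ _) (by
    simpa using inv_mem (right_mem_fieldAdjoin (k := k) t s⁻¹))

theorem IsCoordinates.inv_left_mul (hc : IsCoordinates k t s) : IsCoordinates k t⁻¹ (t * s) := by
  have h1 := left_mem_fieldAdjoin (k := k) t⁻¹ (t * s)
  have h2 := right_mem_fieldAdjoin (k := k) t⁻¹ (t * s)
  refine hc.change (by simpa using inv_mem h1) ?_
  convert mul_mem h1 h2 using 1
  rw [inv_mul_cancel_left₀ hc.left_ne_zero]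

theorem IsCoordinates.div_left (hc : IsCoordinates k t s) : IsCoordinates k (s / t) t := by
  have h1 := left_mem_fieldAdjoin (k := k) (s / t) t
  have h2 := right_mem_fieldAdjoin (k := k) (s / t) t
  refine hc.change h2 ?_
  convert mul_mem h1 h2 using 1
  rw [div_mul_cancel₀ _ hc.left_ne_zero]

theorem hirzebruch_one_symm (ht : t ≠ 0) :
    hirzebruch k 1 t⁻¹ (t * s) = hirzebruch k 1 t s := by
  ext R
  rw [mem_hirzebruch_one, mem_hirzebruch_one, inv_inv, inv_mul_cancel_left₀ ht]
  tauto

theorem IsLocPair.of_inv_left_mul (h : IsLocPair k t⁻¹ (t * s) R) (ht0 : t ≠ 0)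
    (ht : t ∈ R.toSubring) : IsLocPair k t s R := by
  have h1 := left_mem_adjoin_pair (k := k) t s
  have h2 := right_mem_adjoin_pair (k := k) t s
  refine h.change ht ?_ ⟨1, one_mem _, t, h1, ⟨ht0, ht, h.left_mem⟩, (one_div _).symm⟩
    ⟨t * s, mul_mem h1 h2, 1, one_mem _, .one, by simp⟩
  have := mul_mem h.left_mem h.right_mem
  rwa [inv_mul_cancel_left₀ ht0] at this

theorem isLocPair_of_mem (hc : IsCoordinates k t s) (hR : R ∈ hirzebruch k 1 t s)
    (ht : t ∈ R.toSubring) (hs : s ∈ R.toSubring) : IsLocPair k t s R := by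
  have ht0 := hc.left_ne_zero
  have hs0 := hc.right_ne_zero
  rcases mem_hirzebruch_one.1 hR with h | h | h | h
  · exact h
  · simpa using h.inv_right ⟨inv_ne_zero hs0, h.right_mem, by simpa using hs⟩
  · exact h.of_inv_left_mul ht0 ht
  · have := h.inv_right ⟨inv_ne_zero (mul_ne_zero ht0 hs0), h.right_mem, by
      simpa using mul_mem ht hs⟩
    rw [inv_inv] at this
    exact this.of_inv_left_mul ht0 ht

theorem isLocPair_of_inv_mem (hc : IsCoordinates k t s) (hR : R ∈ hirzebruch k 1 t s)
    (ht : t ∈ R.toSubring) (hs : s⁻¹ ∈ R.toSubring) : IsLocPair k t s⁻¹ R := by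
  have ht0 := hc.left_ne_zero
  have hs0 := hc.right_ne_zero
  by_cases hs' : s ∈ R.toSubring
  · exact (isLocPair_of_mem hc hR ht hs').inv_right ⟨hs0, hs', hs⟩
  rcases mem_hirzebruch_one.1 hR with h | h | h | h
  · exact absurd h.right_mem hs'
  · exact h
  · exact absurd (h.of_inv_left_mul ht0 ht).right_mem hs'
  · have h1 := left_mem_adjoin_pair (k := k) t s⁻¹
    have h2 := right_mem_adjoin_pair (k := k) t s⁻¹
    refine h.change ht hs ⟨1, one_mem _, t, h1, ⟨ht0, ht, h.left_mem⟩, (one_div _).symm⟩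
      ⟨s⁻¹, h2, t, h1, ⟨ht0, ht, h.left_mem⟩, ?_⟩
    rw [mul_inv, mul_comm, div_eq_mul_inv]

/-- Prime divisors on which `t` has a pole. -/
theorem vanishesAt_inv_of_notMem (hD : IsDivisorial R) (ht : t ∉ R.toSubring) :
    VanishesAt R t⁻¹ :=
  .of_inv_notMem ((hD.mem_or_inv_mem t).resolve_left ht) (by simpa using ht)

theorem isDivisorial_of_mem_hirzebruch (hc : IsCoordinates k t s) (hR : R ∈ hirzebruch k 1 t s)
    (hD : IsDiscreteValuationRing R.toSubring) : IsDivisorial R := by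
  rcases mem_hirzebruch_one.1 hR with h | h | h | h
  · exact h.isDivisorial hc hD
  · exact h.isDivisorial hc.inv_right hD
  · exact h.isDivisorial hc.inv_left_mul hD
  · exact h.isDivisorial hc.inv_left_mul.inv_right hD

/-! ### Fibres -/

/-- If `s` had a pole, then `t - c` and `s⁻¹` would both vanish in the chart `(t, s⁻¹)`, which
describes a point and not a curve. -/
theorem isLocPair_of_fibre (hc : IsCoordinates k t s) (hR : R ∈ hirzebruch k 1 t s)
    (hD : IsDiscreteValuationRing R.toSubring) {c : k} (hv : VanishesAt R (t - algebraMap k K c)) :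
    IsLocPair k t s R := by
  have hdiv := isDivisorial_of_mem_hirzebruch hc hR hD
  have ht : t ∈ R.toSubring := by
    have hk : algebraMap k K c ∈ R.toSubring := by
      rcases mem_hirzebruch_one.1 hR with h | h | h | h <;> exact h.algebraMap_mem c
    simpa using add_mem hv.mem hk
  by_cases hs : s ∈ R.toSubring
  · exact isLocPair_of_mem hc hR ht hs
  have hs' := vanishesAt_inv_of_notMem hdiv hs
  have h := isLocPair_of_inv_mem hc hR ht hs'.mem
  have := h.symm.isUnitAt_left_of_graph hc.inv_right.symm hD (q := Polynomial.C c)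
    (by simpa using hv) 0
  rw [map_zero, sub_zero] at this
  exact absurd this hs'.not_isUnitAt

theorem isUniformizerAt_fibre (hc : IsCoordinates k t s) (hR : R ∈ hirzebruch k 1 t s)
    (hD : IsDiscreteValuationRing R.toSubring) {c : k} (hv : VanishesAt R (t - algebraMap k K c)) :
    IsUniformizerAt R (t - algebraMap k K c) := by
  have := (isLocPair_of_fibre hc hR hD hv).symm.isUniformizerAt_graph hc.symm hD
    (q := Polynomial.C c) (by simpa using hv)
  simpa using this

theorem eq_of_fibre (hc : IsCoordinates k t s) (hR : R ∈ hirzebruch k 1 t s)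
    (hR' : R' ∈ hirzebruch k 1 t s) (hD : IsDiscreteValuationRing R.toSubring)
    (hD' : IsDiscreteValuationRing R'.toSubring) {c : k}
    (hv : VanishesAt R (t - algebraMap k K c)) (hv' : VanishesAt R' (t - algebraMap k K c)) :
    R = R' :=
  (isLocPair_of_fibre hc hR hD hv).symm.unique_of_graph (isLocPair_of_fibre hc hR' hD' hv').symm
    hc.symm hD hD' (q := Polynomial.C c) (by simpa using hv) (by simpa using hv')

/-! ### Positive sections -/

theorem exists_linear_of_natDegree_le {P : Polynomial k} (hP : P.natDegree ≤ 1) :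
    ∃ a b : k, P = Polynomial.C a * Polynomial.X + Polynomial.C b :=
  Polynomial.exists_eq_X_add_C_of_natDegree_le_one hP

/-- Where `t` has a pole, a positive section does not contain the prime divisor. -/
theorem isUnitAt_section_div (hc : IsCoordinates k t s) (hR : R ∈ hirzebruch k 1 t s)
    (hD : IsDiscreteValuationRing R.toSubring) {P : Polynomial k} (hP : P.natDegree ≤ 1)
    (ht : t ∉ R.toSubring) (hts : (t * s)⁻¹ ∈ R.toSubring) :
    IsUnitAt R ((s⁻¹ - Polynomial.aeval t P) / t) := by
  have hdiv := isDivisorial_of_mem_hirzebruch hc hR hD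
  have ht' := vanishesAt_inv_of_notMem hdiv ht
  have ht0 := hc.left_ne_zero
  have hs0 := hc.right_ne_zero
  rw [← hirzebruch_one_symm ht0] at hR
  have h := isLocPair_of_inv_mem hc.inv_left_mul hR ht'.mem hts
  obtain ⟨a, b, rfl⟩ := exists_linear_of_natDegree_le hP
  -- In the chart at `t = ∞` the section given by `a t + b` becomes the graph of `b t⁻¹ + a`.
  have e : (s⁻¹ - Polynomial.aeval t (Polynomial.C a * Polynomial.X + Polynomial.C b)) / t =
      (t * s)⁻¹ - Polynomial.aeval t⁻¹ (Polynomial.C b * Polynomial.X + Polynomial.C a) := by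
    simp only [map_add, map_mul, Polynomial.aeval_C, Polynomial.aeval_X]
    field_simp
    ring
  rw [e]
  rcases isUnitAt_or_vanishesAt (sub_mem h.right_mem (h.aeval_mem h.left_mem
    (Polynomial.C b * Polynomial.X + Polynomial.C a))) with hu | hv
  · exact hu
  · have := h.isUnitAt_left_of_graph hc.inv_left_mul.inv_right hD hv 0
    rw [map_zero, sub_zero] at this
    exact absurd this ht'.not_isUnitAt

/-- A positive section is not the fibre `t = ∞`: there its equation, divided by `t`, is a unit. -/
theorem isLocPair_of_section (hc : IsCoordinates k t s) (hR : R ∈ hirzebruch k 1 t s)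
    (hD : IsDiscreteValuationRing R.toSubring) {P : Polynomial k} (hP : P.natDegree ≤ 1)
    (hv : VanishesAt R (s⁻¹ - Polynomial.aeval t P)) : IsLocPair k t s⁻¹ R := by
  have hdiv := isDivisorial_of_mem_hirzebruch hc hR hD
  have ht0 := hc.left_ne_zero
  have hs0 := hc.right_ne_zero
  have hk : ∀ c : k, algebraMap k K c ∈ R.toSubring := fun c => by
    rcases mem_hirzebruch_one.1 hR with h | h | h | h <;> exact h.algebraMap_mem c
  have ht : t ∈ R.toSubring := by
    by_contra ht
    have ht' := vanishesAt_inv_of_notMem hdiv ht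
    have hv' : VanishesAt R ((s⁻¹ - Polynomial.aeval t P) / t) := by
      rw [div_eq_mul_inv]; exact hv.mul_right ht'.mem
    refine hv'.not_isUnitAt (isUnitAt_section_div hc hR hD hP ht ?_)
    obtain ⟨a, b, rfl⟩ := exists_linear_of_natDegree_le hP
    have e : (t * s)⁻¹ = (s⁻¹ - Polynomial.aeval t
        (Polynomial.C a * Polynomial.X + Polynomial.C b)) / t +
        (algebraMap k K b * t⁻¹ + algebraMap k K a) := by
      simp only [map_add, map_mul, Polynomial.aeval_C, Polynomial.aeval_X]
      field_simp
      ring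
    rw [e]
    exact add_mem hv'.mem (add_mem (mul_mem (hk b) ht'.mem) (hk a))
  refine isLocPair_of_inv_mem hc hR ht ?_
  have : Polynomial.aeval t P ∈ R.toSubring := by
    obtain ⟨a, b, rfl⟩ := exists_linear_of_natDegree_le hP
    simp only [map_add, map_mul, Polynomial.aeval_C, Polynomial.aeval_X]
    exact add_mem (mul_mem (hk a) ht) (hk b)
  simpa using add_mem hv.mem this

theorem isUniformizerAt_section (hc : IsCoordinates k t s) (hR : R ∈ hirzebruch k 1 t s)
    (hD : IsDiscreteValuationRing R.toSubring) {P : Polynomial k} (hP : P.natDegree ≤ 1)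
    (hv : VanishesAt R (s⁻¹ - Polynomial.aeval t P)) :
    IsUniformizerAt R (s⁻¹ - Polynomial.aeval t P) :=
  (isLocPair_of_section hc hR hD hP hv).isUniformizerAt_graph hc.inv_right hD hv

theorem eq_of_section (hc : IsCoordinates k t s) (hR : R ∈ hirzebruch k 1 t s)
    (hR' : R' ∈ hirzebruch k 1 t s) (hD : IsDiscreteValuationRing R.toSubring)
    (hD' : IsDiscreteValuationRing R'.toSubring) {P : Polynomial k} (hP : P.natDegree ≤ 1)
    (hv : VanishesAt R (s⁻¹ - Polynomial.aeval t P))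
    (hv' : VanishesAt R' (s⁻¹ - Polynomial.aeval t P)) : R = R' :=
  (isLocPair_of_section hc hR hD hP hv).unique_of_graph (isLocPair_of_section hc hR' hD' hP hv')
    hc.inv_right hD hD' hv hv'

/-! ### The negative section -/

/-- Near `t = ∞` the fibre coordinate is `t s`; its vanishing together with `t⁻¹` would describe a
point. -/
theorem mem_of_negative_section (hc : IsCoordinates k t s) (hR : R ∈ hirzebruch k 1 t s)
    (hD : IsDiscreteValuationRing R.toSubring) (hts : VanishesAt R (t * s)) :
    t ∈ R.toSubring := by
  by_contra ht
  have hdiv := isDivisorial_of_mem_hirzebruch hc hR hD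
  have ht' := vanishesAt_inv_of_notMem hdiv ht
  rw [← hirzebruch_one_symm hc.left_ne_zero] at hR
  have h := isLocPair_of_mem hc.inv_left_mul hR ht'.mem hts.mem
  have := h.isUnitAt_left_of_graph hc.inv_left_mul hD (q := 0) (by simpa using hts) 0
  rw [map_zero, sub_zero] at this
  exact ht'.not_isUnitAt this

theorem isUniformizerAt_negative_section (hc : IsCoordinates k t s) (hR : R ∈ hirzebruch k 1 t s)
    (hD : IsDiscreteValuationRing R.toSubring) (ht : t ∈ R.toSubring) (hs : VanishesAt R s) :
    IsUniformizerAt R s := by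
  have := (isLocPair_of_mem hc hR ht hs.mem).isUniformizerAt_graph hc hD (q := 0)
    (by simpa using hs)
  simpa using this

theorem eq_of_negative_section (hc : IsCoordinates k t s) (hR : R ∈ hirzebruch k 1 t s)
    (hR' : R' ∈ hirzebruch k 1 t s) (hD : IsDiscreteValuationRing R.toSubring)
    (hD' : IsDiscreteValuationRing R'.toSubring) (ht : t ∈ R.toSubring) (ht' : t ∈ R'.toSubring)
    (hs : VanishesAt R s) (hs' : VanishesAt R' s) : R = R' :=
  (isLocPair_of_mem hc hR ht hs.mem).unique_of_graph (isLocPair_of_mem hc hR' ht' hs'.mem)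
    hc hD hD' (q := 0) (by simpa using hs) (by simpa using hs')

/-- The negative section. -/
theorem exists_negative_section (hc : IsCoordinates k t s) :
    ∃ R, IsLocPair k t s R ∧ IsUniformizerAt R s := by
  have := exists_isLocPair_of_prime hc (prime_right_sub (k := k) 0)
  simpa using this

/-! ### Divisors of the functions that cut out these curves -/

/-- The rational function with divisor `f - {t = ∞}`, for a fibre `f`. -/
theorem exists_fibre_function (hc : IsCoordinates k t s)
    {f : LocalSubring K} (hf : f ∈ hirzebruch k 1 t s)
    (hDf : IsDiscreteValuationRing f.toSubring)
    (h : (∃ c : k, VanishesAt f (t - algebraMap k K c)) ∨ VanishesAt f t⁻¹) :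
    ∃ φ : K, φ ≠ 0 ∧ ∀ R ∈ hirzebruch k 1 t s, IsDiscreteValuationRing R.toSubring →
      (t ∈ R.toSubring → (R = f → ordAt R φ = 1) ∧ (R ≠ f → ordAt R φ = 0)) ∧
      (t ∉ R.toSubring → (R = f → ordAt R (φ / t) = 1) ∧ (R ≠ f → ordAt R (φ / t) = 0)) := by
  have ht0 := hc.left_ne_zero
  rcases h with ⟨c, hv⟩ | hv
  · refine ⟨t - algebraMap k K c, sub_ne_zero.2 (hc.left_ne_const c), fun R hR hD => ⟨fun ht =>
      ⟨?_, fun hne => ?_⟩, fun ht => ⟨?_, fun hne => ?_⟩⟩⟩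
    · rintro rfl
      exact (isUniformizerAt_fibre hc hR hD hv).ordAt_self
    · have hdiv := isDivisorial_of_mem_hirzebruch hc hR hD
      have hk : algebraMap k K c ∈ R.toSubring := by
        rcases mem_hirzebruch_one.1 hR with h | h | h | h <;> exact h.algebraMap_mem c
      rcases isUnitAt_or_vanishesAt (sub_mem ht hk) with hu | hv'
      · exact hdiv.ordAt_isUnitAt hu
      · exact absurd (eq_of_fibre hc hR hf hD hDf hv' hv) hne
    · rintro rfl
      exact absurd (isLocPair_of_fibre hc hR hD hv).left_mem ht
    · have hdiv := isDivisorial_of_mem_hirzebruch hc hR hD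
      have ht' := vanishesAt_inv_of_notMem hdiv ht
      have hk : algebraMap k K c ∈ R.toSubring := by
        rcases mem_hirzebruch_one.1 hR with h | h | h | h <;> exact h.algebraMap_mem c
      have e : (t - algebraMap k K c) / t = 1 + -(algebraMap k K c * t⁻¹) := by
        field_simp; ring
      rw [e]
      exact hdiv.ordAt_isUnitAt (IsUnitAt.one.add_vanishesAt (ht'.mul_left hk).neg)
  · have hft : t ∉ f.toSubring := fun h =>
      hv.not_isUnitAt ⟨inv_ne_zero ht0, hv.mem, by simpa using h⟩
    -- If the fibre is `t = ∞` itself, the required divisor is zero.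
    refine ⟨1, one_ne_zero, fun R hR hD => ⟨fun ht => ⟨?_, fun hne => ?_⟩, fun ht =>
      ⟨?_, fun hne => ?_⟩⟩⟩
    · rintro rfl
      exact absurd ht hft
    · exact (isDivisorial_of_mem_hirzebruch hc hR hD).ordAt_isUnitAt .one
    · rintro rfl
      rw [← hirzebruch_one_symm ht0] at hR
      have := isUniformizerAt_fibre hc.inv_left_mul hR hD (c := 0) (by simpa using hv)
      rw [map_zero, sub_zero] at this
      rw [one_div]
      exact this.ordAt_self
    · have hdiv := isDivisorial_of_mem_hirzebruch hc hR hD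
      have ht' := vanishesAt_inv_of_notMem hdiv ht
      rw [← hirzebruch_one_symm ht0] at hR hf
      exact absurd (eq_of_fibre hc.inv_left_mul hR hf hD hDf (c := 0) (by simpa using ht')
        (by simpa using hv)) hne

theorem ordAt_section (hc : IsCoordinates k t s) {m : LocalSubring K}
    (hm : m ∈ hirzebruch k 1 t s) (hDm : IsDiscreteValuationRing m.toSubring) {P : Polynomial k}
    (hP : P.natDegree ≤ 1) (hv : VanishesAt m (s⁻¹ - Polynomial.aeval t P))
    (hR : R ∈ hirzebruch k 1 t s) (hD : IsDiscreteValuationRing R.toSubring)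
    (ht : t ∈ R.toSubring) (hs : s⁻¹ ∈ R.toSubring) :
    (R = m → ordAt R (s⁻¹ - Polynomial.aeval t P) = 1) ∧
    (R ≠ m → ordAt R (s⁻¹ - Polynomial.aeval t P) = 0) := by
  refine ⟨?_, fun hne => ?_⟩
  · rintro rfl
    exact (isUniformizerAt_section hc hR hD hP hv).ordAt_self
  · have h := isLocPair_of_inv_mem hc hR ht hs
    rcases isUnitAt_or_vanishesAt (sub_mem hs (h.aeval_mem ht P)) with hu | hv'
    · exact (h.isDivisorial hc.inv_right hD).ordAt_isUnitAt hu
    · exact absurd (eq_of_section hc hR hm hD hDm hP hv' hv) hne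

/-- On the negative section the rescaled equation is `1 - P(t) s`, which is a unit: the two sections
are disjoint and `s⁻¹` accounts for the pole. -/
theorem ordAt_section_mul_of_vanishesAt (hc : IsCoordinates k t s) {P : Polynomial k}
    (hR : R ∈ hirzebruch k 1 t s) (hD : IsDiscreteValuationRing R.toSubring)
    (ht : t ∈ R.toSubring) (hs : VanishesAt R s) :
    ordAt R ((s⁻¹ - Polynomial.aeval t P) * s) = 0 := by
  have h := isLocPair_of_mem hc hR ht hs.mem
  have hs0 := hc.right_ne_zero
  have e : (s⁻¹ - Polynomial.aeval t P) * s = 1 + -(Polynomial.aeval t P * s) := by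
    field_simp; ring
  rw [e]
  exact (h.isDivisorial hc hD).ordAt_isUnitAt
    (IsUnitAt.one.add_vanishesAt (hs.mul_left (h.aeval_mem ht P)).neg)

end Hirzebruch

/-! ## The foliation on the plane and on its blowup -/

section BlownUpFoliation

variable {k K : Type*} [Field k] [Field K] [Algebra k K] {R Q : LocalSubring K} {x y : K}
  {F : Foliation k K} {v : Derivation k K K} {d : ℕ} {a : Fin 3 → K}

/-- The residue field at the origin is `k`: divide the constant terms of numerator and denominator.
-/
theorem exists_residue (hQ : IsLocPair k x y Q) (hx : VanishesAt Q x) (hy : VanishesAt Q y) {r : K}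
    (hr : r ∈ Q.toSubring) : ∃ c : k, VanishesAt Q (r - algebraMap k K c) := by
  obtain ⟨f, hf, g, hg, hu, rfl⟩ := hQ.2 r hr
  obtain ⟨b, b1, hb1, b2, hb2, rfl⟩ := exists_eq_const_add hf
  obtain ⟨c, c1, hc1, c2, hc2, rfl⟩ := exists_eq_const_add hg
  have hc : c ≠ 0 := (isUnitAt_const_add_iff hQ.algebraMap_mem hx hy (hQ.1 hc1) (hQ.1 hc2) c).1 hu
  have hc' : algebraMap k K c ≠ 0 := by simpa using hc
  have hu0 := hu.1
  have hv1 : VanishesAt Q (b1 * x + b2 * y) := (hx.mul_left (hQ.1 hb1)).add (hy.mul_left (hQ.1 hb2))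
  have hv2 : VanishesAt Q (c1 * x + c2 * y) := (hx.mul_left (hQ.1 hc1)).add (hy.mul_left (hQ.1 hc2))
  refine ⟨b / c, ?_⟩
  set m := b1 * x + b2 * y
  set n := c1 * x + c2 * y
  have e : (algebraMap k K b + m) / (algebraMap k K c + n) - algebraMap k K (b / c) =
      (m - algebraMap k K (b / c) * n) * (algebraMap k K c + n)⁻¹ := by
    rw [map_div₀]
    field_simp
    ring
  rw [e]
  exact (hv1.sub (hv2.mul_left (hQ.algebraMap_mem _))).mul_right hu.inv_mem

theorem exists_isPrimitiveAt_of_not_isSingular (hQ : IsLocPair k x y Q) (h : ¬ IsSingular F Q) :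
    ∃ v ∈ F.line, IsPrimitiveAt Q x y v := by
  simp only [IsSingular, not_forall] at h
  obtain ⟨v, hv, f, hf, hvf⟩ := h
  have hx := hv.2 x hQ.left_mem
  have hy := hv.2 y hQ.right_mem
  refine ⟨v, hv.1, hx, hy, ?_⟩
  by_contra! hn
  obtain ⟨b, hb, c, hc, e⟩ := hQ.exists_apply_eq hf
  apply hvf
  rw [e v]
  exact ((vanishesAt_iff.2 ⟨hx, hn.1⟩).mul_left hb).add ((vanishesAt_iff.2 ⟨hy, hn.2⟩).mul_left hc)

theorem IsPrimitiveAt.mono {u w : K} (h : IsPrimitiveAt Q u w v)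
    (hQR : Q.toSubring ≤ R.toSubring) : IsPrimitiveAt R u w v :=
  ⟨hQR h.1, hQR h.2.1, h.2.2.imp (fun h => h.mono hQR) fun h => h.mono hQR⟩

/-- A vector field without zeros at `Q` acquires a simple pole along the exceptional divisor. -/
theorem IsPrimitiveAt.smul_exceptional (hc : IsCoordinates k x y) (hQ : IsLocPair k x y Q)
    (hx : VanishesAt Q x) (hy : VanishesAt Q y) (hv : IsPrimitiveAt Q x y v)
    (hR : IsLocPair k (y / x) x R) (hRx : IsUniformizerAt R x) (hQR : Q ≤ R) :
    IsPrimitiveAt R (y / x) x (x • v) := by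
  obtain ⟨hle, hvan⟩ := localSubring_le_iff.1 hQR
  have hx0 := hc.left_ne_zero
  have e : (x • v) (y / x) = v y - y / x * v x := by
    rw [Derivation.smul_apply, Derivation.leibniz_div]
    simp only [smul_eq_mul]
    field_simp
  have ex : (x • v) x = x * v x := rfl
  have h1 := hle hv.1
  have h2 := hle hv.2.1
  have ht := hR.left_mem
  refine ⟨by rw [e]; exact sub_mem h2 (mul_mem ht h1), by rw [ex]; exact mul_mem hR.right_mem h1,
    Or.inl ?_⟩
  rw [e]
  obtain ⟨b, hb⟩ := exists_residue hQ hx hy hv.1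
  obtain ⟨c, hc'⟩ := exists_residue hQ hx hy hv.2.1
  have hbc : b ≠ 0 ∨ c ≠ 0 := by
    by_contra! h0
    rw [h0.1, map_zero, sub_zero] at hb
    rw [h0.2, map_zero, sub_zero] at hc'
    exact hv.2.2.elim hb.not_isUnitAt hc'.not_isUnitAt
  have hm : VanishesAt R ((v y - algebraMap k K c) - y / x * (v x - algebraMap k K b)) :=
    (hvan _ hc').sub ((hvan _ hb).mul_left ht)
  -- Modulo functions that vanish on `E` the component is `c - b t` with `(b, c) ≠ 0`. It is not
  -- identically zero on `E`, since `t` is a coordinate there.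
  have hu : IsUnitAt R (algebraMap k K c - y / x * algebraMap k K b) := by
    by_cases hb0 : b = 0
    · rw [hb0, map_zero, mul_zero, sub_zero]
      exact .const hR.algebraMap_mem (hbc.resolve_left (by simpa using hb0))
    · have hb0' : algebraMap k K b ≠ 0 := by simpa using hb0
      have := hR.isUnitAt_left_of_graph hc.div_left hRx.isDiscreteValuationRing (q := 0)
        (by simpa using hRx.2.1) (c / b)
      have e' : algebraMap k K c - y / x * algebraMap k K b =
          -(algebraMap k K b * (y / x - algebraMap k K (c / b))) := by
        rw [map_div₀]; field_simp; ring
      rw [e']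
      exact ((IsUnitAt.const hR.algebraMap_mem hb0).mul this).neg
  have := hu.add_vanishesAt hm
  convert this using 1
  ring

/-- Rescaling by `x` gives `x^(p+1)`, and `d(y/x) ∧ dx = -(1/x) dx ∧ dy` takes away one power and
gives the sign. -/
theorem pContract_exceptional {p : ℕ} [Fact p.Prime] [CharP k p] (hx : x ≠ 0) :
    pContract p (y / x) x (x • v) = -(x ^ p * pContract p x y v) := by
  rw [pContract_smul]
  simp only [pContract, ← pPow_apply, Derivation.leibniz_div, smul_eq_mul]
  field_simp
  ring

/-! ### `p`-closedness -/

variable {p : ℕ} [Fact p.Prime] [CharP k p]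

/-- Iterates of a regular vector field preserve the local ring, so p-closedness can fail only
because `v^p` leaves the line. -/
theorem exists_pPow_notMem {X : Set (LocalSubring K)} (h : ¬ IsPClosed p X F) :
    ∃ v ∈ F.line, pPow p v ∉ F.line := by
  simp only [IsPClosed, not_forall] at h
  obtain ⟨R, -, v, hv, hp⟩ := h
  refine ⟨v, hv.1, fun hl => hp ⟨hl, fun f hf => ?_⟩⟩
  rw [pPow_apply]
  have : ∀ n : ℕ, v^[n] f ∈ R.toSubring := by
    intro n
    induction n with
    | zero => exact hf
    | succ n ih => rw [Function.iterate_succ_apply']; exact hv.2 _ ih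
  exact this p

theorem not_isPClosed_hirzebruch {t s : K} (hc : IsCoordinates k t s) (hv : v ∈ F.line)
    (hp : pPow p v ∉ F.line) : ¬ IsPClosed p (hirzebruch k 1 t s) F := by
  intro h
  -- The zero ideal gives the generic point, with local ring `K`, where regularity imposes no
  -- condition.
  obtain ⟨R, hR, hRv⟩ := exists_isLocPair_of_isPrime hc (Ideal.isPrime_bot)
  have htop : ∀ f, f ∈ R.toSubring := fun f => by
    obtain ⟨b, c, hc0, rfl⟩ := hc.exists_div f
    rw [div_eq_mul_inv]
    refine mul_mem (hR.poly_mem b) (IsUnitAt.inv_mem ?_)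
    rcases isUnitAt_or_vanishesAt (hR.poly_mem c) with hu | hv
    · exact hu
    · exact absurd ((hRv c).1 hv) hc0
  exact hp (h R (mem_hirzebruch_one.2 (Or.inl hR)) v ⟨hv, fun f _ => htop _⟩).1

theorem pDivisor_nonneg_of_hirzebruch {t s : K} (hc : IsCoordinates k t s) (hv : v ∈ F.line)
    (hp : pPow p v ∉ F.line) {X : Set (LocalSubring K)} (C : PrimeDivisor X)
    (hC : C.1 ∈ hirzebruch k 1 t s) : 0 ≤ pDivisor p X F C := by
  have hdiv := isDivisorial_of_mem_hirzebruch hc hC C.2.2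
  rcases mem_hirzebruch_one.1 hC with h | h | h | h
  · exact pDivisor_nonneg hdiv h hc hv hp
  · exact pDivisor_nonneg hdiv h hc.inv_right hv hp
  · exact pDivisor_nonneg hdiv h hc.inv_left_mul hv hp
  · exact pDivisor_nonneg hdiv h hc.inv_left_mul.inv_right hv hp

/-- Outside of the support of the `p`-divisor its local equations are units. -/
theorem isUnitAt_pContract (hc : IsCoordinates k x y) (hQ : IsLocPair k x y Q) (hv : v ∈ F.line)
    (hvQ : IsPrimitiveAt Q x y v) (hp : pPow p v ∉ F.line)
    (hsupp : ¬ MemSupport Q (pDivisor p (plane k ![1, x, y]) F)) :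
    IsUnitAt Q (pContract p x y v) := by
  have hne := hc.pContract_ne_zero hv hvQ.ne_zero hp
  refine isUnitAt_of_forall_divisorial hc hQ hne fun R hR hD hQR => ?_
  let C : PrimeDivisor (plane k ![1, x, y]) :=
    ⟨R, (mem_plane_iff hc).2 (Or.inl hR), hD.isDiscreteValuationRing⟩
  have h0 : pDivisor p (plane k ![1, x, y]) F C = 0 := by
    by_contra h
    exact hsupp ⟨C, h, hQR⟩
  rw [pDivisor_eq (C := C) hD hR hc hv (hvQ.mono hQR) hp] at h0
  exact (hD.isUnitAt_iff hne).2 h0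

/-- The exceptional divisor has multiplicity `p` in the `p`-divisor. -/
theorem pDivisor_exceptional (hc : IsCoordinates k x y) (hQ : IsLocPair k x y Q)
    (hx : VanishesAt Q x) (hy : VanishesAt Q y) (hv : v ∈ F.line) (hvQ : IsPrimitiveAt Q x y v)
    (hp : pPow p v ∉ F.line) (hu : IsUnitAt Q (pContract p x y v)) {X : Set (LocalSubring K)}
    {E : PrimeDivisor X} (hE : IsLocPair k (y / x) x E.1) (hEx : IsUniformizerAt E.1 x)
    (hQE : Q ≤ E.1) : pDivisor p X F E = p := by
  have hx0 := hc.left_ne_zero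
  have hprim := hvQ.smul_exceptional hc hQ hx hy hE hEx hQE
  have hxv := F.line.smul_mem x hv
  have hdiv : IsDivisorial E.1 := ⟨x, hEx⟩
  have huE := hu.mono hQE.1
  rw [pDivisor_eq hdiv hE hc.div_left hxv hprim (pPow_notMem_of_ne_zero hv hp hxv hprim.ne_zero),
    pContract_exceptional hx0, ← mul_neg, hdiv.ordAt_mul (pow_ne_zero _ hx0) huE.neg.1,
    hdiv.ordAt_isUnitAt huE.neg, hdiv.ordAt_pow hx0, hEx.ordAt_self]
  ring

/-! ### The canonical divisor -/

theorem IsDefiningForm.swap (h : IsDefiningForm F d ![1, x, y] a) :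
    IsDefiningForm F d ![1, y, x] ![a 0, a 2, a 1] := by
  refine h.perm (Equiv.swap 1 2) one_ne_zero (fun j => ?_) (fun j => ?_) <;>
  fin_cases j <;> simp [Equiv.swap_apply_of_ne_of_ne]

/-- The normalized field is `a₂ ∂_x - a₁ ∂_y`. If `a₁` and `a₂` both vanished along a curve, Euler's
relation would make `a₀` vanish as well. -/
theorem IsDefiningForm.isPrimitiveAt_affine (h : IsDefiningForm F d ![1, x, y] a)
    (hc : IsCoordinates k x y) (hR : IsLocPair k x y R) (hD : IsDivisorial R) {h' : K}
    (hh : h' ≠ 0) (hvx : v x = h' * a 2) (hvy : v y = -(h' * a 1)) :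
    IsPrimitiveAt R x y (h'⁻¹ • v) := by
  obtain ⟨h1, h2⟩ := h.unimodular R ((mem_plane_iff hc).2 (Or.inl hR)) hD.isDiscreteValuationRing 1
    one_ne_zero ⟨fun j => by
      fin_cases j
      · simp
      · simpa using hR.left_mem
      · simpa using hR.right_mem, 0, by simpa using IsUnitAt.one⟩
  simp only [one_pow, div_one] at h1 h2
  have ex : (h'⁻¹ • v) x = a 2 := by
    rw [Derivation.smul_apply, hvx, smul_eq_mul, inv_mul_cancel_left₀ hh]
  have ey : (h'⁻¹ • v) y = -a 1 := by
    rw [Derivation.smul_apply, hvy, smul_eq_mul, mul_neg, inv_mul_cancel_left₀ hh]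
  refine ⟨by rw [ex]; exact h1 2, by rw [ey]; exact neg_mem (h1 1), ?_⟩
  rw [ex, ey]
  by_contra! hn
  have v2 : VanishesAt R (a 2) := vanishesAt_iff.2 ⟨h1 2, hn.1⟩
  have v1 : VanishesAt R (a 1) := by
    have := (vanishesAt_iff.2 ⟨neg_mem (h1 1), hn.2⟩).neg
    rwa [neg_neg] at this
  have v0 : VanishesAt R (a 0) := by
    have e : a 0 = -(x * a 1 + y * a 2) := by
      have := h.euler
      simp only [Fin.sum_univ_three, Matrix.cons_val] at this
      linear_combination this
    rw [e]
    exact ((v1.mul_left hR.left_mem).add (v2.mul_left hR.right_mem)).neg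
  obtain ⟨j, hj⟩ := h2
  fin_cases j
  exacts [v0.not_isUnitAt hj, v1.not_isUnitAt hj, v2.not_isUnitAt hj]

/-- By Euler's relation, `x^(1-d) (a₂ ∂_x - a₁ ∂_y)` has components `a₀ / x^(d+1)` and `-a₂ /
x^(d+1)` in this chart. The power `x^(1-d)` is the source of the degree `d - 1` of the canonical
class of the plane. -/
theorem IsDefiningForm.isPrimitiveAt_infinity (h : IsDefiningForm F d ![1, x, y] a)
    (hc : IsCoordinates k x y) (hR : IsLocPair k (y / x) x⁻¹ R) (hD : IsDivisorial R) {h' : K}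
    (hh : h' ≠ 0) (hvx : v x = h' * a 2) (hvy : v y = -(h' * a 1)) :
    IsPrimitiveAt R (y / x) x⁻¹ ((x * (h' * x ^ d)⁻¹) • v) := by
  have hx0 := hc.left_ne_zero
  obtain ⟨h1, h2⟩ := h.unimodular R ((mem_plane_iff hc).2 (Or.inr (Or.inl hR)))
    hD.isDiscreteValuationRing x hx0 ⟨fun j => by
      fin_cases j
      · simpa using hR.right_mem
      · simp [hx0]
      · simpa using hR.left_mem, 1, by simpa [hx0] using IsUnitAt.one⟩
  have euler := h.euler
  simp only [Fin.sum_univ_three, Matrix.cons_val] at euler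
  have et : ((x * (h' * x ^ d)⁻¹) • v) (y / x) = a 0 / x ^ (d + 1) := by
    rw [Derivation.smul_apply, Derivation.leibniz_div, hvx, hvy]
    simp only [smul_eq_mul]
    field_simp
    linear_combination (-(x ^ (d + 1))) * euler
  have ex : ((x * (h' * x ^ d)⁻¹) • v) x⁻¹ = -(a 2 / x ^ (d + 1)) := by
    rw [Derivation.smul_apply, Derivation.leibniz_inv, hvx]
    simp only [smul_eq_mul]
    field_simp
    ring
  refine ⟨by rw [et]; exact h1 0, by rw [ex]; exact neg_mem (h1 2), ?_⟩
  rw [et, ex]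
  by_contra! hn
  have v0 : VanishesAt R (a 0 / x ^ (d + 1)) := vanishesAt_iff.2 ⟨h1 0, hn.1⟩
  have v2 : VanishesAt R (a 2 / x ^ (d + 1)) := by
    have := (vanishesAt_iff.2 ⟨neg_mem (h1 2), hn.2⟩).neg
    rwa [neg_neg] at this
  have v1 : VanishesAt R (a 1 / x ^ (d + 1)) := by
    have e : a 1 / x ^ (d + 1) =
        -(x⁻¹ * (a 0 / x ^ (d + 1)) + y / x * (a 2 / x ^ (d + 1))) := by
      field_simp
      linear_combination euler
    rw [e]
    exact ((v0.mul_left hR.right_mem).add (v2.mul_left hR.left_mem)).neg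
  obtain ⟨j, hj⟩ := h2
  fin_cases j
  exacts [v0.not_isUnitAt hj, v1.not_isUnitAt hj, v2.not_isUnitAt hj]

/-- The vector fields of the foliation are the multiples of `a₂ ∂_x - a₁ ∂_y`. -/
theorem IsDefiningForm.exists_factor (h : IsDefiningForm F d ![1, x, y] a)
    (hc : IsCoordinates k x y) (hv : v ∈ F.line) (hv0 : v ≠ 0) :
    ∃ h' : K, h' ≠ 0 ∧ v x = h' * a 2 ∧ v y = -(h' * a 1) := by
  have e := (h.line v).1 hv
  simp only [Fin.sum_univ_three, Matrix.cons_val] at e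
  rw [Derivation.map_one_eq_zero, mul_zero, zero_add] at e
  have hne : ∀ h' : K, v x = h' * a 2 → v y = -(h' * a 1) → h' ≠ 0 := by
    rintro _ h1 h2 rfl
    exact hv0 (hc.derivation_ext (by simp [h1]) (by simp [h2]))
  by_cases h2 : a 2 = 0
  · by_cases h1 : a 1 = 0
    · exfalso
      -- Any prime divisor of the affine chart contradicts unimodularity of a zero form; here it is
      -- the line `y = 0`.
      obtain ⟨R, hR, hRy⟩ := exists_isLocPair_of_prime hc (prime_right_sub (k := k) 0)
      have hD : IsDivisorial R := ⟨_, hRy⟩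
      obtain ⟨-, j, hj⟩ := h.unimodular R ((mem_plane_iff hc).2 (Or.inl hR))
        hD.isDiscreteValuationRing 1 one_ne_zero ⟨fun j => by
          fin_cases j
          · simp
          · simpa using hR.left_mem
          · simpa using hR.right_mem, 0, by simpa using IsUnitAt.one⟩
      have h0 : a 0 = 0 := by
        have := h.euler
        simpa [Fin.sum_univ_three, h1, h2] using this
      fin_cases j
      · exact hj.1 (by simp [h0])
      · exact hj.1 (by simp [h1])
      · exact hj.1 (by simp [h2])
    · have hx : v x = 0 := by simpa [h1, h2] using e
      have e1 : v x = -(v y / a 1) * a 2 := by rw [hx, h2, mul_zero]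
      have e2 : v y = -(-(v y / a 1) * a 1) := by field_simp
      exact ⟨_, hne _ e1 e2, e1, e2⟩
  · have e1 : v x = v x / a 2 * a 2 := by field_simp
    have e2 : v y = -(v x / a 2 * a 1) := by
      field_simp
      linear_combination e
    exact ⟨_, hne _ e1 e2, e1, e2⟩

theorem canonicalDivisor_eq_of_isPrimitiveAt {u w : K} {X : Set (LocalSubring K)}
    {C : PrimeDivisor X} (hC : IsLocPair k u w C.1) (hD : IsDivisorial C.1) (hv : v ∈ F.line)
    {c : K} (hc : c ≠ 0) (hp : IsPrimitiveAt C.1 u w (c • v)) :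
    canonicalDivisor X F v C = ordAt C.1 c := by
  have := canonicalDivisor_eq hD
    (hC.isGenerator_tangentStalk (F.line.smul_mem c hv) hp) hp.ne_zero (inv_ne_zero hc)
  rwa [smul_smul, inv_mul_cancel₀ hc, one_smul, hD.ordAt_inv hc, neg_neg] at this

theorem IsDefiningForm.canonicalDivisor_infinity (h : IsDefiningForm F d ![1, x, y] a)
    (hc : IsCoordinates k x y) (hv : v ∈ F.line) {h' : K} (hh : h' ≠ 0) (hvx : v x = h' * a 2)
    (hvy : v y = -(h' * a 1)) {X : Set (LocalSubring K)} {C : PrimeDivisor X}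
    (hC : IsLocPair k (y / x) x⁻¹ C.1) (hD : IsDivisorial C.1) :
    canonicalDivisor X F v C = -ordAt C.1 h' + (1 - d) * ordAt C.1 x := by
  have hx0 := hc.left_ne_zero
  have hxd := pow_ne_zero d hx0
  have hm := mul_ne_zero hh hxd
  rw [canonicalDivisor_eq_of_isPrimitiveAt hC hD hv (mul_ne_zero hx0 (inv_ne_zero hm))
    (h.isPrimitiveAt_infinity hc hC hD hh hvx hvy), hD.ordAt_mul hx0 (inv_ne_zero hm),
    hD.ordAt_inv hm, hD.ordAt_mul hh hxd, hD.ordAt_pow hx0]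
  ring

/-- With `v = g v'`, both `v'` and `h'⁻¹ v` generate the tangent sheaf along all curves through `Q`,
so `h' / g` is a unit at `Q` and hence along `E`. The summand `1` comes from the generator `x v'`
along `E`. -/
theorem IsDefiningForm.canonicalDivisor_exceptional (h : IsDefiningForm F d ![1, x, y] a)
    (hc : IsCoordinates k x y) (hv : v ∈ F.line) {h' : K} (hh : h' ≠ 0)
    (hvx : v x = h' * a 2) (hvy : v y = -(h' * a 1)) (hQ : IsLocPair k x y Q)
    (hx : VanishesAt Q x) (hy : VanishesAt Q y) {v' : Derivation k K K} (hv' : v' ∈ F.line)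
    (hvQ : IsPrimitiveAt Q x y v') {X : Set (LocalSubring K)} {E : PrimeDivisor X}
    (hE : IsLocPair k (y / x) x E.1) (hEx : IsUniformizerAt E.1 x) (hQE : Q ≤ E.1) :
    canonicalDivisor X F v E = 1 - ordAt E.1 h' := by
  have hdiv : IsDivisorial E.1 := ⟨x, hEx⟩
  have hx0 := hc.left_ne_zero
  obtain ⟨g, rfl⟩ := Foliation.exists_smul_eq hv' hvQ.ne_zero hv
  have hg : g ≠ 0 := by
    rintro rfl
    obtain ⟨R, hR, hRy⟩ := exists_isLocPair_of_prime hc (prime_right_sub (k := k) 0)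
    have := (h.isPrimitiveAt_affine hc hR ⟨_, hRy⟩ hh hvx hvy).ne_zero
    simp at this
  have hu : IsUnitAt Q (h' / g) := by
    refine isUnitAt_of_forall_divisorial hc hQ (div_ne_zero hh hg) fun R hR hD hQR => ?_
    have hp := h.isPrimitiveAt_affine hc hR hD hh hvx hvy
    obtain ⟨c, hcu, e⟩ := (hR.isGenerator_tangentStalk (F.line.smul_mem _ hv) hp).exists_isUnitAt
      (hR.isGenerator_tangentStalk hv' (hvQ.mono hQR)) hp.ne_zero
    have e' : (1 - c * (h'⁻¹ * g)) • v' = 0 := by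
      rw [sub_smul, one_smul, mul_smul, mul_smul, ← e, sub_self]
    have e'' := (smul_eq_zero.1 e').resolve_right hvQ.ne_zero
    have ec : h' / g = c := by
      field_simp at e'' ⊢
      linear_combination e''
    rwa [ec]
  have hp := hvQ.smul_exceptional hc hQ hx hy hE hEx hQE
  have hcan := canonicalDivisor_eq (X := X) hdiv
    (hE.isGenerator_tangentStalk (F.line.smul_mem x hv') hp) hp.ne_zero (div_ne_zero hg hx0)
  rw [smul_smul, div_mul_cancel₀ _ hx0, hdiv.ordAt_div hg hx0, hEx.ordAt_self] at hcan
  have h0 := hdiv.ordAt_isUnitAt (hu.mono hQE.1)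
  rw [hdiv.ordAt_div hh hg] at h0
  rw [hcan]
  omega

end BlownUpFoliation

/-! ## Linear and numerical equivalence -/

section Equivalence

variable {k K : Type*} [Field k] [Field K] [Algebra k K] {X : Set (LocalSubring K)}

theorem LinEquiv.symm (hX : ∀ C : PrimeDivisor X, IsDivisorial C.1) {D D' : Divisor X}
    (h : LinEquiv D D') : LinEquiv D' D := by
  obtain ⟨f, hf, e⟩ := h
  refine ⟨f⁻¹, inv_ne_zero hf, fun C => ?_⟩
  rw [(hX C).ordAt_inv hf, ← e, neg_sub]

theorem LinEquiv.trans (hX : ∀ C : PrimeDivisor X, IsDivisorial C.1) {D D' D'' : Divisor X}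
    (h : LinEquiv D D') (h' : LinEquiv D' D'') : LinEquiv D D'' := by
  obtain ⟨f, hf, e⟩ := h
  obtain ⟨g, hg, e'⟩ := h'
  refine ⟨f * g, mul_ne_zero hf hg, fun C => ?_⟩
  rw [(hX C).ordAt_mul hf hg, ← e, ← e', sub_add_sub_cancel]

/-- Linearly equivalent divisors are numerically equivalent. -/
theorem LinEquiv.numEquiv (hX : ∀ C : PrimeDivisor X, IsDivisorial C.1) {D D' : Divisor X}
    (h : LinEquiv D D') : NumEquiv D D' := by
  -- `intersection` refers to its first divisor only through linear equivalence.
  have key : ∀ D'', LinEquiv D D'' ↔ LinEquiv D' D'' := fun D'' =>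
    ⟨(h.symm hX).trans hX, h.trans hX⟩
  intro C
  simp only [intersection, key]

theorem single_eq_of_apply {C f : PrimeDivisor X} {n : ℤ}
    (h1 : C.1 = f.1 → n = 1) (h0 : C.1 ≠ f.1 → n = 0) : single f C = n := by
  unfold single
  split_ifs with h
  · exact (h1 (congrArg Subtype.val h)).symm
  · exact (h0 fun e => h (Subtype.ext e)).symm

theorem isEffective_single (E : PrimeDivisor X) : IsEffective (single E) := by
  refine ⟨(Set.finite_singleton E).subset fun C hC => ?_, fun C => ?_⟩
  · by_contra h
    exact hC (if_neg h)
  · unfold single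
    split_ifs <;> norm_num

theorem single_self (E : PrimeDivisor X) : single E E = 1 := if_pos rfl

theorem hasPFactor_of_apply_eq {p : ℕ} {D : Divisor X} (hD : ∀ C, 0 ≤ D C) {E : PrimeDivisor X}
    (hE : D E = p) : HasPFactor p D := by
  refine ⟨single E, isEffective_single E, fun h => ?_, fun C => ?_⟩
  · have := congrFun h E
    rw [single_self] at this
    exact one_ne_zero this
  · by_cases h : C = E
    · rw [h, single_self, mul_one, hE]
    · rw [single, if_neg h, mul_zero]
      exact hD C

end Equivalence

/-! ## The class of the canonical divisor -/

section CanonicalClass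

variable {k K : Type*} [Field k] [Field K] [Algebra k K] {Q : LocalSubring K} {x y : K}
  {F : Foliation k K} {v v' : Derivation k K K} {d : ℕ} {a : Fin 3 → K} {X : Set (LocalSubring K)}

/-- Orders are compared along three kinds of curves: the exceptional curve, other curves on which
`t` is regular, and the fibre `t = ∞`. -/
theorem linEquiv_canonicalDivisor (h : IsDefiningForm F d ![1, x, y] a)
    (hc : IsCoordinates k x y) (hQ : IsLocPair k x y Q) (hx : VanishesAt Q x)
    (hy : VanishesAt Q y) (hv' : v' ∈ F.line) (hvQ : IsPrimitiveAt Q x y v')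
    (hX : X = hirzebruch k 1 (y / x) x) {f m : PrimeDivisor X} (hf : IsFibre k (y / x) f)
    (hm : IsPositiveSection k 1 (y / x) x m) (hv : v ∈ F.line) (hv0 : v ≠ 0) :
    LinEquiv (canonicalDivisor X F v) (-single f + (d : ℤ) • single m) := by
  have hc' := hc.div_left
  have hx0 := hc.left_ne_zero
  have hy0 := hc.right_ne_zero
  have ht0 := hc'.left_ne_zero
  have hyx : y / x * x = y := div_mul_cancel₀ _ hx0
  have hY : ∀ C : PrimeDivisor X, C.1 ∈ hirzebruch k 1 (y / x) x := fun C => hX ▸ C.2.1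
  obtain ⟨P, hP, hmP⟩ := hm
  obtain ⟨h', hh, hvx, hvy⟩ := h.exists_factor hc hv hv0
  obtain ⟨φ, hφ0, hφ⟩ := exists_fibre_function hc' (hY f) f.2.2 hf
  set ψ := x⁻¹ - Polynomial.aeval (y / x) P with hψ
  have hψ0 : ψ ≠ 0 := (isUniformizerAt_section hc' (hY m) m.2.2 hP hmP).1
  have hψx := mul_ne_zero hψ0 hx0
  -- With `L` the line at infinity, `x` has divisor `E + {t = ∞} - L`, `φ` has `f - {t = ∞}`, and `ψ
  -- x` has `m - L`. The quotient has divisor `f - d m + E + (d - 1) L - div h'`, whose last three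
  -- terms are the canonical divisor of `v`.
  refine ⟨x * φ / (h' * (ψ * x) ^ d), div_ne_zero (mul_ne_zero hx0 hφ0)
    (mul_ne_zero hh (pow_ne_zero _ hψx)), fun C => ?_⟩
  have hC := hY C
  have hdiv := isDivisorial_of_mem_hirzebruch hc' hC C.2.2
  obtain ⟨hφ1, hφ2⟩ := hφ C.1 hC C.2.2
  rw [hdiv.ordAt_div (mul_ne_zero hx0 hφ0) (mul_ne_zero hh (pow_ne_zero _ hψx)),
    hdiv.ordAt_mul hx0 hφ0, hdiv.ordAt_mul hh (pow_ne_zero _ hψx), hdiv.ordAt_pow hψx]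
  simp only [Pi.add_apply, Pi.neg_apply, Pi.smul_apply, smul_eq_mul]
  by_cases ht : y / x ∈ C.1.toSubring
  · rw [single_eq_of_apply (hφ1 ht).1 (hφ1 ht).2]
    by_cases hxC : VanishesAt C.1 x
    · have hE := isLocPair_of_mem hc' hC ht hxC.mem
      have hyC : VanishesAt C.1 y := hyx ▸ hxC.mul_left ht
      rw [h.canonicalDivisor_exceptional hc hv hh hvx hvy hQ hx hy hv' hvQ hE
        (isUniformizerAt_negative_section hc' hC C.2.2 ht hxC)
        (le_of_vanishesAt hQ hx hy hE.algebraMap_mem hxC hyC),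
        (isUniformizerAt_negative_section hc' hC C.2.2 ht hxC).ordAt_self,
        ordAt_section_mul_of_vanishesAt hc' hC C.2.2 ht hxC,
        single_eq_of_apply (C := C) (f := m) (n := 0)]
      · ring
      · intro e
        exact absurd (e ▸ (isLocPair_of_section hc' (hY m) m.2.2 hP hmP).right_mem)
          (hxC.inv_notMem hx0)
      · exact fun _ => rfl
    · have hxi : x⁻¹ ∈ C.1.toSubring := by
        rcases hdiv.mem_or_inv_mem x with hm' | hm'
        · exact ((isUnitAt_or_vanishesAt hm').resolve_right hxC).inv_mem
        · exact hm'
      obtain ⟨hs1, hs2⟩ := ordAt_section hc' (hY m) m.2.2 hP hmP hC C.2.2 ht hxi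
      rw [single_eq_of_apply hs1 hs2, h.canonicalDivisor_infinity hc hv hh hvx hvy
        (isLocPair_of_inv_mem hc' hC ht hxi) hdiv, hdiv.ordAt_mul hψ0 hx0]
      ring
  · have hti := vanishesAt_inv_of_notMem hdiv ht
    have hyi : y⁻¹ ∈ C.1.toSubring := by
      rcases hdiv.mem_or_inv_mem y with hm' | hm'
      · refine ((isUnitAt_or_vanishesAt hm').resolve_right fun hyC => ht ?_).inv_mem
        exact mem_of_negative_section hc' hC C.2.2 (by rwa [hyx])
      · exact hm'
    have hloc : IsLocPair k (x / y) y⁻¹ C.1 := by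
      have := hC
      rw [← hirzebruch_one_symm ht0] at this
      have := isLocPair_of_inv_mem hc'.inv_left_mul this hti.mem (by rwa [hyx])
      rwa [inv_div, hyx] at this
    have hψt := isUnitAt_section_div hc' hC C.2.2 hP ht (by rwa [hyx])
    have hψo := hdiv.ordAt_isUnitAt hψt
    rw [hdiv.ordAt_div hψ0 ht0] at hψo
    have hto := hdiv.ordAt_div hy0 hx0
    -- Along `t = ∞` the roles of `x` and `y` are exchanged, which turns `a₂ ∂_x - a₁ ∂_y` into its
    -- negative.
    have hh' : -h' ≠ 0 := neg_ne_zero.2 hh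
    have hφo := hdiv.ordAt_div hφ0 ht0
    have hneg : ordAt C.1 (-h') = ordAt C.1 h' := by
      rw [neg_eq_neg_one_mul, hdiv.ordAt_mul (neg_ne_zero.2 one_ne_zero) hh,
        hdiv.ordAt_isUnitAt IsUnitAt.one.neg, zero_add]
    rw [single_eq_of_apply (hφ2 ht).1 (hφ2 ht).2, single_eq_of_apply (C := C) (f := m) (n := 0),
      h.swap.canonicalDivisor_infinity hc.symm hv hh' (by simp [hvy]) (by simp [hvx]) hloc hdiv,
      hdiv.ordAt_mul hψ0 hx0, hφo, hneg]
    · linear_combination ((d : ℤ) - 1) * hto + (d : ℤ) * hψo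
    · intro e
      exact absurd (e ▸ (isLocPair_of_section hc' (hY m) m.2.2 hP hmP).left_mem) ht
    · exact fun _ => rfl

/-- On a prime divisor over `Q` both `s = x` and `t s = y` vanish. This forces `t` to be regular
there, and the negative section is the only such curve. -/
theorem exists_exceptional (hc : IsCoordinates k x y) (hQ : IsLocPair k x y Q)
    (hx : VanishesAt Q x) (hy : VanishesAt Q y) (hX : X = hirzebruch k 1 (y / x) x) :
    ∃ E : PrimeDivisor X, IsLocPair k (y / x) x E.1 ∧ IsUniformizerAt E.1 x ∧
      ∀ C : PrimeDivisor X, Q ≤ C.1 ↔ C = E := by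
  have hc' := hc.div_left
  have hyx : y / x * x = y := div_mul_cancel₀ _ hc.left_ne_zero
  obtain ⟨E, hE, hEx⟩ := exists_negative_section hc'
  have hEX : E ∈ hirzebruch k 1 (y / x) x := mem_hirzebruch_one.2 (Or.inl hE)
  refine ⟨⟨E, hX ▸ hEX, hEx.isDiscreteValuationRing⟩, hE, hEx, fun C => ⟨fun h => ?_, ?_⟩⟩
  · have hC : C.1 ∈ hirzebruch k 1 (y / x) x := hX ▸ C.2.1
    obtain ⟨-, hvan⟩ := localSubring_le_iff.1 h
    have ht := mem_of_negative_section hc' hC C.2.2 (by rw [hyx]; exact hvan y hy)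
    exact Subtype.ext (eq_of_negative_section hc' hC hEX C.2.2 hEx.isDiscreteValuationRing ht
      hE.left_mem (hvan x hx) hEx.2.1)
  · rintro rfl
    have hyE := hEx.2.1.mul_left hE.left_mem
    rw [hyx] at hyE
    exact le_of_vanishesAt hQ hx hy hE.algebraMap_mem hEx.2.1 hyE

end CanonicalClass

end FoliatedSurface

end

/-! ### The proposition. -/

theorem mainTheorem10 {k K : Type*} [Field k] [IsAlgClosed k] [Field K] [Algebra k K]
    (p : ℕ) [Fact p.Prime] [CharP k p]
    (x y : K) (hxy : FoliatedSurface.IsCoordinates k x y)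
    (d : ℕ) (F : FoliatedSurface.Foliation k K) (hd : FoliatedSurface.HasDegree x y F d)
    (hF : ¬ FoliatedSurface.IsPClosed p (FoliatedSurface.projectivePlane k x y) F)
    (Q : LocalSubring K)
    (hQ : FoliatedSurface.IsClosedPoint (FoliatedSurface.projectivePlane k x y) Q)
    (hsing : ¬ FoliatedSurface.IsSingular F Q)
    (hsupp : ¬ FoliatedSurface.MemSupport Q
      (FoliatedSurface.pDivisor p (FoliatedSurface.projectivePlane k x y) F)) :
    let Y := FoliatedSurface.blowup (FoliatedSurface.projectivePlane k x y) Q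
    ¬ FoliatedSurface.IsPClosed p Y F ∧
    (∃ E : FoliatedSurface.PrimeDivisor Y,
      (∀ C : FoliatedSurface.PrimeDivisor Y, FoliatedSurface.IsExceptional Q C ↔ C = E) ∧
      FoliatedSurface.pDivisor p Y F E = p) ∧
    FoliatedSurface.HasPFactor p (FoliatedSurface.pDivisor p Y F) ∧
    ∃ t s : K, FoliatedSurface.IsCoordinates k t s ∧ Y = FoliatedSurface.hirzebruch k 1 t s ∧
      ∀ f m : FoliatedSurface.PrimeDivisor Y,
        FoliatedSurface.IsFibre k t f → FoliatedSurface.IsPositiveSection k 1 t s m →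
        ∀ v ∈ F.line, v ≠ 0 →
          FoliatedSurface.NumEquiv (FoliatedSurface.canonicalDivisor Y F v)
            (-FoliatedSurface.single f + (d : ℤ) • FoliatedSurface.single m) := by
  obtain ⟨u, w, hc, hX, ⟨a, ha⟩, hQuw, hu, hw⟩ :=
    FoliatedSurface.exists_coordinates_origin hxy hd hQ
  obtain ⟨v₀, hv₀, hp⟩ := FoliatedSurface.exists_pPow_notMem hF
  obtain ⟨v₁, hv₁, hprim⟩ := FoliatedSurface.exists_isPrimitiveAt_of_not_isSingular hQuw hsing
  -- `v₀` witnesses the failure of p-closedness and `v₁` has no zero at `Q`; one vector field with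
  -- both properties is needed.
  have hp₁ := FoliatedSurface.pPow_notMem_of_ne_zero hv₀ hp hv₁ hprim.ne_zero
  rw [← hX] at hsupp
  have hunit := FoliatedSurface.isUnitAt_pContract hc hQuw hv₁ hprim hp₁ hsupp
  intro Y
  have hY : Y = FoliatedSurface.hirzebruch k 1 (w / u) u := by
    rw [← FoliatedSurface.blowup_eq_hirzebruch hc hQuw hu hw, hX]
  have hc' := hc.div_left
  obtain ⟨E, hE, hEu, hexc⟩ := FoliatedSurface.exists_exceptional hc hQuw hu hw hY
  have hpE : FoliatedSurface.pDivisor p Y F E = p :=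
    FoliatedSurface.pDivisor_exceptional hc hQuw hu hw hv₁ hprim hp₁ hunit hE hEu ((hexc E).2 rfl)
  have hmem : ∀ C : FoliatedSurface.PrimeDivisor Y,
      C.1 ∈ FoliatedSurface.hirzebruch k 1 (w / u) u := fun C => hY ▸ C.2.1
  -- The base coordinate is the slope `w / u` of the lines through `Q`, and the fibre coordinate is
  -- `u`.
  refine ⟨hY ▸ FoliatedSurface.not_isPClosed_hirzebruch hc' hv₀ hp, ⟨E, hexc, hpE⟩,
    FoliatedSurface.hasPFactor_of_apply_eq
      (fun C => FoliatedSurface.pDivisor_nonneg_of_hirzebruch hc' hv₀ hp C (hmem C)) hpE,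
    w / u, u, hc', hY, fun f m hf hm v hv hv0 => ?_⟩
  exact (FoliatedSurface.linEquiv_canonicalDivisor ha hc hQuw hu hw hv₁ hprim hY hf hm hv
    hv0).numEquiv fun C => FoliatedSurface.isDivisorial_of_mem_hirzebruch hc' (hmem C) C.2.2
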